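/- Let $M$ be a nonempty smooth manifold of dimension $4n$ ($n\ge 1$) with an $\mathrm{Sp}(1)\mathrm{GL}(n,\mathbb H)$-structure $Q$ that admits a torsion-free connection; thus $M$ is a quaternionic manifold if $n\ge 2$, while for $n=1$ every self-dual conformal $4$-manifold is included. Here $\mathrm{Sp}(1)\mathrm{GL}(n,\mathbb H)$ is the group of the transformations $v\mapsto q\,A(v)$ of $\mathbb H^n$ with $q$ a unit quaternion and $A$ an automorphism of the left $\mathbb H$-module $\mathbb H^n$. Left multiplication by $\mathrm{Sp}(1)$ on $\mathbb H^n$ induces an $\mathrm{Sp}(1)$-action on the exterior forms on $\mathbb H^n$. Let $E_{k,r}\subseteq\Lambda^kT^*M$ be the bundle associated with $Q$ and the sum of all irreducible $\mathrm{Sp}(1)$-representations of highest weight $r$ in the $k$-forms on $\mathbb H^n$, so that $\Lambda^kT^*M=\bigoplus_r E_{k,r}$; let $\pi_{k,r}:\Lambda^kT^*M\to E_{k,r}$ be the natural projection, and let $$\mathcal D=\pi_{k+1,r+1}\circ d:\ C^\infty(E_{k,r})\to C^\infty(E_{k+1,r+1}).$$ For $0\le k\le 2n$ consider the complex $$0\to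 E_{2k,0}\xrightarrow{\mathcal D}E_{2k+1,1}\xrightarrow{\mathcal D}E_{2k+2,2}\xrightarrow{\mathcal D}\cdots\xrightarrow{\mathcal D}E_{2n+k,2n-k}\xrightarrow{\mathcal D}0 .$$ It is called elliptic at one of its terms if the sequence of principal symbols $\sigma_{\mathcal D}(x,\xi)$ is exact at that term for all $x\in M$ and all $0\ne\xi\in T^*_xM$. Then: 1. If $2k\ge 4$, the complex is elliptic everywhere except at $E_{2k,0}$ and $E_{2k+1,1}$, where it is not elliptic (for $k=2n$ the complex consists of $E_{4n,0}$ only, and the claim about $E_{2k+1,1}$ is void). 2. If $k=1$, the complex is elliptic everywhere except at $E_{3,1}$, where it is not elliptic. 3. If $k=0$, the complex is elliptic everywhere. -/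

import Mathlib

open scoped Manifold ContDiff Quaternion Topology

noncomputable section

namespace QuaternionicForms

/-! ### The model space `ℍⁿ`, its forms and the group `Sp(1)GL(n,ℍ)` -/

/-- `ℍⁿ`, a left `ℍ`-module. -/
abbrev HSpace (n : ℕ) : Type := Fin n → ℍ[ℝ]

/-- Membership in `Sp(1)GL(n,ℍ)`: the transformations `v ↦ q A(v)` of `ℍⁿ` with `q` a unit
quaternion and `A` an automorphism of the left `ℍ`-module `ℍⁿ`. -/
def MemSp1GL {n : ℕ} (g : HSpace n ≃L[ℝ] HSpace n) : Prop :=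
  ∃ q : ℍ[ℝ], ‖q‖ = 1 ∧ ∃ A : HSpace n ≃ₗ[ℍ[ℝ]] HSpace n, ∀ v, g v = q • A v

/-- Membership in the Lie algebra `sp(1) + gl(n,ℍ)` of `Sp(1)GL(n,ℍ)`: the endomorphisms
`v ↦ a v + A(v)` with `a` an imaginary quaternion and `A` an `ℍ`-linear endomorphism. -/
def MemLieSp1GL {n : ℕ} (T : HSpace n → HSpace n) : Prop :=
  ∃ a : ℍ[ℝ], a.re = 0 ∧ ∃ A : HSpace n →ₗ[ℍ[ℝ]] HSpace n, ∀ v, T v = a • v + A v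

/-- Left multiplication by a quaternion. -/
def leftMul (n : ℕ) (q : ℍ[ℝ]) : HSpace n →L[ℝ] HSpace n :=
  q • ContinuousLinearMap.id ℝ (HSpace n)

/-- The action of `q ∈ sp(1) = Im ℍ` on the alternating forms on `ℍⁿ` induced from left
multiplication on `ℍⁿ`: the derivative at `t = 0` of `exp(-tq)^* α`, that is
`(q · α)(v₁, …, v_k) = -∑ⱼ α(v₁, …, q vⱼ, …, v_k)`. -/
def sp1Action {n k : ℕ} {F : Type*} [NormedAddCommGroup F] [NormedSpace ℝ F]
    (q : ℍ[ℝ]) (α : HSpace n [⋀^Fin k]→L[ℝ] F) : HSpace n [⋀^Fin k]→L[ℝ] F :=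
  α.fderivCompContinuousLinearMap (ContinuousLinearMap.id ℝ (HSpace n)) (-leftMul n q)

/-- The imaginary unit `i`; in `sp(1) = Im ℍ` one has `[i,j] = 2k`, `[j,k] = 2i`, `[k,i] = 2j`. -/
def qI : ℍ[ℝ] := ⟨0, 1, 0, 0⟩

/-- The imaginary unit `j`. -/
def qJ : ℍ[ℝ] := ⟨0, 0, 1, 0⟩

/-- The imaginary unit `k`. -/
def qK : ℍ[ℝ] := ⟨0, 0, 0, 1⟩

/-- `α` is a highest weight vector of weight `r` (or zero) for `sp(1) ⊗ ℂ = sl(2,ℂ)`: the Cartan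
element `H = -√-1 I` acts by `r`, and the raising operator `J - √-1 K` (for which
`[H, J - √-1 K] = 2 (J - √-1 K)`) kills `α`. -/
def IsHighestWeight {n k : ℕ} (r : ℕ) (α : HSpace n [⋀^Fin k]→L[ℝ] ℂ) : Prop :=
  sp1Action qI α = (Complex.I * (r : ℂ)) • α ∧ sp1Action qJ α - Complex.I • sp1Action qK α = 0

/-- The sum of all the irreducible `sp(1)`-representations of highest weight `r` in the
complex-valued `k`-forms on `ℍⁿ`: the smallest `sp(1)`-invariant complex subspace that contains
all highest weight vectors of weight `r`. -/
def modelEC (n k r : ℕ) : Submodule ℂ (HSpace n [⋀^Fin k]→L[ℝ] ℂ) :=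
  sInf {W | (∀ q : ℍ[ℝ], q.re = 0 → ∀ α ∈ W, sp1Action q α ∈ W) ∧
    ∀ α, IsHighestWeight r α → α ∈ W}

/-- The real `k`-forms on `ℍⁿ` in `modelEC n k r`. -/
def modelE (n k r : ℕ) : Submodule ℝ (HSpace n [⋀^Fin k]→L[ℝ] ℝ) :=
  ((modelEC n k r).restrictScalars ℝ).comap
    (ContinuousLinearMap.compContinuousAlternatingMapₗ ℝ (HSpace n) ℝ ℂ Complex.ofRealCLM)

/-! ### Quaternionic manifolds -/

section Manifold

variable {n : ℕ} {M : Type*} [TopologicalSpace M]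
  [ChartedSpace (EuclideanSpace ℝ (Fin (4 * n))) M]

/-- `p` is a smooth frame field on `U`, i.e. all the vector fields `y ↦ p_y⁻¹(v)` are smooth. -/
def SmoothFrameOn [IsManifold (𝓡 (4 * n)) ∞ M]
    (p : ∀ y : M, TangentSpace (𝓡 (4 * n)) y ≃L[ℝ] HSpace n) (U : Set M) : Prop :=
  ∀ v : HSpace n, ContMDiffOn (𝓡 (4 * n)) (𝓡 (4 * n)).tangent ∞
    (fun y => (⟨y, (p y).symm v⟩ : TangentBundle (𝓡 (4 * n)) M)) U

variable (n M) in
/-- An `Sp(1)GL(n,ℍ)`-structure on a `4n`-manifold: a principal subbundle of the frame bundle with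
structure group `Sp(1)GL(n,ℍ)`. -/
structure Sp1GLStructure [IsManifold (𝓡 (4 * n)) ∞ M] where
  /-- The frames at `x` that belong to the structure. -/
  frames : ∀ x : M, Set (TangentSpace (𝓡 (4 * n)) x ≃L[ℝ] HSpace n)
  /-- Each fibre is one orbit of the structure group. -/
  mem_iff : ∀ (x : M), ∀ p ∈ frames x, ∀ p' : TangentSpace (𝓡 (4 * n)) x ≃L[ℝ] HSpace n,
    p' ∈ frames x ↔ MemSp1GL (p.symm.trans p')
  /-- There are smooth local sections. -/
  exists_section : ∀ x : M, ∃ U ∈ 𝓝 x,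
    ∃ p : ∀ y : M, TangentSpace (𝓡 (4 * n)) y ≃L[ℝ] HSpace n,
      (∀ y ∈ U, p y ∈ frames y) ∧ SmoothFrameOn p U

variable [IsManifold (𝓡 (4 * n)) ∞ M]

/-- A linear connection is a connection on the `Sp(1)GL(n,ℍ)`-structure `Q`: in each smooth local
section of `Q` the connection form takes its values in the Lie algebra of the structure group. -/
def Sp1GLStructure.IsPreservedBy (Q : Sp1GLStructure n M)
    (cov : CovariantDerivative (𝓡 (4 * n)) (EuclideanSpace ℝ (Fin (4 * n)))
      (TangentSpace (𝓡 (4 * n)) : M → Type _)) : Prop :=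
  ∀ (U : Set M) (p : ∀ y : M, TangentSpace (𝓡 (4 * n)) y ≃L[ℝ] HSpace n), IsOpen U →
    (∀ y ∈ U, p y ∈ Q.frames y) → SmoothFrameOn p U →
    ∀ y ∈ U, ∀ X : TangentSpace (𝓡 (4 * n)) y,
      MemLieSp1GL fun v => p y (cov (fun z => (p z).symm v) y X)

/-- The structure `Q` is integrable, so that `(M, Q)` is a quaternionic manifold: `Q` admits a
(smooth) torsion-free connection. For `n = 1`, where an `Sp(1)GL(1,ℍ)`-structure is an oriented
conformal structure, this always holds; self-dual conformal 4-manifolds are thus included. -/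
def Sp1GLStructure.IsQuaternionic (Q : Sp1GLStructure n M) : Prop :=
  ∃ cov : CovariantDerivative (𝓡 (4 * n)) (EuclideanSpace ℝ (Fin (4 * n)))
      (TangentSpace (𝓡 (4 * n)) : M → Type _),
    cov.ContMDiffCovariantDerivative ∞ ∧ cov.torsion = 0 ∧ Q.IsPreservedBy cov

/-! ### Differential forms and the exterior derivative -/

variable (n) in
/-- The real `k`-covectors at `x`: the fibre of `Λᵏ T*M`. -/
abbrev Covectors (k : ℕ) (x : M) : Type :=
  TangentSpace (𝓡 (4 * n)) x [⋀^Fin k]→L[ℝ] ℝ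

/-- The coordinate expression of a differential `k`-form `η` in the chart at `x`: its pullback
along the inverse of the chart. -/
def localRep {k : ℕ} (η : ∀ y : M, Covectors n k y) (x : M)
    (e : EuclideanSpace ℝ (Fin (4 * n))) :
    EuclideanSpace ℝ (Fin (4 * n)) [⋀^Fin k]→L[ℝ] ℝ :=
  (η ((extChartAt (𝓡 (4 * n)) x).symm e)).compContinuousLinearMap
    (mfderiv 𝓘(ℝ, EuclideanSpace ℝ (Fin (4 * n))) (𝓡 (4 * n))
      (extChartAt (𝓡 (4 * n)) x).symm e)

/-- Smoothness of a differential `k`-form. -/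
def SmoothForm {k : ℕ} (η : ∀ y : M, Covectors n k y) : Prop :=
  ∀ x : M, ContDiffOn ℝ ∞ (localRep η x) (extChartAt (𝓡 (4 * n)) x).target

/-- The exterior derivative on `M`, computed in the chart at each point. -/
def extD {k : ℕ} (η : ∀ y : M, Covectors n k y) (x : M) : Covectors n (k + 1) x :=
  (extDeriv (localRep η x) (extChartAt (𝓡 (4 * n)) x x)).compContinuousLinearMap
    (mfderiv (𝓡 (4 * n)) 𝓘(ℝ, EuclideanSpace ℝ (Fin (4 * n))) (extChartAt (𝓡 (4 * n)) x) x)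

/-! ### The bundles `E_{k,r}`, the operators `𝒟` and their principal symbols -/

namespace Sp1GLStructure

variable (Q : Sp1GLStructure n M)

/-- The fibre at `x` of the bundle `E_{k,r} ⊆ Λᵏ T*M`, associated with `Q` and the
subrepresentation `modelE n k r` of the `k`-forms on `ℍⁿ`. -/
def E (k r : ℕ) (x : M) : Submodule ℝ (Covectors n k x) :=
  ⨅ p ∈ Q.frames x, (modelE n k r).comap
    (ContinuousAlternatingMap.compContinuousLinearMapₗ (p.symm : HSpace n →L[ℝ] _))

open Classical in
/-- The natural projection `π_{k,r}` of `Λᵏ T*M = ⨁ₛ E_{k,s}` onto `E_{k,r}` (the value of the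
second branch is irrelevant, as the two spaces are complementary). -/
def proj (k r : ℕ) (x : M) : Covectors n k x →ₗ[ℝ] Q.E k r x :=
  if h : IsCompl (Q.E k r x) (⨆ s : ℕ, ⨆ _ : s ≠ r, Q.E k s x) then
    Submodule.projectionOnto _ _ h
  else 0

/-- The operator `𝒟 = π_{k+1,r+1} ∘ d`, to be applied to sections of `E_{k,r}`. -/
def opD (k r : ℕ) (η : ∀ y : M, Covectors n k y) (x : M) : Q.E (k + 1) (r + 1) x :=
  Q.proj (k + 1) (r + 1) x (extD η x)

/-- `σ` is the principal symbol at the covector `ξ` at `x` of the first order operator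
`𝒟 : C^∞(E_{k,r}) → C^∞(E_{k+1,r+1})`: one has `σ (s x) = 𝒟 (f s) (x)` for each smooth section `s`
of `E_{k,r}` and each smooth function `f` with `f x = 0` and `df_x = ξ`. -/
def IsPrincipalSymbol (k r : ℕ) (x : M) (ξ : TangentSpace (𝓡 (4 * n)) x →L[ℝ] ℝ)
    (σ : Q.E k r x →ₗ[ℝ] Q.E (k + 1) (r + 1) x) : Prop :=
  ∀ (f : M → ℝ) (s : ∀ y : M, Q.E k r y), ContMDiff (𝓡 (4 * n)) 𝓘(ℝ, ℝ) ∞ f → f x = 0 →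
    mfderiv (𝓡 (4 * n)) 𝓘(ℝ, ℝ) f x = ξ → SmoothForm (fun y => (s y : Covectors n k y)) →
    σ (s x) = Q.opD k r (fun y => f y • (s y : Covectors n k y)) x

open Classical in
/-- The principal symbol `σ_𝒟(x, ξ) : E_{k,r} → E_{k+1,r+1}` (it exists and is unique). -/
def symbol (k r : ℕ) (x : M) (ξ : TangentSpace (𝓡 (4 * n)) x →L[ℝ] ℝ) :
    Q.E k r x →ₗ[ℝ] Q.E (k + 1) (r + 1) x :=
  if h : ∃ σ, Q.IsPrincipalSymbol k r x ξ σ then h.choose else 0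

/-- The upward complex `0 → E_{2k,0} → E_{2k+1,1} → E_{2k+2,2} → …` is elliptic at its `j`-th term
`E_{2k+j,j}`: the principal symbol sequence is exact there for all nonzero covectors. (The last
nonzero term is `E_{2n+k,2n-k}`, for `j = 2n - k`; the map that leaves it has a zero target.) -/
def EllipticAt (k : ℕ) : ℕ → Prop
  | 0 => ∀ (x : M) (ξ : TangentSpace (𝓡 (4 * n)) x →L[ℝ] ℝ), ξ ≠ 0 →
      Function.Injective (Q.symbol (2 * k) 0 x ξ)
  | j + 1 => ∀ (x : M) (ξ : TangentSpace (𝓡 (4 * n)) x →L[ℝ] ℝ), ξ ≠ 0 →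
      Function.Exact (Q.symbol (2 * k + j) j x ξ) (Q.symbol (2 * k + j + 1) (j + 1) x ξ)

end Sp1GLStructure

end Manifold

end QuaternionicForms

end

/-! The symbol of `𝒟` at `ξ` sends `α` to the projection of `ξ ∧ α` to the next type, so ellipticity
is a question about forms on `ℍⁿ` (`symbol_apply`, `exact_symbol_iff`, `injective_symbol_iff`).
Types are eigenspaces of the Casimir operator `I² + J² + K²`; it is real and invariant under the
structure group, so types make sense on `M` and pass to and from complex forms.

Exactness. Over `ℂ` a form of type `r` is uniquely `∑ (r - i)! Yⁱ aᵢ`, `0 ≤ i ≤ r`, with highest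
weight vectors `aᵢ` of weight `r`. A real covector `ξ ≠ 0` is `e₁ + f₂`, with `e₁` of weight `1`,
`f₂ = Y e₂` of weight `-1`, and `e₁`, `e₂` taken from two transversal copies of the standard
representation. Modulo lower type, multiplication by `ξ` becomes, up to the factor `1/(r + 1)`, the
map `aᵢ ↦ e₁ aᵢ + e₂ aᵢ₋₁` (`wedge_assemble`), which is multiplication by `e₁ + t e₂` on the
polynomial `∑ aᵢ tⁱ`. Its kernel is found coefficient by coefficient, because a highest weight
vector of positive weight killed by `e₁` is `e₁` times a highest weight vector (`Leg.exists_eq_e`).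
The solution may have degree one too large; its top coefficient is removed using that a highest
weight vector of weight at least `2` killed by `e₁` and `e₂` is a multiple of `e₁ e₂`
(`exists_eq_e_e`). This needs `r > 0`, except on functions, where the top coefficient does no harm.
Hence the complex is exact at types at least `2`, and at type `1` when `k = 0`.

The low terms. The product of `ξ` with an invariant form is already of type `1`, so the first symbol
is plain multiplication by `ξ`. It is injective on functions, and on invariant two-forms because
those killed by `ξ` are killed by `Iξ`, `Jξ`, `Kξ` too. For the failures, `φ = ξ ∧ Iξ - Jξ ∧ Kξ` is
invariant and `φ² = -2 ξ ∧ Iξ ∧ Jξ ∧ Kξ`. If `ρ ≠ 0` is invariant and involves only the other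
quaternionic lines, then `φ² ρ` is a nonzero invariant form killed by `ξ`. Moreover `α = Iξ ∧ φ ρ`
has type `1` and `ξ ∧ α` is nonzero of type `0`, so `α` is in the kernel of the symbol but is not a
multiple of `ξ`. -/

open scoped Manifold ContDiff Quaternion Topology

noncomputable section

namespace QuaternionicForms

/-! ### Wedge products with one-forms, contractions and derivations -/

section Calculus

/-- The `𝕜`-valued alternating `k`-forms on `E`, as a `𝕜`-module. -/
def Form (𝕜 : Type*) [RCLike 𝕜] (E : Type*) [NormedAddCommGroup E] [NormedSpace ℝ E] (k : ℕ) :=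
  E [⋀^Fin k]→L[ℝ] 𝕜

/-- The `𝕜`-valued one-forms on `E`, as a `𝕜`-module. -/
def Cov (𝕜 : Type*) [RCLike 𝕜] (E : Type*) [NormedAddCommGroup E] [NormedSpace ℝ E] :=
  E →L[ℝ] 𝕜

variable {𝕜 : Type*} [RCLike 𝕜] {E : Type*} [NormedAddCommGroup E] [NormedSpace ℝ E]
  {E' : Type*} [NormedAddCommGroup E'] [NormedSpace ℝ E'] {k : ℕ}

instance : AddCommGroup (Form 𝕜 E k) := inferInstanceAs (AddCommGroup (E [⋀^Fin k]→L[ℝ] 𝕜))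
instance : Module 𝕜 (Form 𝕜 E k) := inferInstanceAs (Module 𝕜 (E [⋀^Fin k]→L[ℝ] 𝕜))
instance : FunLike (Form 𝕜 E k) (Fin k → E) 𝕜 :=
  inferInstanceAs (FunLike (E [⋀^Fin k]→L[ℝ] 𝕜) (Fin k → E) 𝕜)
instance : AddCommGroup (Cov 𝕜 E) := inferInstanceAs (AddCommGroup (E →L[ℝ] 𝕜))
instance : Module 𝕜 (Cov 𝕜 E) := inferInstanceAs (Module 𝕜 (E →L[ℝ] 𝕜))
instance : FunLike (Cov 𝕜 E) E 𝕜 := inferInstanceAs (FunLike (E →L[ℝ] 𝕜) E 𝕜)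

namespace Form

@[ext] lemma ext {α β : Form 𝕜 E k} (h : ∀ v, α v = β v) : α = β := DFunLike.ext _ _ h
@[simp] lemma add_apply (α β : Form 𝕜 E k) (v : Fin k → E) : (α + β) v = α v + β v := rfl
@[simp] lemma sub_apply (α β : Form 𝕜 E k) (v : Fin k → E) : (α - β) v = α v - β v := rfl
@[simp] lemma neg_apply (α : Form 𝕜 E k) (v : Fin k → E) : (-α) v = -α v := rfl
@[simp] lemma zero_apply (v : Fin k → E) : (0 : Form 𝕜 E k) v = 0 := rfl
@[simp] lemma smul_apply (c : 𝕜) (α : Form 𝕜 E k) (v : Fin k → E) : (c • α) v = c * α v := rfl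
lemma sum_apply {ι : Type*} (s : Finset ι) (f : ι → Form 𝕜 E k) (v : Fin k → E) :
    (∑ i ∈ s, f i) v = ∑ i ∈ s, f i v :=
  ContinuousAlternatingMap.sum_apply (R := ℝ) f v

end Form

namespace Cov

@[ext] lemma ext {ξ η : Cov 𝕜 E} (h : ∀ v, ξ v = η v) : ξ = η := DFunLike.ext _ _ h
@[simp] lemma add_apply (ξ η : Cov 𝕜 E) (v : E) : (ξ + η) v = ξ v + η v := rfl
@[simp] lemma sub_apply (ξ η : Cov 𝕜 E) (v : E) : (ξ - η) v = ξ v - η v := rfl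
@[simp] lemma neg_apply (ξ : Cov 𝕜 E) (v : E) : (-ξ) v = -ξ v := rfl
@[simp] lemma zero_apply (v : E) : (0 : Cov 𝕜 E) v = 0 := rfl
@[simp] lemma smul_apply (c : 𝕜) (ξ : Cov 𝕜 E) (v : E) : (c • ξ) v = c * ξ v := rfl

/-- Precomposition of a one-form with a linear map. -/
def comp (ξ : Cov 𝕜 E) (L : E' →L[ℝ] E) : Cov 𝕜 E' := ContinuousLinearMap.comp ξ L

@[simp] lemma comp_apply (ξ : Cov 𝕜 E) (L : E' →L[ℝ] E) (v : E') : ξ.comp L v = ξ (L v) := rfl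
@[simp] lemma map_add (ξ : Cov 𝕜 E) (u v : E) : ξ (u + v) = ξ u + ξ v :=
  ContinuousLinearMap.map_add (R₁ := ℝ) ξ u v
@[simp] lemma map_neg (ξ : Cov 𝕜 E) (u : E) : ξ (-u) = -ξ u :=
  ContinuousLinearMap.map_neg (R := ℝ) ξ u

end Cov

/-- Pullback of forms along a linear map. -/
def Form.comp (α : Form 𝕜 E k) (L : E' →L[ℝ] E) : Form 𝕜 E' k :=
  ContinuousAlternatingMap.compContinuousLinearMap α L

@[simp] lemma Form.comp_apply (α : Form 𝕜 E k) (L : E' →L[ℝ] E) (v : Fin k → E') :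
    α.comp L v = α (fun i => L (v i)) := rfl

/-- The wedge product `ξ ∧ α` of a one-form and a `k`-form. -/
def wedgeFun (ξ : Cov 𝕜 E) (α : Form 𝕜 E k) : Form 𝕜 E (k + 1) :=
  ContinuousAlternatingMap.alternatizeUncurryFin
    (ContinuousLinearMap.smulRight (M₁ := E) (R := ℝ) (S := 𝕜) (M₂ := E [⋀^Fin k]→L[ℝ] 𝕜) ξ α)

lemma wedgeFun_apply (ξ : Cov 𝕜 E) (α : Form 𝕜 E k) (v : Fin (k + 1) → E) :
    wedgeFun ξ α v = ∑ i : Fin (k + 1), (-1) ^ (i : ℕ) * (ξ (v i) * α (i.removeNth v)) := by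
  refine (ContinuousAlternatingMap.alternatizeUncurryFin_apply _ v).trans ?_
  refine Finset.sum_congr rfl fun i _ => ?_
  rw [zsmul_eq_mul]
  push_cast
  rfl

/-- The wedge product with one-forms, as a bilinear map. -/
def wedge : Cov 𝕜 E →ₗ[𝕜] Form 𝕜 E k →ₗ[𝕜] Form 𝕜 E (k + 1) :=
  LinearMap.mk₂ 𝕜 wedgeFun
    (fun ξ η α => by
      ext v
      simp only [wedgeFun_apply, Form.add_apply, Cov.add_apply, ← Finset.sum_add_distrib]
      exact Finset.sum_congr rfl fun i _ => by ring)
    (fun c ξ α => by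
      ext v
      simp only [wedgeFun_apply, Form.smul_apply, Cov.smul_apply, Finset.mul_sum]
      exact Finset.sum_congr rfl fun i _ => by ring)
    (fun ξ α β => by
      ext v
      simp only [wedgeFun_apply, Form.add_apply, ← Finset.sum_add_distrib]
      exact Finset.sum_congr rfl fun i _ => by ring)
    (fun c ξ α => by
      ext v
      simp only [wedgeFun_apply, Form.smul_apply, Finset.mul_sum]
      exact Finset.sum_congr rfl fun i _ => by ring)

lemma wedge_eq (ξ : Cov 𝕜 E) (α : Form 𝕜 E k) : wedge ξ α = wedgeFun ξ α := rfl

lemma wedge_apply (ξ : Cov 𝕜 E) (α : Form 𝕜 E k) (v : Fin (k + 1) → E) :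
    wedge ξ α v = ∑ i : Fin (k + 1), (-1) ^ (i : ℕ) * (ξ (v i) * α (i.removeNth v)) :=
  wedgeFun_apply ξ α v

lemma Form.map_vecCons_add (α : Form 𝕜 E (k + 1)) (u v : E) (w : Fin k → E) :
    α (Matrix.vecCons (u + v) w) = α (Matrix.vecCons u w) + α (Matrix.vecCons v w) :=
  ContinuousAlternatingMap.vecCons_add (R := ℝ) α w u v

lemma Form.map_vecCons_smul (α : Form 𝕜 E (k + 1)) (c : ℝ) (v : E) (w : Fin k → E) :
    α (Matrix.vecCons (c • v) w) = c • α (Matrix.vecCons v w) :=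
  ContinuousAlternatingMap.vecCons_smul (R := ℝ) α w c v

/-- Contraction of a form with a vector. -/
def contr : E →+ Form 𝕜 E (k + 1) →ₗ[𝕜] Form 𝕜 E k where
  toFun v :=
    { toFun := fun α => ContinuousAlternatingMap.curryLeft (𝕜 := ℝ) α v
      map_add' := fun α β => by ext w; rfl
      map_smul' := fun c α => by ext w; rfl }
  map_zero' := by
    refine LinearMap.ext fun α => Form.ext fun w => ?_
    exact ContinuousAlternatingMap.map_coord_zero (R := ℝ) α (0 : Fin (k + 1)) rfl
  map_add' u v := by
    refine LinearMap.ext fun α => Form.ext fun w => ?_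
    exact α.map_vecCons_add u v w

@[simp] lemma contr_apply (v : E) (α : Form 𝕜 E (k + 1)) (w : Fin k → E) :
    contr v α w = α (Matrix.vecCons v w) := rfl

lemma contr_real_smul (c : ℝ) (v : E) (α : Form 𝕜 E (k + 1)) :
    contr (c • v) α = (c : 𝕜) • contr v α := by
  ext w
  rw [contr_apply, Form.map_vecCons_smul, RCLike.real_smul_eq_coe_mul]
  rfl

/-- Contractions determine a form of positive degree, which allows the identities below to be proved
by induction on the degree. Degree `0` admits no contraction, hence the separate rule
`contr_wedge_zero`. -/
lemma ext_contr {α β : Form 𝕜 E (k + 1)} (h : ∀ v, contr v α = contr v β) : α = β := by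
  ext w
  have := congrArg (fun γ : Form 𝕜 E k => γ (Matrix.vecTail w)) (h (Matrix.vecHead w))
  simpa using this

lemma contr_wedge_zero (v : E) (ξ : Cov 𝕜 E) (α : Form 𝕜 E 0) :
    contr v (wedge ξ α) = ξ v • α := by
  ext w
  simp only [contr_apply, wedge_apply, Form.smul_apply, Fin.sum_univ_succ, Fin.sum_univ_zero]
  simp

lemma contr_wedge (v : E) (ξ : Cov 𝕜 E) (α : Form 𝕜 E (k + 1)) :
    contr v (wedge ξ α) = ξ v • α - wedge ξ (contr v α) := by
  ext w
  rw [contr_apply, wedge_apply, Fin.sum_univ_succ]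
  simp only [Form.sub_apply, Form.smul_apply, wedge_apply, contr_apply]
  rw [sub_eq_add_neg, ← Finset.sum_neg_distrib]
  congr 1
  · simp
  · refine Finset.sum_congr rfl fun i _ => ?_
    have : (i.succ.removeNth (Matrix.vecCons v w) : Fin (k + 1) → E)
        = Matrix.vecCons v (i.removeNth w) := by
      funext j
      refine Fin.cases ?_ (fun j => ?_) j <;> simp [Fin.removeNth]
    rw [this]
    simp [pow_succ]

lemma contr_self (u : E) (α : Form 𝕜 E (k + 2)) : contr u (contr u α) = 0 :=
  ContinuousAlternatingMap.curryLeft_same (𝕜 := ℝ) α u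

lemma contr_contr_comm (u v : E) (α : Form 𝕜 E (k + 2)) :
    contr u (contr v α) = - contr v (contr u α) := by
  have h := contr_self (u + v) α
  simp only [map_add, LinearMap.add_apply, contr_self, zero_add, add_zero] at h
  exact eq_neg_of_add_eq_zero_right h

lemma wedge_wedge_comm : ∀ {k : ℕ} (ξ η : Cov 𝕜 E) (α : Form 𝕜 E k),
    wedge ξ (wedge η α) = - wedge η (wedge ξ α)
  | 0, ξ, η, α => by
    refine ext_contr fun v => ?_
    simp only [contr_wedge, contr_wedge_zero, map_neg, map_smul]
    abel
  | k + 1, ξ, η, α => by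
    refine ext_contr fun v => ?_
    simp only [contr_wedge, map_neg, map_smul, map_sub, wedge_wedge_comm ξ η (contr v α)]
    abel

lemma wedge_self_wedge (ξ : Cov 𝕜 E) (α : Form 𝕜 E k) : wedge ξ (wedge ξ α) = 0 := by
  have h := eq_neg_iff_add_eq_zero.mp (wedge_wedge_comm ξ ξ α)
  rw [← two_smul 𝕜] at h
  exact (smul_eq_zero.mp h).resolve_left two_ne_zero

lemma wedge_comp (L : E' →L[ℝ] E) (ξ : Cov 𝕜 E) (α : Form 𝕜 E k) :
    (wedge ξ α).comp L = wedge (ξ.comp L) (α.comp L) := by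
  ext v
  simp only [Form.comp_apply, wedge_apply]
  rfl

/-- The derivation `α ↦ -∑ⱼ α(…, T vⱼ, …)` of the forms on `E` induced by an endomorphism `T`. -/
def derFun (T : E →L[ℝ] E) (α : Form 𝕜 E k) : Form 𝕜 E k :=
  ContinuousAlternatingMap.fderivCompContinuousLinearMap (𝕜 := ℝ) (G := 𝕜) α
    (ContinuousLinearMap.id ℝ E) (-T)

lemma derFun_apply (T : E →L[ℝ] E) (α : Form 𝕜 E k) (v : Fin k → E) :
    derFun T α v = -∑ i, α (Function.update v i (T (v i))) := by
  refine (ContinuousAlternatingMap.fderivCompContinuousLinearMap_apply (𝕜 := ℝ) (G := 𝕜) α _ _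
    v).trans ?_
  rw [← Finset.sum_neg_distrib]
  refine Finset.sum_congr rfl fun i _ => ?_
  have : (fun j => (Function.update (fun _ => ContinuousLinearMap.id ℝ E) i (-T) j) (v j))
      = Function.update v i ((-1 : ℝ) • T (v i)) := by
    funext j
    by_cases h : j = i
    · subst h; simp
    · simp [h]
  rw [this]
  refine (ContinuousAlternatingMap.map_update_smul (R := ℝ) α v i (-1) (T (v i))).trans ?_
  rw [neg_one_smul]
  rfl

/-- The derivations of the forms on `E` induced by endomorphisms, as a bilinear map. -/
def der : (E →L[ℝ] E) →+ Form 𝕜 E k →ₗ[𝕜] Form 𝕜 E k where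
  toFun T :=
    { toFun := derFun T
      map_add' := fun α β => by
        ext v
        simp [derFun_apply, Finset.sum_add_distrib, add_comm]
      map_smul' := fun c α => by
        ext v
        simp [derFun_apply, Finset.mul_sum] }
  map_zero' := by
    ext α v
    refine (derFun_apply 0 α v).trans (neg_eq_zero.mpr (Finset.sum_eq_zero fun i _ => ?_))
    exact ContinuousAlternatingMap.map_update_zero (R := ℝ) α v i
  map_add' S T := by
    ext α v
    refine (derFun_apply (S + T) α v).trans ?_
    change _ = derFun S α v + derFun T α v
    rw [derFun_apply, derFun_apply, ← neg_add, ← Finset.sum_add_distrib]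
    refine congrArg Neg.neg (Finset.sum_congr rfl fun i _ => ?_)
    exact ContinuousAlternatingMap.map_update_add (R := ℝ) α v i _ _

lemma der_apply (T : E →L[ℝ] E) (α : Form 𝕜 E k) (v : Fin k → E) :
    der T α v = -∑ i, α (Function.update v i (T (v i))) := derFun_apply T α v

@[simp] lemma der_zero_form (T : E →L[ℝ] E) (α : Form 𝕜 E 0) : der T α = 0 := by
  ext v; simp [der_apply]

lemma contr_der (T : E →L[ℝ] E) (v : E) (α : Form 𝕜 E (k + 1)) :
    contr v (der T α) = der T (contr v α) - contr (T v) α := by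
  ext w
  simp only [contr_apply, der_apply, Form.sub_apply, Fin.sum_univ_succ]
  have h0 : Function.update (Matrix.vecCons v w) 0 (T v) = Matrix.vecCons (T v) w := by
    funext j
    refine Fin.cases ?_ (fun j => ?_) j <;> simp
  have hs : ∀ i : Fin k, Function.update (Matrix.vecCons v w) i.succ (T (w i))
      = Matrix.vecCons v (Function.update w i (T (w i))) := fun i => by
    funext j
    refine Fin.cases ?_ (fun j => ?_) j
    · simp [Function.update_of_ne, (Fin.succ_ne_zero _).symm]
    · by_cases h : j = i
      · subst h; simp
      · simp [h]
  simp only [Matrix.cons_val_zero, Matrix.cons_val_succ, h0, hs]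
  ring

lemma der_wedge : ∀ {k : ℕ} (T : E →L[ℝ] E) (ξ : Cov 𝕜 E) (α : Form 𝕜 E k),
    der T (wedge ξ α) = wedge (-ξ.comp T) α + wedge ξ (der T α)
  | 0, T, ξ, α => by
    refine ext_contr fun v => ?_
    simp [contr_der, contr_wedge_zero]
  | k + 1, T, ξ, α => by
    refine ext_contr fun v => ?_
    simp only [contr_der, contr_wedge, map_sub, map_smul, der_wedge T ξ (contr v α), map_add,
      Cov.neg_apply, Cov.comp_apply, neg_smul]
    abel

lemma der_lie : ∀ {k : ℕ} (S T : E →L[ℝ] E) (α : Form 𝕜 E k),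
    der S (der T α) - der T (der S α) = der (S * T - T * S) α
  | 0, S, T, α => by simp
  | k + 1, S, T, α => by
    refine ext_contr fun v => ?_
    have h := der_lie S T (contr v α)
    have hST : (S * T - T * S) v = S (T v) - T (S v) := rfl
    rw [contr_der, ← h, hST]
    simp only [map_sub, contr_der, LinearMap.sub_apply]
    abel

lemma der_comp (L : E' →L[ℝ] E) (S : E' →L[ℝ] E') (T : E →L[ℝ] E) (h : ∀ v, L (S v) = T (L v))
    (α : Form 𝕜 E k) : der S (α.comp L) = (der T α).comp L := by
  ext v
  simp only [der_apply, Form.comp_apply]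
  congr 1
  refine Finset.sum_congr rfl fun i _ => congrArg α (funext fun j => ?_)
  by_cases hj : j = i
  · subst hj; simp [h]
  · simp [hj]

lemma der_real_smul (c : ℝ) (T : E →L[ℝ] E) (α : Form 𝕜 E k) :
    der (c • T) α = (c : 𝕜) • der T α := by
  ext v
  rw [Form.smul_apply, der_apply, der_apply, mul_neg, Finset.mul_sum]
  refine congrArg Neg.neg (Finset.sum_congr rfl fun i _ => ?_)
  refine (ContinuousAlternatingMap.map_update_smul (R := ℝ) α v i c (T (v i))).trans ?_
  rw [RCLike.real_smul_eq_coe_mul]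
  rfl

/-- A form is recovered from its contractions: `∑ᵦ xᵦ ∧ ι_b α = (k + 1) α`. -/
lemma sum_wedge_contr {ι : Type*} [Fintype ι] (b : Module.Basis ι ℝ E) (x : ι → Cov 𝕜 E)
    (hx : ∀ i v, x i v = (b.repr v i : 𝕜)) (α : Form 𝕜 E (k + 1)) :
    ∑ i, wedge (x i) (contr (b i) α) = ((k : 𝕜) + 1) • α := by
  have hα : ContinuousAlternatingMap.alternatizeUncurryFin
      (ContinuousAlternatingMap.curryLeft (𝕜 := ℝ) α) = (k + 1) • α :=
    ContinuousAlternatingMap.alternatizeUncurryFin_curryLeft (𝕜 := ℝ) α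
  have h : ((k : 𝕜) + 1) • α = (k + 1) • α := by
    rw [← Nat.cast_smul_eq_nsmul 𝕜]; push_cast; rfl
  rw [h]
  ext v
  refine Eq.trans ?_ (congrArg (fun γ : Form 𝕜 E (k + 1) => γ v) hα)
  refine Eq.trans ?_ (ContinuousAlternatingMap.alternatizeUncurryFin_apply _ v).symm
  simp only [Form.sum_apply, wedge_apply, contr_apply]
  rw [Finset.sum_comm]
  refine Finset.sum_congr rfl fun j _ => ?_
  rw [← Finset.mul_sum, zsmul_eq_mul]
  push_cast
  congr 1
  have hv : contr (v j) α = ∑ i, (b.repr (v j) i : 𝕜) • contr (b i) α := by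
    conv_lhs => rw [← b.sum_repr (v j)]
    rw [map_sum, LinearMap.sum_apply]
    exact Finset.sum_congr rfl fun i _ => contr_real_smul _ _ _
  refine Eq.trans ?_ (congrArg (fun γ : Form 𝕜 E k => γ (j.removeNth v)) hv).symm
  simp only [Form.sum_apply, Form.smul_apply, hx, contr_apply]

/-- Postcomposition of forms with a real linear map. -/
def postcomp {𝕜' : Type*} [RCLike 𝕜'] (g : 𝕜 →L[ℝ] 𝕜') : Form 𝕜 E k →+ Form 𝕜' E k where
  toFun α := ContinuousLinearMap.compContinuousAlternatingMap (R := ℝ) g α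
  map_zero' := by
    ext v; exact g.map_zero
  map_add' α β := by
    ext v; exact g.map_add _ _

lemma postcomp_apply {𝕜' : Type*} [RCLike 𝕜'] (g : 𝕜 →L[ℝ] 𝕜') (α : Form 𝕜 E k)
    (v : Fin k → E) : postcomp g α v = g (α v) := rfl

lemma postcomp_der {𝕜' : Type*} [RCLike 𝕜'] (g : 𝕜 →L[ℝ] 𝕜') (T : E →L[ℝ] E)
    (α : Form 𝕜 E k) : postcomp g (der T α) = der T (postcomp g α) := by
  ext v
  simp [der_apply, postcomp_apply]

lemma postcomp_real_smul {𝕜' : Type*} [RCLike 𝕜'] (g : 𝕜 →L[ℝ] 𝕜') (c : ℝ) (α : Form 𝕜 E k) :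
    postcomp g ((c : 𝕜) • α) = (c : 𝕜') • postcomp g α := by
  ext v
  rw [postcomp_apply, Form.smul_apply, ← RCLike.real_smul_eq_coe_mul, map_smul,
    RCLike.real_smul_eq_coe_mul]
  rfl

/-- A real one-form as a `𝕜`-valued one-form. -/
def Cov.ofReal (ξ : Cov ℝ E) : Cov 𝕜 E := (RCLike.ofRealCLM (K := 𝕜)).comp (ξ : E →L[ℝ] ℝ)

@[simp] lemma Cov.ofReal_apply (ξ : Cov ℝ E) (v : E) : (ξ.ofReal : Cov 𝕜 E) v = (ξ v : 𝕜) := rfl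

lemma postcomp_wedge {𝕜' : Type*} [RCLike 𝕜'] (g : 𝕜 →L[ℝ] 𝕜') (ξ : Cov ℝ E)
    (α : Form 𝕜 E k) : postcomp g (wedge ξ.ofReal α) = wedge ξ.ofReal (postcomp g α) := by
  ext v
  rw [postcomp_apply, wedge_apply, wedge_apply, map_sum]
  refine Finset.sum_congr rfl fun i _ => ?_
  have h1 : ((-1 : 𝕜) ^ (i : ℕ) * ((ξ.ofReal : Cov 𝕜 E) (v i) * α (i.removeNth v)))
      = ((-1 : ℝ) ^ (i : ℕ) * ξ (v i)) • α (i.removeNth v) := by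
    simp [RCLike.real_smul_eq_coe_mul, mul_assoc]
  rw [h1, map_smul, ← postcomp_apply]
  simp [RCLike.real_smul_eq_coe_mul, mul_assoc]

end Calculus

/-! ### Weight modules of `sl(2, ℂ)` -/

/-- The operators `X`, `Y`, `H` make the complex vector space `V` an `sl(2, ℂ)`-module that is
spanned by the weight spaces of finitely many integral weights. -/
structure IsSl2Rep {V : Type*} [AddCommGroup V] [Module ℂ V] (X Y H : V →ₗ[ℂ] V) : Prop where
  X_Y : ∀ v, X (Y v) = Y (X v) + H v
  H_X : ∀ v, H (X v) = X (H v) + (2 : ℂ) • X v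
  H_Y : ∀ v, H (Y v) = Y (H v) - (2 : ℂ) • Y v
  bounded : ∃ N : ℤ, ∀ m : ℤ, N < |m| → ∀ v, H v = (m : ℂ) • v → v = 0
  span : ∀ v, v ∈ ⨆ m : ℤ, Module.End.eigenspace H (m : ℂ)

namespace IsSl2Rep

variable {V : Type*} [AddCommGroup V] [Module ℂ V] {X Y H : V →ₗ[ℂ] V}

/-- The highest weight vectors of weight `m`. -/
def hw (X H : V →ₗ[ℂ] V) (m : ℤ) : Submodule ℂ V :=
  Module.End.eigenspace H (m : ℂ) ⊓ LinearMap.ker X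

lemma mem_hw {m : ℤ} {v : V} : v ∈ hw X H m ↔ H v = (m : ℂ) • v ∧ X v = 0 := by
  simp [hw]

/-- The Casimir operator. -/
def casimir (X Y H : V →ₗ[ℂ] V) : V →ₗ[ℂ] V :=
  (4 : ℂ) • (Y ∘ₗ X) + H ∘ₗ H + (2 : ℂ) • H

lemma casimir_apply (v : V) :
    casimir X Y H v = (4 : ℂ) • Y (X v) + H (H v) + (2 : ℂ) • H v := rfl

/-- The sum of the irreducible submodules of highest weight `r`. -/
def iso (X Y H : V →ₗ[ℂ] V) (r : ℕ) : Submodule ℂ V :=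
  Submodule.span ℂ {v | ∃ (i : ℕ) (p : V), p ∈ hw X H r ∧ v = (Y ^ i) p}

/-- This Weyl reflection carries statements about nonnegative weights over to nonpositive ones. -/
lemma symm (h : IsSl2Rep X Y H) : IsSl2Rep Y X (-H) where
  X_Y v := by simp [h.X_Y]
  H_X v := by simp [h.H_Y]; abel
  H_Y v := by simp [h.H_X]; abel
  bounded := by
    obtain ⟨N, hN⟩ := h.bounded
    refine ⟨N, fun m hm v hv => hN (-m) (by simpa using hm) v ?_⟩
    have : H v = -((m : ℂ) • v) := by rw [← hv]; simp
    rw [this]; simp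
  span v := by
    refine (iSup_le fun m : ℤ => ?_ :
      (⨆ m : ℤ, Module.End.eigenspace H (m : ℂ)) ≤ _) (h.span v)
    refine le_iSup_of_le (-m) fun w hw => ?_
    rw [Module.End.mem_eigenspace_iff] at hw ⊢
    simp [hw]

lemma H_pow_Y (h : IsSl2Rep X Y H) {m : ℂ} {v : V} (hv : H v = m • v) (i : ℕ) :
    H ((Y ^ i) v) = (m - 2 * i) • (Y ^ i) v := by
  induction i with
  | zero => simp [hv]
  | succ i ih =>
    rw [pow_succ', Module.End.mul_apply, h.H_Y, ih, map_smul]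
    push_cast
    module

lemma H_pow_X (h : IsSl2Rep X Y H) {m : ℂ} {v : V} (hv : H v = m • v) (i : ℕ) :
    H ((X ^ i) v) = (m + 2 * i) • (X ^ i) v := by
  induction i with
  | zero => simp [hv]
  | succ i ih =>
    rw [pow_succ', Module.End.mul_apply, h.H_X, ih, map_smul]
    push_cast
    module

lemma X_pow_Y (h : IsSl2Rep X Y H) {m : ℤ} {p : V} (hp : p ∈ hw X H m) (i : ℕ) :
    X ((Y ^ (i + 1)) p) = (((i : ℂ) + 1) * (m - i)) • (Y ^ i) p := by
  rw [mem_hw] at hp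
  induction i with
  | zero => simp [h.X_Y, hp.1, hp.2]
  | succ i ih =>
    rw [pow_succ', Module.End.mul_apply, h.X_Y, ih, map_smul, h.H_pow_Y hp.1,
      ← Module.End.mul_apply,
      ← pow_succ']
    push_cast
    module

/-- For `m < 0` the factors `(i + 1)(m - i)` in `X_pow_Y` never vanish, so a nonzero `p` would give
nonzero vectors `Yⁱ p` of arbitrarily negative weight. -/
lemma hw_eq_zero (h : IsSl2Rep X Y H) {m : ℤ} (hm : m < 0) {p : V} (hp : p ∈ hw X H m) : p = 0 := by
  by_contra h0
  have hne : ∀ i : ℕ, (Y ^ i) p ≠ 0 := by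
    intro i
    induction i with
    | zero => simpa using h0
    | succ i ih =>
      intro hz
      have := h.X_pow_Y hp i
      rw [hz, map_zero] at this
      rcases smul_eq_zero.mp this.symm with h1 | h1
      · rcases mul_eq_zero.mp h1 with h2 | h2
        · exact Nat.cast_add_one_ne_zero i h2
        · have : m - i = 0 := by exact_mod_cast h2
          omega
      · exact ih h1
  obtain ⟨N, hN⟩ := h.bounded
  refine hne (N.toNat + 1) (hN (m - 2 * (N.toNat + 1 : ℕ)) ?_ _ ?_)
  · rw [abs_of_neg (by omega)]; push_cast; omega
  · rw [h.H_pow_Y (mem_hw.mp hp).1]; push_cast; rfl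

/-- The factor in `X_pow_Y` vanishes at `i = r`, so `Y^(r+1) p` is a highest weight vector of the
negative weight `-r - 2`. -/
lemma pow_Y_eq_zero (h : IsSl2Rep X Y H) {r : ℕ} {p : V} (hp : p ∈ hw X H r) :
    (Y ^ (r + 1)) p = 0 := by
  refine h.hw_eq_zero (m := -r - 2) (by omega) (mem_hw.mpr ⟨?_, ?_⟩)
  · rw [h.H_pow_Y (mem_hw.mp hp).1]; push_cast; module
  · rw [h.X_pow_Y hp]; simp

lemma pow_Y_eq_zero_of_lt (h : IsSl2Rep X Y H) {r i : ℕ} (hi : r < i) {p : V}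
    (hp : p ∈ hw X H r) : (Y ^ i) p = 0 := by
  obtain ⟨j, rfl⟩ := Nat.exists_eq_add_of_lt hi
  rw [show r + j + 1 = j + (r + 1) by ring, pow_add, Module.End.mul_apply, h.pow_Y_eq_zero hp,
    map_zero]

lemma casimir_Y (h : IsSl2Rep X Y H) (v : V) : casimir X Y H (Y v) = Y (casimir X Y H v) := by
  simp only [casimir_apply, map_add, map_sub, map_smul, h.X_Y, h.H_Y]
  module

lemma casimir_pow_Y (h : IsSl2Rep X Y H) (v : V) (i : ℕ) :
    casimir X Y H ((Y ^ i) v) = (Y ^ i) (casimir X Y H v) := by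
  induction i with
  | zero => rfl
  | succ i ih => rw [pow_succ', Module.End.mul_apply, h.casimir_Y, ih]; rfl

lemma iso_le (h : IsSl2Rep X Y H) (r : ℕ) :
    iso X Y H r ≤ Module.End.eigenspace (casimir X Y H) ((r : ℂ) * (r + 2)) := by
  refine Submodule.span_le.mpr ?_
  rintro _ ⟨i, p, hp, rfl⟩
  rw [mem_hw] at hp
  rw [SetLike.mem_coe, Module.End.mem_eigenspace_iff, h.casimir_pow_Y, ← map_smul]
  congr 1
  rw [casimir_apply, hp.2, hp.1, map_smul, hp.1, map_zero]
  push_cast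
  module

lemma X_mem_iso (h : IsSl2Rep X Y H) {r : ℕ} {v : V} (hv : v ∈ iso X Y H r) :
    X v ∈ iso X Y H r := by
  induction hv using Submodule.span_induction with
  | mem v hv =>
    obtain ⟨i, p, hp, rfl⟩ := hv
    cases i with
    | zero => simp [(mem_hw.mp hp).2]
    | succ i =>
      rw [h.X_pow_Y hp]
      exact Submodule.smul_mem _ _ (Submodule.subset_span ⟨i, p, hp, rfl⟩)
  | zero => simp
  | add u v _ _ hu hv => rw [map_add]; exact add_mem hu hv
  | smul c v _ hv => rw [map_smul]; exact Submodule.smul_mem _ _ hv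

lemma Y_mem_iso {r : ℕ} {v : V} (hv : v ∈ iso X Y H r) : Y v ∈ iso X Y H r := by
  induction hv using Submodule.span_induction with
  | mem v hv =>
    obtain ⟨i, p, hp, rfl⟩ := hv
    refine Submodule.subset_span ⟨i + 1, p, hp, ?_⟩
    rw [pow_succ']; rfl
  | zero => simp
  | add u v _ _ hu hv => rw [map_add]; exact add_mem hu hv
  | smul c v _ hv => rw [map_smul]; exact Submodule.smul_mem _ _ hv

lemma H_mem_iso (h : IsSl2Rep X Y H) {r : ℕ} {v : V} (hv : v ∈ iso X Y H r) :
    H v ∈ iso X Y H r := by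
  have := h.X_Y v
  rw [← sub_eq_iff_eq_add'] at this
  rw [← this]
  exact sub_mem (h.X_mem_iso (Y_mem_iso hv)) (Y_mem_iso (h.X_mem_iso hv))

lemma hw_le_iso {r : ℕ} {p : V} (hp : p ∈ hw X H r) : p ∈ iso X Y H r :=
  Submodule.subset_span ⟨0, p, hp, rfl⟩

lemma pow_mem_iso {r : ℕ} {p : V} (hp : p ∈ hw X H r) (i : ℕ) : (Y ^ i) p ∈ iso X Y H r :=
  Submodule.subset_span ⟨i, p, hp, rfl⟩

lemma exists_X_pow_Y_pow (h : IsSl2Rep X Y H) {r : ℕ} {p : V} (hp : p ∈ hw X H r) {i : ℕ}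
    (hi : i ≤ r) :
    ∃ c : ℂ, c ≠ 0 ∧ (X ^ i) ((Y ^ i) p) = c • p := by
  induction i with
  | zero => exact ⟨1, one_ne_zero, by simp⟩
  | succ i ih =>
    obtain ⟨c, hc, hcp⟩ := ih (by omega)
    refine ⟨((i : ℂ) + 1) * (((r : ℤ) : ℂ) - i) * c,
      mul_ne_zero (mul_ne_zero (Nat.cast_add_one_ne_zero i) ?_) hc, ?_⟩
    · rw [sub_ne_zero]; exact_mod_cast (by omega : r ≠ i)
    · rw [pow_succ, Module.End.mul_apply, h.X_pow_Y hp, map_smul, hcp, smul_smul]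

lemma X_pow_Y_pow_of_lt (h : IsSl2Rep X Y H) {m : ℤ} {p : V} (hp : p ∈ hw X H m) {i j : ℕ}
    (hij : i < j) :
    (X ^ j) ((Y ^ i) p) = 0 := by
  induction i generalizing j with
  | zero =>
    obtain ⟨j, rfl⟩ := Nat.exists_eq_add_of_lt hij
    rw [pow_succ, Module.End.mul_apply, pow_zero, Module.End.one_apply, (mem_hw.mp hp).2, map_zero]
  | succ i ih =>
    obtain ⟨j, rfl⟩ : ∃ j', j = j' + 1 := ⟨j - 1, by omega⟩
    rw [pow_succ, Module.End.mul_apply, h.X_pow_Y hp, map_smul, ih (by omega), smul_zero]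

/-- A weight vector of nonnegative weight is a sum of vectors obtained by lowering highest weight
vectors. -/
lemma mem_span_of_weight_nonneg (h : IsSl2Rep X Y H) (d : ℕ) {N : ℤ}
    (hN : ∀ m : ℤ, N < |m| → ∀ v, H v = (m : ℂ) • v → v = 0) {m : ℕ} (hd : N < m + d) {v : V}
    (hv : H v = (m : ℂ) • v) :
    v ∈ Submodule.span ℂ {w | ∃ (i : ℕ) (p : V), p ∈ hw X H (m + 2 * i : ℕ) ∧ w = (Y ^ i) p} := by
  induction d generalizing m v with
  | zero =>
    rw [hN m (by simpa using hd) v (by exact_mod_cast hv)]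
    exact zero_mem _
  | succ d ih =>
    have hXv : H (X v) = ((m + 2 : ℕ) : ℂ) • X v := by
      rw [h.H_X, hv, map_smul]; push_cast; module
    have hmem := ih (m := m + 2) (by push_cast at hd ⊢; omega) hXv
    -- `X` maps `Y^(i+1) p` to `(i + 1)(m + 2 + i) Yⁱ p` with a nonzero factor, so `X v` has a
    -- preimage `v'` of weight `m` in the span; then `v - v'` is a highest weight vector.
    have key : ∀ w ∈ Submodule.span ℂ {w | ∃ (i : ℕ) (p : V),
        p ∈ hw X H (m + 2 + 2 * i : ℕ) ∧ w = (Y ^ i) p}, ∃ v' ∈ Submodule.span ℂ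
          {w | ∃ (i : ℕ) (p : V), p ∈ hw X H (m + 2 * i : ℕ) ∧ w = (Y ^ i) p}, X v' = w ∧
          H v' = (m : ℂ) • v' := by
      intro w hw
      induction hw using Submodule.span_induction with
      | mem w hw =>
        obtain ⟨i, p, hp, rfl⟩ := hw
        have hp' : p ∈ IsSl2Rep.hw X H (m + 2 * (i + 1) : ℕ) := by
          rwa [show m + 2 * (i + 1) = m + 2 + 2 * i by ring]
        have hc : ((i : ℂ) + 1) * (((m + 2 + 2 * i : ℕ) : ℤ) - i) ≠ 0 := by
          refine mul_ne_zero (Nat.cast_add_one_ne_zero i) ?_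
          push_cast
          exact_mod_cast (by omega : (m + 2 + 2 * i : ℤ) - i ≠ 0)
        refine ⟨(((i : ℂ) + 1) * (((m + 2 + 2 * i : ℕ) : ℤ) - i))⁻¹ • (Y ^ (i + 1)) p,
          Submodule.smul_mem _ _ (Submodule.subset_span ⟨i + 1, p, hp', rfl⟩), ?_, ?_⟩
        · rw [map_smul, h.X_pow_Y hp, smul_smul, inv_mul_cancel₀ hc, one_smul]
        · rw [map_smul, h.H_pow_Y (mem_hw.mp hp').1, smul_comm]
          push_cast
          module
      | zero => exact ⟨0, zero_mem _, by simp, by simp⟩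
      | add w₁ w₂ _ _ h₁ h₂ =>
        obtain ⟨v₁, m₁, e₁, f₁⟩ := h₁
        obtain ⟨v₂, m₂, e₂, f₂⟩ := h₂
        exact ⟨v₁ + v₂, add_mem m₁ m₂, by rw [map_add, e₁, e₂], by rw [map_add, f₁, f₂, smul_add]⟩
      | smul c w _ h₁ =>
        obtain ⟨v₁, m₁, e₁, f₁⟩ := h₁
        exact ⟨c • v₁, Submodule.smul_mem _ _ m₁, by rw [map_smul, e₁],
          by rw [map_smul, f₁, smul_comm]⟩
    obtain ⟨v', hv', hX, hH⟩ := key _ hmem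
    have : v - v' ∈ hw X H (m + 2 * 0 : ℕ) := by
      refine mem_hw.mpr ⟨?_, ?_⟩
      · rw [map_sub, hv, hH, ← smul_sub]; simp
      · rw [map_sub, hX, sub_self]
    rw [← sub_add_cancel v v']
    exact add_mem (Submodule.subset_span ⟨0, _, this, rfl⟩) hv'

lemma mem_iSup_iso_of_weight_nonneg (h : IsSl2Rep X Y H) {m : ℕ} {v : V} (hv : H v = (m : ℂ) • v) :
    v ∈ ⨆ r, iso X Y H r := by
  obtain ⟨N, hN⟩ := h.bounded
  refine Submodule.span_le.mpr ?_
    (h.mem_span_of_weight_nonneg (N.toNat + 1) hN (m := m) (by push_cast; omega) hv)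
  rintro _ ⟨i, p, hp, rfl⟩
  exact Submodule.mem_iSup_of_mem _ (pow_mem_iso hp i)

/-- If `p` is a lowest weight vector of weight `-r`, then `X^r p` is a highest weight vector of
weight `r`, and `Y^r X^r p` is a nonzero multiple of `p`. -/
lemma iso_symm_le (h : IsSl2Rep X Y H) (r : ℕ) : iso Y X (-H) r ≤ iso X Y H r := by
  refine Submodule.span_le.mpr ?_
  rintro _ ⟨i, p, hp, rfl⟩
  have hp0 : p ∈ iso X Y H r := by
    obtain ⟨c, hc, hcp⟩ := h.symm.exists_X_pow_Y_pow hp le_rfl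
    have hq : (X ^ r) p ∈ hw X H r := by
      refine mem_hw.mpr ⟨?_, ?_⟩
      · have h1 : H p = (-(r : ℂ)) • p := by
          have := (mem_hw.mp hp).1
          rw [LinearMap.neg_apply, neg_eq_iff_eq_neg] at this
          rw [this]; push_cast; module
        rw [h.H_pow_X h1]; push_cast; module
      · have := h.symm.pow_Y_eq_zero hp
        rwa [pow_succ'] at this
    have := pow_mem_iso (Y := Y) hq r
    rw [hcp] at this
    exact (Submodule.smul_mem_iff _ hc).mp this
  rw [SetLike.mem_coe]
  induction i with
  | zero => exact hp0
  | succ i ih => rw [pow_succ']; exact h.X_mem_iso ih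

lemma iSup_iso (h : IsSl2Rep X Y H) : ⨆ r, iso X Y H r = ⊤ := by
  refine eq_top_iff.mpr fun v _ => ?_
  refine (iSup_le fun m : ℤ => ?_ :
      (⨆ m : ℤ, Module.End.eigenspace H (m : ℂ)) ≤ _) (h.span v)
  intro w hw
  rw [Module.End.mem_eigenspace_iff] at hw
  obtain ⟨l, rfl | rfl⟩ := m.eq_nat_or_neg
  · exact h.mem_iSup_iso_of_weight_nonneg (m := l) (by simpa using hw)
  · have := h.symm.mem_iSup_iso_of_weight_nonneg (m := l) (v := w) (by simp [hw])
    exact iSup_mono h.iso_symm_le this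

lemma casimir_value_injective : Function.Injective fun r : ℕ => (r : ℂ) * (r + 2) := by
  intro r s hrs
  have : r * (r + 2) = s * (s + 2) := by
    dsimp only at hrs
    exact_mod_cast hrs
  by_contra hne
  rcases Nat.lt_or_gt_of_ne hne with hlt | hlt <;> nlinarith

/-- The Casimir operator takes different values on different highest weights and the isotypic parts
span, so each of them fills its eigenspace. -/
lemma iso_eq (h : IsSl2Rep X Y H) (r : ℕ) :
    iso X Y H r = Module.End.eigenspace (casimir X Y H) ((r : ℂ) * (r + 2)) := by
  refine le_antisymm (h.iso_le r) fun v hv => ?_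
  have hind := (Module.End.eigenspaces_iSupIndep (casimir X Y H)).comp casimir_value_injective
  have htop : v ∈ iso X Y H r ⊔ ⨆ s, ⨆ _ : s ≠ r, iso X Y H s := by
    rw [← iSup_split_single, h.iSup_iso]; trivial
  obtain ⟨u, hu, w, hw, rfl⟩ := Submodule.mem_sup.mp htop
  have hw1 : w ∈ Module.End.eigenspace (casimir X Y H) ((r : ℂ) * (r + 2)) := by
    have := sub_mem hv (h.iso_le r hu)
    rwa [add_sub_cancel_left] at this
  have hw2 : w ∈ ⨆ s, ⨆ _ : s ≠ r,
      Module.End.eigenspace (casimir X Y H) ((s : ℂ) * (s + 2)) :=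
    iSup₂_mono (fun s _ => h.iso_le s) hw
  have := Submodule.disjoint_def.mp (hind r) w hw1 hw2
  rw [this, add_zero]
  exact hu

/-- The element `∑ᵢ (r - i)! Yⁱ aᵢ` for a family of highest weight vectors `aᵢ`. -/
def assemble (Y : V →ₗ[ℂ] V) (r : ℕ) (a : ℕ → V) : V :=
  ∑ i ∈ Finset.range (r + 1), ((r - i).factorial : ℂ) • (Y ^ i) (a i)

/-- The factorials are invertible and so harmless here; they are chosen to make the coefficients of
the symbol constant in `wedge_assemble`. -/
lemma exists_assemble (h : IsSl2Rep X Y H) {r : ℕ} {v : V} (hv : v ∈ iso X Y H r) :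
    ∃ a : ℕ → V, (∀ i, a i ∈ hw X H r) ∧ v = assemble Y r a := by
  induction hv using Submodule.span_induction with
  | mem v hv =>
    obtain ⟨i, p, hp, rfl⟩ := hv
    by_cases hi : i ≤ r
    · refine ⟨Pi.single i (((r - i).factorial : ℂ)⁻¹ • p), fun j => ?_, ?_⟩
      · by_cases hj : j = i
        · subst hj; simpa using Submodule.smul_mem _ _ hp
        · simp [hj]
      · rw [assemble, Finset.sum_eq_single i]
        · have : ((r - i).factorial : ℂ) ≠ 0 := Nat.cast_ne_zero.mpr (Nat.factorial_ne_zero _)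
          simp [smul_smul, this]
        · intro j _ hj; simp [hj]
        · intro hn; exact absurd (Finset.mem_range.mpr (by omega)) hn
    · refine ⟨0, fun _ => zero_mem _, ?_⟩
      rw [h.pow_Y_eq_zero_of_lt (by omega) hp]
      simp [assemble]
  | zero => exact ⟨0, fun _ => zero_mem _, by simp [assemble]⟩
  | add u v _ _ hu hv =>
    obtain ⟨a, ha, rfl⟩ := hu
    obtain ⟨b, hb, rfl⟩ := hv
    exact ⟨a + b, fun i => add_mem (ha i) (hb i),
      by simp [assemble, Finset.sum_add_distrib]⟩
  | smul c v _ hv =>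
    obtain ⟨a, ha, rfl⟩ := hv
    exact ⟨c • a, fun i => Submodule.smul_mem _ _ (ha i),
      by simp [assemble, Finset.smul_sum, smul_comm c]⟩

lemma assemble_mem {r : ℕ} {a : ℕ → V} (ha : ∀ i, a i ∈ hw X H r) :
    assemble Y r a ∈ iso X Y H r :=
  sum_mem fun i _ => Submodule.smul_mem _ _ (pow_mem_iso (ha i) i)

/-- For the largest remaining index `N`, the operator `X^N` kills the terms with `i < N` and returns
a nonzero multiple of `a N`. The coefficients thus vanish from the top down. -/
lemma eq_zero_of_assemble_eq_zero (h : IsSl2Rep X Y H) {r : ℕ} {a : ℕ → V}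
    (ha : ∀ i, a i ∈ hw X H r) (h0 : assemble Y r a = 0) : ∀ i ≤ r, a i = 0 := by
  have key : ∀ N ≤ r + 1, ∑ i ∈ Finset.range N, ((r - i).factorial : ℂ) • (Y ^ i) (a i) = 0 →
      ∀ i < N, a i = 0 := by
    intro N
    induction N with
    | zero => intro _ _ i hi; omega
    | succ N ih =>
      intro hN hsum
      have hX := congrArg (X ^ N) hsum
      rw [Finset.sum_range_succ, map_add, map_sum, map_zero, Finset.sum_eq_zero, zero_add,
        map_smul] at hX
      · obtain ⟨c, hc, hcp⟩ := h.exists_X_pow_Y_pow (ha N) (i := N) (by omega)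
        rw [hcp, smul_smul] at hX
        have hN0 : a N = 0 := (smul_eq_zero.mp hX).resolve_left
          (mul_ne_zero (Nat.cast_ne_zero.mpr (Nat.factorial_ne_zero _)) hc)
        rw [Finset.sum_range_succ, hN0, map_zero, smul_zero, add_zero] at hsum
        intro i hi
        rcases Nat.lt_succ_iff_lt_or_eq.mp hi with hlt | rfl
        · exact ih (by omega) hsum i hlt
        · exact hN0
      · intro i hi
        rw [map_smul, h.X_pow_Y_pow_of_lt (ha i) (Finset.mem_range.mp hi), smul_zero]
  intro i hi
  exact key (r + 1) le_rfl h0 i (by omega)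

end IsSl2Rep

/-! ### The forms on a quaternionic vector space as an `sl(2, ℂ)`-module -/

section Quaternionic

variable {𝕜 : Type*} [RCLike 𝕜] {E : Type*} [NormedAddCommGroup E] [NormedSpace ℝ E]
  {E' : Type*} [NormedAddCommGroup E'] [NormedSpace ℝ E'] {k : ℕ}
  (m : ℍ[ℝ] →ₐ[ℝ] (E →L[ℝ] E))

/-- The action of an endomorphism on one-forms. -/
def derCov (T : E →L[ℝ] E) : Cov 𝕜 E →ₗ[𝕜] Cov 𝕜 E where
  toFun ξ := -ξ.comp T
  map_add' ξ η := by ext v; simp [add_comm]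
  map_smul' c ξ := by ext v; simp

@[simp] lemma derCov_apply (T : E →L[ℝ] E) (ξ : Cov 𝕜 E) (v : E) : derCov T ξ v = -ξ (T v) := rfl

lemma der_wedge' (T : E →L[ℝ] E) (ξ : Cov 𝕜 E) (α : Form 𝕜 E k) :
    der T (wedge ξ α) = wedge (derCov T ξ) α + wedge ξ (der T α) := der_wedge T ξ α

/-- The Cartan element `H = -√-1 I`. -/
def opH : Form ℂ E k →ₗ[ℂ] Form ℂ E k := (-Complex.I) • der (m qI)

/-- The raising operator `X = (J - √-1 K) / 2`. -/
def opX : Form ℂ E k →ₗ[ℂ] Form ℂ E k := (1 / 2 : ℂ) • (der (m qJ) - Complex.I • der (m qK))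

/-- The lowering operator `Y = -(J + √-1 K) / 2`. -/
def opY : Form ℂ E k →ₗ[ℂ] Form ℂ E k := (-1 / 2 : ℂ) • (der (m qJ) + Complex.I • der (m qK))

/-- The Cartan element on one-forms. -/
def covH : Cov ℂ E →ₗ[ℂ] Cov ℂ E := (-Complex.I) • derCov (m qI)

/-- The raising operator on one-forms. -/
def covX : Cov ℂ E →ₗ[ℂ] Cov ℂ E := (1 / 2 : ℂ) • (derCov (m qJ) - Complex.I • derCov (m qK))

/-- The lowering operator on one-forms. -/
def covY : Cov ℂ E →ₗ[ℂ] Cov ℂ E := (-1 / 2 : ℂ) • (derCov (m qJ) + Complex.I • derCov (m qK))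

lemma opH_apply (α : Form ℂ E k) : opH m α = (-Complex.I) • der (m qI) α := rfl

lemma opX_apply (α : Form ℂ E k) :
    opX m α = (1 / 2 : ℂ) • (der (m qJ) α - Complex.I • der (m qK) α) := rfl

lemma opY_apply (α : Form ℂ E k) :
    opY m α = (-1 / 2 : ℂ) • (der (m qJ) α + Complex.I • der (m qK) α) := rfl

lemma opH_wedge (ξ : Cov ℂ E) (α : Form ℂ E k) :
    opH m (wedge ξ α) = wedge (covH m ξ) α + wedge ξ (opH m α) := by
  simp only [opH_apply, der_wedge', covH, LinearMap.smul_apply, map_smul, smul_add]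

lemma opX_wedge (ξ : Cov ℂ E) (α : Form ℂ E k) :
    opX m (wedge ξ α) = wedge (covX m ξ) α + wedge ξ (opX m α) := by
  simp only [opX_apply, der_wedge', covX, LinearMap.smul_apply, map_smul, LinearMap.sub_apply,
    map_sub]
  module

lemma opY_wedge (ξ : Cov ℂ E) (α : Form ℂ E k) :
    opY m (wedge ξ α) = wedge (covY m ξ) α + wedge ξ (opY m α) := by
  simp only [opY_apply, der_wedge', covY, LinearMap.smul_apply, map_smul, LinearMap.add_apply,
    map_add]
  module

@[simp] lemma qI_re : qI.re = 0 := rfl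
@[simp] lemma qI_imI : qI.imI = 1 := rfl
@[simp] lemma qI_imJ : qI.imJ = 0 := rfl
@[simp] lemma qI_imK : qI.imK = 0 := rfl
@[simp] lemma qJ_re : qJ.re = 0 := rfl
@[simp] lemma qJ_imI : qJ.imI = 0 := rfl
@[simp] lemma qJ_imJ : qJ.imJ = 1 := rfl
@[simp] lemma qJ_imK : qJ.imK = 0 := rfl
@[simp] lemma qK_re : qK.re = 0 := rfl
@[simp] lemma qK_imI : qK.imI = 0 := rfl
@[simp] lemma qK_imJ : qK.imJ = 0 := rfl
@[simp] lemma qK_imK : qK.imK = 1 := rfl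

lemma qI_qJ : qI * qJ - qJ * qI = qK + qK := by
  ext <;> simp

lemma qJ_qK : qJ * qK - qK * qJ = qI + qI := by
  ext <;> simp

lemma qK_qI : qK * qI - qI * qK = qJ + qJ := by
  ext <;> simp

lemma der_quaternion_lie (p q s : ℍ[ℝ]) (h : p * q - q * p = s + s) (α : Form 𝕜 E k) :
    der (m p) (der (m q) α) = der (m q) (der (m p) α) + (2 : 𝕜) • der (m s) α := by
  rw [← sub_eq_iff_eq_add', der_lie, ← map_mul, ← map_mul, ← map_sub, h, map_add, map_add,
    LinearMap.add_apply, two_smul]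

lemma opX_opY (α : Form ℂ E k) : opX m (opY m α) = opY m (opX m α) + opH m α := by
  have h := der_quaternion_lie m _ _ _ qJ_qK α
  simp only [opX_apply, opY_apply, opH_apply, map_smul, map_add, map_sub, h, smul_add, smul_sub]
  match_scalars <;> ring_nf

lemma opH_opX (α : Form ℂ E k) : opH m (opX m α) = opX m (opH m α) + (2 : ℂ) • opX m α := by
  have h1 := der_quaternion_lie m _ _ _ qI_qJ α
  have h2 := der_quaternion_lie m _ _ _ qK_qI α
  simp only [opX_apply, opH_apply, map_smul, map_sub, h1, h2, smul_add, smul_sub]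
  match_scalars <;> ring_nf <;> simp

lemma opH_opY (α : Form ℂ E k) : opH m (opY m α) = opY m (opH m α) - (2 : ℂ) • opY m α := by
  have h1 := der_quaternion_lie m _ _ _ qI_qJ α
  have h2 := der_quaternion_lie m _ _ _ qK_qI α
  simp only [opY_apply, opH_apply, map_smul, map_add, h1, h2, smul_add]
  match_scalars <;> ring_nf <;> simp

lemma covH_covH (ξ : Cov ℂ E) : covH m (covH m ξ) = ξ := by
  ext v
  have h : m qI (m qI v) = -v := by
    change (m qI * m qI) v = -v
    rw [← map_mul, show qI * qI = -1 by ext <;> simp, map_neg, map_one]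
    rfl
  simp only [covH, LinearMap.smul_apply, map_smul, Cov.smul_apply, derCov_apply, h, Cov.map_neg]
  linear_combination (-ξ v) * Complex.I_mul_I

/-- Since `H² = 1` on one-forms, `ξ` is the sum of `(ξ ± H ξ)/2`, of weights `±1`, and each part
shifts weights by one. -/
lemma wedge_mem_weights (d : ℕ) (ξ : Cov ℂ E) (α : Form ℂ E k)
    (hα : α ∈ ⨆ j : ℤ, ⨆ _ : |j| ≤ d, Module.End.eigenspace (opH (k := k) m) (j : ℂ)) :
    wedge ξ α ∈ ⨆ j : ℤ, ⨆ _ : |j| ≤ (d + 1 : ℕ),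
      Module.End.eigenspace (opH (k := k + 1) m) (j : ℂ) := by
  suffices h : (⨆ j : ℤ, ⨆ _ : |j| ≤ d, Module.End.eigenspace (opH (k := k) m) (j : ℂ)) ≤
      (⨆ j : ℤ, ⨆ _ : |j| ≤ (d + 1 : ℕ),
        Module.End.eigenspace (opH (k := k + 1) m) (j : ℂ)).comap (wedge ξ) from h hα
  refine iSup₂_le fun j hj β hβ => ?_
  rw [Module.End.mem_eigenspace_iff] at hβ
  rw [Submodule.mem_comap]
  have hξ : ξ = (1 / 2 : ℂ) • (ξ + covH m ξ) + (1 / 2 : ℂ) • (ξ - covH m ξ) := by module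
  rw [hξ, map_add, LinearMap.add_apply]
  refine add_mem ?_ ?_
  · refine Submodule.mem_iSup_of_mem (j + 1) (Submodule.mem_iSup_of_mem ?_ ?_)
    · push_cast; rw [abs_le] at hj ⊢; omega
    · rw [Module.End.mem_eigenspace_iff, opH_wedge, hβ]
      simp only [map_smul, map_add, covH_covH, LinearMap.smul_apply, LinearMap.add_apply]
      push_cast
      module
  · refine Submodule.mem_iSup_of_mem (j - 1) (Submodule.mem_iSup_of_mem ?_ ?_)
    · push_cast; rw [abs_le] at hj ⊢; omega
    · rw [Module.End.mem_eigenspace_iff, opH_wedge, hβ]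
      simp only [map_smul, map_sub, covH_covH, LinearMap.smul_apply, LinearMap.sub_apply]
      push_cast
      module

/-- Induction on the degree, as a form of degree `k + 1` is a combination of products of one-forms
with its contractions. -/
lemma mem_weights [FiniteDimensional ℝ E] : ∀ {k : ℕ} (α : Form ℂ E k),
    α ∈ ⨆ j : ℤ, ⨆ _ : |j| ≤ k, Module.End.eigenspace (opH (k := k) m) (j : ℂ)
  | 0, α => by
    refine Submodule.mem_iSup_of_mem 0 (Submodule.mem_iSup_of_mem (by simp) ?_)
    rw [Module.End.mem_eigenspace_iff]
    simp [opH_apply]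
  | k + 1, α => by
    have hb := sum_wedge_contr (Module.finBasis ℝ E)
      (fun i => (Cov.ofReal (LinearMap.toContinuousLinearMap ((Module.finBasis ℝ E).coord i) :
        E →L[ℝ] ℝ) : Cov ℂ E)) (fun i v => rfl) α
    have hk : ((k : ℂ) + 1) ≠ 0 := Nat.cast_add_one_ne_zero k
    rw [← Submodule.smul_mem_iff _ hk]
    refine hb ▸ sum_mem fun i _ => ?_
    exact wedge_mem_weights m k _ _ (mem_weights _)

lemma eq_zero_of_weight_gt [FiniteDimensional ℝ E] {j : ℤ} (hj : (k : ℤ) < |j|) {v : Form ℂ E k}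
    (hv : opH m v = (j : ℂ) • v) : v = 0 := by
  have hind : iSupIndep fun j : ℤ => Module.End.eigenspace (opH (k := k) m) (j : ℂ) :=
    (Module.End.eigenspaces_iSupIndep (opH (k := k) m)).comp (Int.cast_injective (α := ℂ))
  have hle : (⨆ i : ℤ, ⨆ _ : |i| ≤ k, Module.End.eigenspace (opH (k := k) m) (i : ℂ)) ≤
      ⨆ i : ℤ, ⨆ _ : i ≠ j, Module.End.eigenspace (opH (k := k) m) (i : ℂ) := by
    refine iSup_mono fun i => iSup_le fun hi => le_iSup_of_le (?_ : i ≠ j) le_rfl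
    rintro rfl
    omega
  exact Submodule.disjoint_def.mp (hind j) v (Module.End.mem_eigenspace_iff.mpr hv)
    (hle (mem_weights m v))

/-- The forms on a quaternionic vector space are an `sl(2, ℂ)`-module. -/
lemma isSl2Rep [FiniteDimensional ℝ E] :
    IsSl2Rep (opX m) (opY m) (opH m : Form ℂ E k →ₗ[ℂ] Form ℂ E k) where
  X_Y := opX_opY m
  H_X := opH_opX m
  H_Y := opH_opY m
  bounded := ⟨k, fun _ hj _ hv => eq_zero_of_weight_gt m hj hv⟩
  span v := by
    have hle : (⨆ i : ℤ, ⨆ _ : |i| ≤ k, Module.End.eigenspace (opH (k := k) m) (i : ℂ)) ≤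
      ⨆ i : ℤ, Module.End.eigenspace (opH (k := k) m) (i : ℂ) :=
      iSup_mono fun i => iSup_le fun _ => le_rfl
    exact hle (mem_weights m v)

/-- The Casimir operator `I² + J² + K²` on forms. -/
def cas : Form 𝕜 E k →ₗ[𝕜] Form 𝕜 E k :=
  der (m qI) ∘ₗ der (m qI) + der (m qJ) ∘ₗ der (m qJ) + der (m qK) ∘ₗ der (m qK)

lemma cas_apply (α : Form 𝕜 E k) : cas m α =
    der (m qI) (der (m qI) α) + der (m qJ) (der (m qJ) α) + der (m qK) (der (m qK) α) := rfl

lemma casimir_eq (α : Form ℂ E k) : IsSl2Rep.casimir (opX m) (opY m) (opH m) α = -cas m α := by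
  have h := der_quaternion_lie m _ _ _ qJ_qK α
  simp only [IsSl2Rep.casimir_apply, cas_apply, opX_apply, opY_apply, opH_apply, map_smul,
    map_sub, h, smul_add, smul_sub]
  match_scalars <;> ring_nf <;> simp

/-- The forms of type `r`: the sum of the irreducible representations of highest weight `r`,
as an eigenspace of the Casimir operator. -/
def typ (𝕜 : Type*) [RCLike 𝕜] (k r : ℕ) : Submodule 𝕜 (Form 𝕜 E k) :=
  Module.End.eigenspace (cas m) ((-((r : ℝ) * (r + 2)) : ℝ) : 𝕜)

lemma mem_typ {r : ℕ} {α : Form 𝕜 E k} :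
    α ∈ typ m 𝕜 k r ↔ cas m α = ((-((r : ℝ) * (r + 2)) : ℝ) : 𝕜) • α :=
  Module.End.mem_eigenspace_iff

/-- The right side is cut out by an operator with real coefficients, so the same description serves
real forms. The sign in the eigenvalue comes from `casimir_eq`. -/
lemma iso_eq_typ [FiniteDimensional ℝ E] (r : ℕ) :
    IsSl2Rep.iso (opX m) (opY m) (opH m) r = typ m ℂ k r := by
  rw [(isSl2Rep m).iso_eq]
  ext α
  rw [mem_typ, Module.End.mem_eigenspace_iff, casimir_eq, neg_eq_iff_eq_neg, ← neg_smul]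
  push_cast
  rfl

lemma typ_iSupIndep : iSupIndep fun r => typ m 𝕜 k r := by
  refine (Module.End.eigenspaces_iSupIndep (cas m : Form 𝕜 E k →ₗ[𝕜] Form 𝕜 E k)).comp
    (f := fun r : ℕ => ((-((r : ℝ) * (r + 2)) : ℝ) : 𝕜)) fun r s hrs => ?_
  have h1 : -((r : ℝ) * (r + 2)) = -((s : ℝ) * (s + 2)) := RCLike.ofReal_injective hrs
  apply IsSl2Rep.casimir_value_injective
  have h2 : (r : ℝ) * (r + 2) = s * (s + 2) := neg_injective h1
  dsimp only
  exact_mod_cast h2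

/-- The sum of the forms of the types other than `r`. -/
def cotyp (𝕜 : Type*) [RCLike 𝕜] (k r : ℕ) : Submodule 𝕜 (Form 𝕜 E k) :=
  ⨆ s, ⨆ _ : s ≠ r, typ m 𝕜 k s

lemma typ_le_cotyp {r s : ℕ} (h : s ≠ r) : typ m 𝕜 k s ≤ cotyp m 𝕜 k r :=
  le_iSup₂_of_le s h le_rfl

lemma postcomp_mem_typ {𝕜' : Type*} [RCLike 𝕜'] (g : 𝕜 →L[ℝ] 𝕜') {r : ℕ} {α : Form 𝕜 E k}
    (hα : α ∈ typ m 𝕜 k r) : postcomp g α ∈ typ m 𝕜' k r := by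
  rw [mem_typ] at hα ⊢
  rw [← postcomp_real_smul, ← hα, cas_apply, cas_apply]
  simp only [map_add, postcomp_der]

lemma postcomp_mem_iSup_typ {𝕜' : Type*} [RCLike 𝕜'] (g : 𝕜 →L[ℝ] 𝕜') (P : ℕ → Prop)
    {α : Form 𝕜 E k} (hα : α ∈ ⨆ s, ⨆ _ : P s, typ m 𝕜 k s) :
    postcomp g α ∈ ⨆ s, ⨆ _ : P s, typ m 𝕜' k s := by
  induction hα using Submodule.iSup_induction' with
  | mem s α hα =>
    by_cases hs : P s
    · simp only [hs, iSup_pos] at hα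
      exact (le_iSup₂_of_le s hs le_rfl : typ m 𝕜' k s ≤ _) (postcomp_mem_typ m g hα)
    · simp only [hs, iSup_neg, Submodule.mem_bot, not_false_eq_true] at hα
      rw [hα, map_zero]
      exact zero_mem _
  | zero => rw [map_zero]; exact zero_mem _
  | add α β _ _ hα hβ => rw [map_add]; exact add_mem hα hβ

lemma postcomp_mem_cotyp {𝕜' : Type*} [RCLike 𝕜'] (g : 𝕜 →L[ℝ] 𝕜') {r : ℕ} {α : Form 𝕜 E k}
    (hα : α ∈ cotyp m 𝕜 k r) : postcomp g α ∈ cotyp m 𝕜' k r :=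
  postcomp_mem_iSup_typ m g (· ≠ r) hα

/-- The complexification of a real form. -/
def toComplex (α : Form ℝ E k) : Form ℂ E k := postcomp Complex.ofRealCLM α

lemma reCLM_toComplex (α : Form ℝ E k) : postcomp Complex.reCLM (toComplex α) = α := by
  ext v; rfl

lemma iSup_typ_complex [FiniteDimensional ℝ E] : ⨆ r, typ m ℂ k r = ⊤ := by
  rw [← (isSl2Rep (k := k) m).iSup_iso]
  exact iSup_congr fun r => (iso_eq_typ m r).symm

/-- Complexify, decompose, and take real parts, which preserves types. -/
lemma iSup_typ_real [FiniteDimensional ℝ E] : ⨆ r, typ m ℝ k r = ⊤ := by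
  refine eq_top_iff.mpr fun α _ => ?_
  have h : toComplex α ∈ ⨆ s, ⨆ _ : True, typ m ℂ k s := by
    simp only [iSup_pos, iSup_typ_complex]; trivial
  have h2 := postcomp_mem_iSup_typ m Complex.reCLM (fun _ => True) h
  rw [reCLM_toComplex] at h2
  simpa only [iSup_pos] using h2

lemma isCompl_typ_real [FiniteDimensional ℝ E] (r : ℕ) :
    IsCompl (typ m ℝ k r) (cotyp m ℝ k r) := by
  refine ⟨typ_iSupIndep m r, codisjoint_iff.mpr ?_⟩
  rw [cotyp, ← iSup_split_single, iSup_typ_real]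

lemma disjoint_typ_cotyp (r : ℕ) : Disjoint (typ m 𝕜 k r) (cotyp m 𝕜 k r) :=
  typ_iSupIndep m r

lemma toComplex_mem_typ_iff {r : ℕ} {α : Form ℝ E k} :
    toComplex α ∈ typ m ℂ k r ↔ α ∈ typ m ℝ k r :=
  ⟨fun h => reCLM_toComplex α ▸ postcomp_mem_typ m Complex.reCLM h, postcomp_mem_typ m _⟩

lemma toComplex_mem_cotyp_iff {r : ℕ} {α : Form ℝ E k} :
    toComplex α ∈ cotyp m ℂ k r ↔ α ∈ cotyp m ℝ k r :=
  ⟨fun h => reCLM_toComplex α ▸ postcomp_mem_cotyp m Complex.reCLM h, postcomp_mem_cotyp m _⟩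

/-- Invariant forms are of type `0`. -/
lemma mem_typ_zero_of_invariant {α : Form 𝕜 E k}
    (h : ∀ q : ℍ[ℝ], q.re = 0 → der (m q) α = 0) : α ∈ typ m 𝕜 k 0 := by
  rw [mem_typ, cas_apply, h qI rfl, h qJ rfl, h qK rfl]
  simp

lemma quaternion_eq (q : ℍ[ℝ]) (h : q.re = 0) :
    q = q.imI • qI + q.imJ • qJ + q.imK • qK := by
  ext <;> simp [h]

lemma der_quaternion (q : ℍ[ℝ]) (h : q.re = 0) (α : Form 𝕜 E k) :
    der (m q) α = (q.imI : 𝕜) • der (m qI) α + (q.imJ : 𝕜) • der (m qJ) α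
      + (q.imK : 𝕜) • der (m qK) α := by
  conv_lhs => rw [quaternion_eq q h]
  simp only [map_add, map_smul, LinearMap.add_apply, der_real_smul]

lemma der_qI_eq (α : Form ℂ E k) : der (m qI) α = Complex.I • opH m α := by
  rw [opH_apply, smul_smul]; simp

lemma der_qJ_eq (α : Form ℂ E k) : der (m qJ) α = opX m α - opY m α := by
  rw [opX_apply, opY_apply]; module

lemma der_qK_eq (α : Form ℂ E k) : der (m qK) α = Complex.I • (opX m α + opY m α) := by
  rw [opX_apply, opY_apply]
  match_scalars <;> ring_nf <;> simp

/-- Complex forms of type `0` are invariant. -/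
lemma invariant_of_mem_typ_zero_complex [FiniteDimensional ℝ E] {α : Form ℂ E k}
    (hα : α ∈ typ m ℂ k 0) (q : ℍ[ℝ]) (hq : q.re = 0) : der (m q) α = 0 := by
  rw [← iso_eq_typ] at hα
  obtain ⟨a, ha, rfl⟩ := (isSl2Rep m).exists_assemble hα
  have h0 : IsSl2Rep.assemble (opY m) 0 a = a 0 := by simp [IsSl2Rep.assemble]
  rw [h0]
  have hY := (isSl2Rep m).pow_Y_eq_zero (r := 0) (ha 0)
  rw [zero_add, pow_one] at hY
  obtain ⟨hH, hX⟩ := IsSl2Rep.mem_hw.mp (ha 0)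
  rw [der_quaternion m q hq, der_qI_eq, der_qJ_eq, der_qK_eq, hY, hX, hH]
  simp

/-- Real forms of type `0` are invariant. -/
lemma invariant_of_mem_typ_zero_real [FiniteDimensional ℝ E] {α : Form ℝ E k}
    (hα : α ∈ typ m ℝ k 0) (q : ℍ[ℝ]) (hq : q.re = 0) : der (m q) α = 0 := by
  have h := invariant_of_mem_typ_zero_complex m ((toComplex_mem_typ_iff m).mpr hα) q hq
  rw [← reCLM_toComplex α, ← postcomp_der, h, map_zero]

end Quaternionic

/-! ### Exactness of the complexified symbol sequence -/

section Exactness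

variable {E : Type*} [NormedAddCommGroup E] [NormedSpace ℝ E] {k : ℕ}
  (m : ℍ[ℝ] →ₐ[ℝ] (E →L[ℝ] E))

/-- Contraction with the complex vector `u + √-1 v`. -/
def contrC (u v : E) : Form ℂ E (k + 1) →ₗ[ℂ] Form ℂ E k := contr u + Complex.I • contr v

lemma contrC_apply (u v : E) (α : Form ℂ E (k + 1)) :
    contrC u v α = contr u α + Complex.I • contr v α := rfl

lemma contrC_wedge (u v : E) (ξ : Cov ℂ E) (α : Form ℂ E (k + 1)) :
    contrC u v (wedge ξ α) = (ξ u + Complex.I * ξ v) • α - wedge ξ (contrC u v α) := by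
  simp only [contrC_apply, contr_wedge, map_add, map_smul]
  module

lemma contrC_wedge_zero (u v : E) (ξ : Cov ℂ E) (α : Form ℂ E 0) :
    contrC u v (wedge ξ α) = (ξ u + Complex.I * ξ v) • α := by
  simp only [contrC_apply, contr_wedge_zero]
  module

lemma der_contr (T : E →L[ℝ] E) (v : E) (α : Form ℂ E (k + 1)) :
    der T (contr v α) = contr v (der T α) + contr (T v) α := by
  rw [contr_der]; abel

/-- A pair of one-forms `e`, `f = Y e` that spans a copy of the standard representation, together
with complex vectors `c = u + √-1 v` and `d = u' + √-1 v'` dual to them. -/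
structure Leg where
  /-- The one-form of weight `1`. -/
  e : Cov ℂ E
  /-- The one-form of weight `-1`. -/
  f : Cov ℂ E
  /-- Contraction with the vector dual to `e`. -/
  c : ∀ {k : ℕ}, Form ℂ E (k + 1) →ₗ[ℂ] Form ℂ E k
  /-- Contraction with the vector dual to `f`. -/
  d : ∀ {k : ℕ}, Form ℂ E (k + 1) →ₗ[ℂ] Form ℂ E k
  X_e : ∀ {k : ℕ} (α : Form ℂ E k), opX m (wedge e α) = wedge e (opX m α)
  Y_e : ∀ {k : ℕ} (α : Form ℂ E k), opY m (wedge e α) = wedge f α + wedge e (opY m α)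
  H_e : ∀ {k : ℕ} (α : Form ℂ E k), opH m (wedge e α) = wedge e α + wedge e (opH m α)
  X_f : ∀ {k : ℕ} (α : Form ℂ E k), opX m (wedge f α) = wedge e α + wedge f (opX m α)
  Y_f : ∀ {k : ℕ} (α : Form ℂ E k), opY m (wedge f α) = wedge f (opY m α)
  H_f : ∀ {k : ℕ} (α : Form ℂ E k), opH m (wedge f α) = -wedge f α + wedge f (opH m α)
  X_c : ∀ {k : ℕ} (α : Form ℂ E (k + 1)), opX m (c α) = c (opX m α) - d α
  H_c : ∀ {k : ℕ} (α : Form ℂ E (k + 1)), opH m (c α) = c (opH m α) - c α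
  X_d : ∀ {k : ℕ} (α : Form ℂ E (k + 1)), opX m (d α) = d (opX m α)
  H_d : ∀ {k : ℕ} (α : Form ℂ E (k + 1)), opH m (d α) = d (opH m α) + d α
  c_e : ∀ {k : ℕ} (α : Form ℂ E (k + 1)), c (wedge e α) = α - wedge e (c α)
  d_e : ∀ {k : ℕ} (α : Form ℂ E (k + 1)), d (wedge e α) = -wedge e (d α)
  d_f : ∀ {k : ℕ} (α : Form ℂ E (k + 1)), d (wedge f α) = α - wedge f (d α)
  d_f_zero : ∀ α : Form ℂ E 0, d (wedge f α) = α

/-- Two legs are transversal if the vectors dual to the one are annihilated by the one-forms of the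
other. -/
structure Leg.Transversal {m : ℍ[ℝ] →ₐ[ℝ] (E →L[ℝ] E)} (l₁ l₂ : Leg m) : Prop where
  c_e : ∀ {k : ℕ} (α : Form ℂ E (k + 1)), l₁.c (wedge l₂.e α) = -wedge l₂.e (l₁.c α)
  d_e : ∀ {k : ℕ} (α : Form ℂ E (k + 1)), l₁.d (wedge l₂.e α) = -wedge l₂.e (l₁.d α)
  d_f : ∀ {k : ℕ} (α : Form ℂ E (k + 1)), l₁.d (wedge l₂.f α) = -wedge l₂.f (l₁.d α)
  d_d : ∀ {k : ℕ} (α : Form ℂ E (k + 2)), l₁.d (l₂.d α) = -l₂.d (l₁.d α)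
  c_e_zero : ∀ α : Form ℂ E 0, l₁.c (wedge l₂.e α) = 0

/-- The highest weight vectors of weight `r` among the complex `k`-forms. -/
def prim (k : ℕ) (r : ℤ) : Submodule ℂ (Form ℂ E k) := IsSl2Rep.hw (opX m) (opH m) r

variable {m}

lemma mem_prim {r : ℤ} {p : Form ℂ E k} :
    p ∈ prim m k r ↔ opH m p = (r : ℂ) • p ∧ opX m p = 0 := IsSl2Rep.mem_hw

namespace Leg

variable (l : Leg m)

lemma e_mem {r : ℤ} {p : Form ℂ E k} (hp : p ∈ prim m k r) :
    wedge l.e p ∈ prim m (k + 1) (r + 1) := by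
  rw [mem_prim] at hp ⊢
  refine ⟨?_, by rw [l.X_e, hp.2, map_zero]⟩
  rw [l.H_e, hp.1, map_smul]
  push_cast
  module

/-- The projection of the contraction of a highest weight vector of weight `r` to the highest
weight vectors of weight `r - 1`. -/
def G (r : ℂ) (p : Form ℂ E (k + 1)) : Form ℂ E k := l.c p + (r + 1)⁻¹ • opY m (l.d p)

/-- `d p` is a highest weight vector of weight `r + 1`, so `X Y d p = (r + 1) d p`. The correction
term therefore cancels `X (c p) = -d p`. -/
lemma G_mem {r : ℤ} (hr : (r : ℂ) + 1 ≠ 0) {p : Form ℂ E (k + 1)} (hp : p ∈ prim m (k + 1) r) :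
    l.G r p ∈ prim m k (r - 1) := by
  rw [mem_prim] at hp ⊢
  have hHd : opH m (l.d p) = ((r : ℂ) + 1) • l.d p := by
    rw [l.H_d, hp.1, map_smul]; module
  have hXd : opX m (l.d p) = 0 := by rw [l.X_d, hp.2, map_zero]
  constructor
  · rw [G, map_add, map_smul, opH_opY, hHd, l.H_c, hp.1, map_smul, map_smul]
    push_cast
    module
  · rw [G, map_add, map_smul, opX_opY, hXd, hHd, l.X_c, hp.2, map_zero, map_zero, smul_add,
      smul_smul, inv_mul_cancel₀ hr]
    module

/-- The operator `f ∧ ι_d`. -/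
def T : Form ℂ E (k + 1) →ₗ[ℂ] Form ℂ E (k + 1) := wedge l.f ∘ₗ l.d

lemma T_apply (p : Form ℂ E (k + 1)) : l.T p = wedge l.f (l.d p) := rfl

lemma T_mem {r : ℤ} {p : Form ℂ E (k + 1)} (hp : p ∈ prim m (k + 1) r)
    (he : wedge l.e (l.d p) = 0) : l.T p ∈ prim m (k + 1) r := by
  rw [mem_prim] at hp ⊢
  constructor
  · rw [T_apply, l.H_f, l.H_d, hp.1, map_add, map_smul, map_smul]; abel
  · rw [T_apply, l.X_f, l.X_d, hp.2, he]; simp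

lemma e_c {p : Form ℂ E (k + 1)} (he : wedge l.e p = 0) : wedge l.e (l.c p) = p := by
  have := l.c_e p
  rw [he, map_zero] at this
  exact (sub_eq_zero.mp this.symm).symm

lemma e_d {p : Form ℂ E (k + 1)} (he : wedge l.e p = 0) : wedge l.e (l.d p) = 0 := by
  have := l.d_e p
  rw [he, map_zero] at this
  exact neg_eq_zero.mp this.symm

lemma e_Y (q : Form ℂ E k) :
    wedge l.e (opY m q) = opY m (wedge l.e q) - wedge l.f q := by
  rw [l.Y_e]; abel

/-- On the kernel of `e`, the map `G` inverts multiplication by `e` up to the operator `1 - T/(r +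
1)`. As `T` is idempotent (`T_T`), this operator is invertible for `r ≠ 0`. -/
lemma e_G (r : ℂ) {p : Form ℂ E (k + 1)} (he : wedge l.e p = 0) :
    wedge l.e (l.G r p) = p - (r + 1)⁻¹ • l.T p := by
  rw [G, map_add, map_smul, l.e_Y, l.e_d he, l.e_c he, map_zero, T_apply]
  module

lemma e_T {p : Form ℂ E (k + 1)} (he : wedge l.e p = 0) : wedge l.e (l.T p) = 0 := by
  rw [T_apply, wedge_wedge_comm, l.e_d he, map_zero, neg_zero]

lemma T_T : ∀ {k : ℕ} (p : Form ℂ E (k + 1)), l.T (l.T p) = l.T p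
  | 0, p => by rw [T_apply, T_apply, l.d_f_zero]
  | k + 1, p => by rw [T_apply, T_apply, l.d_f, map_sub, wedge_self_wedge, sub_zero]

/-- A highest weight vector of positive weight annihilated by `e` is a multiple of `e`. -/
lemma exists_eq_e {r : ℕ} {p : Form ℂ E (k + 1)} (hp : p ∈ prim m (k + 1) (r + 1))
    (he : wedge l.e p = 0) : ∃ g ∈ prim m k r, p = wedge l.e g := by
  have hr : (((r + 1 : ℕ) : ℤ) : ℂ) + 1 ≠ 0 := by
    push_cast; exact_mod_cast (by omega : r + 1 + 1 ≠ 0)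
  have hr1 : (r : ℂ) + 1 ≠ 0 := Nat.cast_add_one_ne_zero r
  have hT := l.T_mem hp (l.e_d he)
  have h1 := l.G_mem (r := (r + 1 : ℕ)) hr (by exact_mod_cast hp)
  have h2 := l.G_mem (r := (r + 1 : ℕ)) hr (by exact_mod_cast hT)
  rw [show ((r + 1 : ℕ) : ℤ) - 1 = r by push_cast; ring] at h1 h2
  -- The weight is `r + 1`, and since `T² = T` the inverse of `1 - T/(r + 2)` is `1 + T/(r + 1)`.
  refine ⟨_, add_mem h1 (Submodule.smul_mem _ ((r : ℂ) + 1)⁻¹ h2), ?_⟩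
  rw [map_add, map_smul, l.e_G _ he, l.e_G _ (l.e_T he), l.T_T]
  match_scalars
  · ring
  · push_cast at hr ⊢
    field_simp
    ring

/-! ### Division by the product of two one-forms -/

namespace Transversal

variable {l₁ l₂ : Leg m}

lemma T_comm (h₁₂ : l₁.Transversal l₂) (h₂₁ : l₂.Transversal l₁) (p : Form ℂ E (k + 2)) :
    l₁.T (l₂.T p) = l₂.T (l₁.T p) := by
  rw [T_apply, T_apply, T_apply, T_apply, h₁₂.d_f, h₂₁.d_f, map_neg, map_neg, h₁₂.d_d, map_neg,
    map_neg, neg_neg, wedge_wedge_comm]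

lemma e_T (h₁₂ : l₁.Transversal l₂) {p : Form ℂ E (k + 1)} (he : wedge l₂.e p = 0) :
    wedge l₂.e (l₁.T p) = 0 := by
  have h := h₁₂.d_e p
  rw [he, map_zero] at h
  rw [T_apply, wedge_wedge_comm, neg_eq_zero.mp h.symm, map_zero, neg_zero]

/-- The two-leg analogue of `e_G`: dividing by `e₁` and then by `e₂` and multiplying back gives a
polynomial in the commuting idempotents `T₁`, `T₂`. -/
lemma e_e_G_G (h₁₂ : l₁.Transversal l₂) (h₂₁ : l₂.Transversal l₁) {r : ℂ} (hr : r ≠ 0)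
    (hr1 : r + 1 ≠ 0) {p : Form ℂ E (k + 2)} (he₁ : wedge l₁.e p = 0) (he₂ : wedge l₂.e p = 0) :
    wedge l₁.e (wedge l₂.e (l₂.G (r - 1) (l₁.G r p)))
      = p - r⁻¹ • (l₁.T p + l₂.T p) + (2 * (r * (r + 1))⁻¹) • l₁.T (l₂.T p) := by
  have hc : wedge l₂.e (l₁.c p) = 0 := by
    have h := h₁₂.c_e p
    rw [he₂, map_zero] at h
    exact neg_eq_zero.mp h.symm
  have hd : wedge l₂.e (l₁.d p) = 0 := by
    have h := h₁₂.d_e p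
    rw [he₂, map_zero] at h
    exact neg_eq_zero.mp h.symm
  have hv : wedge l₂.e (l₁.G r p) = -((r + 1)⁻¹ • wedge l₂.f (l₁.d p)) := by
    rw [G, map_add, map_smul, l₂.e_Y, hd, hc, map_zero]
    module
  have h1 : wedge l₂.e (l₂.c (l₁.G r p))
      = l₁.G r p + (r + 1)⁻¹ • l₂.c (wedge l₂.f (l₁.d p)) := by
    have h := l₂.c_e (l₁.G r p)
    rw [hv, map_neg, map_smul] at h
    calc wedge l₂.e (l₂.c (l₁.G r p))
        = l₁.G r p - (l₁.G r p - wedge l₂.e (l₂.c (l₁.G r p))) := by abel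
      _ = _ := by rw [← h]; abel
  have h2 : wedge l₂.e (l₂.d (l₁.G r p))
      = (r + 1)⁻¹ • (l₁.d p - wedge l₂.f (l₂.d (l₁.d p))) := by
    have h := l₂.d_e (l₁.G r p)
    rw [hv, map_neg, map_smul, l₂.d_f, neg_inj] at h
    exact h.symm
  have h3 : wedge l₁.e (l₂.c (wedge l₂.f (l₁.d p))) = 0 := by
    have h := h₂₁.c_e (wedge l₂.f (l₁.d p))
    rw [wedge_wedge_comm, l₁.e_d he₁] at h
    simpa using h.symm
  have h4 : wedge l₁.e (l₂.d (l₁.d p)) = 0 := by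
    have h := h₂₁.d_e (l₁.d p)
    rw [l₁.e_d he₁] at h
    simpa using h.symm
  have h5 : wedge l₁.e (l₁.d p - wedge l₂.f (l₂.d (l₁.d p))) = 0 := by
    rw [map_sub, l₁.e_d he₁, wedge_wedge_comm, h4]
    simp
  have h6 : l₁.T (l₂.T p) = wedge l₁.f (wedge l₂.f (l₂.d (l₁.d p))) := by
    rw [T_apply, T_apply, h₁₂.d_f, h₁₂.d_d, map_neg, map_neg, map_neg, neg_neg]
  have h7 : wedge l₁.e (l₂.T (l₁.G r p)) = l₂.T (p - (r + 1)⁻¹ • l₁.T p) := by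
    rw [← l₁.e_G r he₁, T_apply, T_apply, h₂₁.d_e, wedge_wedge_comm, map_neg]
  have h8 : wedge l₂.e (l₂.G (r - 1) (l₁.G r p))
      = l₁.G r p + (r + 1)⁻¹ • l₂.c (wedge l₂.f (l₁.d p))
        + r⁻¹ • (opY m ((r + 1)⁻¹ • (l₁.d p - wedge l₂.f (l₂.d (l₁.d p))))
          - l₂.T (l₁.G r p)) := by
    rw [G, map_add, map_smul, h1, l₂.e_Y, h2, T_apply, sub_add_cancel]
  rw [h8, map_add, map_add, map_smul, map_smul, map_sub, h7, map_smul, map_smul, h3, l₁.e_Y, h5,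
    map_zero, l₁.e_G r he₁, map_sub, map_sub, map_smul, ← h6, ← T_comm h₁₂ h₂₁,
    ← T_apply]
  match_scalars
  · ring
  · field_simp
    ring
  · field_simp
    ring
  · ring

/-- A highest weight vector of weight at least `2` annihilated by the one-forms `e` of two
transversal legs is a multiple of their product. -/
lemma exists_eq_e_e (h₁₂ : l₁.Transversal l₂) (h₂₁ : l₂.Transversal l₁) {r : ℕ}
    {p : Form ℂ E (k + 2)} (hp : p ∈ prim m (k + 2) (r + 2)) (he₁ : wedge l₁.e p = 0)
    (he₂ : wedge l₂.e p = 0) :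
    ∃ u ∈ prim m k r, p = wedge l₁.e (wedge l₂.e u) := by
  have hr0 : (r : ℂ) + 1 ≠ 0 := Nat.cast_add_one_ne_zero r
  have hr2 : (r : ℂ) + 2 ≠ 0 := by exact_mod_cast (by omega : r + 2 ≠ 0)
  have hr3 : (r : ℂ) + 2 + 1 ≠ 0 := by exact_mod_cast (by omega : r + 2 + 1 ≠ 0)
  have hG : ∀ q ∈ prim m (k + 2) (r + 2),
      l₂.G ((r : ℂ) + 2 - 1) (l₁.G ((r : ℂ) + 2) q) ∈ prim m k r := by
    intro q hq
    have h1 := l₁.G_mem (r := (r : ℤ) + 2) (by push_cast; exact hr3) hq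
    have h2 := l₂.G_mem (r := (r : ℤ) + 2 - 1) (by push_cast; rwa [sub_add_cancel]) h1
    rw [show (r : ℤ) + 2 - 1 - 1 = r by ring] at h2
    push_cast at h2
    exact h2
  have hT₁ := l₁.T_mem hp (l₁.e_d he₁)
  have hT₂ := l₂.T_mem hp (l₂.e_d he₂)
  -- With `s = r + 2`, the operator of `e_e_G_G` equals `1`, `(s - 1)/s` or `(s - 1)/(s + 1)` where
  -- none, one or both of `T₁`, `T₂` are `1`. Its inverse is thus `1 + (T₁ + T₂)/(s - 1)`.
  refine ⟨_, add_mem (hG p hp) (Submodule.smul_mem _ ((r : ℂ) + 1)⁻¹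
    (add_mem (hG _ hT₁) (hG _ hT₂))), ?_⟩
  simp only [map_add, map_smul]
  rw [h₁₂.e_e_G_G h₂₁ hr2 hr3 he₁ he₂, h₁₂.e_e_G_G h₂₁ hr2 hr3 (l₁.e_T he₁) (h₁₂.e_T he₂),
    h₁₂.e_e_G_G h₂₁ hr2 hr3 (h₂₁.e_T he₁) (l₂.e_T he₂), l₁.T_T, l₂.T_T, ← T_comm h₁₂ h₂₁, l₁.T_T]
  match_scalars
  · ring
  · field_simp
    ring
  · field_simp
    ring
  · field_simp
    ring

end Transversal

end Leg

end Exactness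

/-! ### Legs from a one-form and a dual vector -/

section LegConstruction

variable {E : Type*} [NormedAddCommGroup E] [NormedSpace ℝ E] {k : ℕ}
  (m : ℍ[ℝ] →ₐ[ℝ] (E →L[ℝ] E))

lemma map_mul_apply (p q : ℍ[ℝ]) (v : E) : m p (m q v) = m (p * q) v := by
  rw [map_mul]; rfl

lemma map_neg_apply (p : ℍ[ℝ]) (v : E) : m (-p) v = -m p v := by
  rw [map_neg]; rfl

lemma qI_mul_qI : qI * qI = -1 := by ext <;> simp
lemma qJ_mul_qJ : qJ * qJ = -1 := by ext <;> simp
lemma qK_mul_qK : qK * qK = -1 := by ext <;> simp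
lemma qI_mul_qJ : qI * qJ = qK := by ext <;> simp
lemma qJ_mul_qI : qJ * qI = -qK := by ext <;> simp
lemma qJ_mul_qK : qJ * qK = qI := by ext <;> simp
lemma qK_mul_qJ : qK * qJ = -qI := by ext <;> simp
lemma qK_mul_qI : qK * qI = qJ := by ext <;> simp
lemma qI_mul_qK : qI * qK = -qJ := by ext <;> simp

lemma map_II (v : E) : m qI (m qI v) = -v := by
  rw [map_mul_apply, qI_mul_qI, map_neg_apply, map_one]; rfl
lemma map_JJ (v : E) : m qJ (m qJ v) = -v := by
  rw [map_mul_apply, qJ_mul_qJ, map_neg_apply, map_one]; rfl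
lemma map_KK (v : E) : m qK (m qK v) = -v := by
  rw [map_mul_apply, qK_mul_qK, map_neg_apply, map_one]; rfl
lemma map_IJ (v : E) : m qI (m qJ v) = m qK v := by rw [map_mul_apply, qI_mul_qJ]
lemma map_JI (v : E) : m qJ (m qI v) = -m qK v := by rw [map_mul_apply, qJ_mul_qI, map_neg_apply]
lemma map_JK (v : E) : m qJ (m qK v) = m qI v := by rw [map_mul_apply, qJ_mul_qK]
lemma map_KJ (v : E) : m qK (m qJ v) = -m qI v := by rw [map_mul_apply, qK_mul_qJ, map_neg_apply]
lemma map_KI (v : E) : m qK (m qI v) = m qJ v := by rw [map_mul_apply, qK_mul_qI]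
lemma map_IK (v : E) : m qI (m qK v) = -m qJ v := by rw [map_mul_apply, qI_mul_qK, map_neg_apply]

/-- The part of weight `1` of a one-form. -/
def covE (ξ : Cov ℂ E) : Cov ℂ E := (1 / 2 : ℂ) • (ξ - Complex.I • derCov (m qI) ξ)

/-- The one-form `Y e`, for `e` the part of weight `1` of a one-form. -/
def covF (ξ : Cov ℂ E) : Cov ℂ E := (-1 / 2 : ℂ) • (derCov (m qJ) ξ + Complex.I • derCov (m qK) ξ)

lemma covE_apply (ξ : Cov ℂ E) (v : E) :
    covE m ξ v = (1 / 2) * (ξ v + Complex.I * ξ (m qI v)) := by simp [covE]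

lemma covF_apply (ξ : Cov ℂ E) (v : E) :
    covF m ξ v = (1 / 2) * (ξ (m qJ v) + Complex.I * ξ (m qK v)) := by simp [covF]; ring

lemma covX_apply (ξ : Cov ℂ E) (v : E) :
    covX m ξ v = (1 / 2) * (-ξ (m qJ v) + Complex.I * ξ (m qK v)) := by simp [covX]

lemma covY_apply (ξ : Cov ℂ E) (v : E) :
    covY m ξ v = (1 / 2) * (ξ (m qJ v) + Complex.I * ξ (m qK v)) := by simp [covY]; ring

lemma covH_apply (ξ : Cov ℂ E) (v : E) : covH m ξ v = Complex.I * ξ (m qI v) := by simp [covH]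

lemma covX_covE (ξ : Cov ℂ E) : covX m (covE m ξ) = 0 := by
  ext v
  simp only [covX_apply, covE_apply, map_IJ, map_IK, Cov.map_neg, Cov.zero_apply]
  linear_combination (-(1 / 4) * ξ (m qJ v)) * Complex.I_mul_I

lemma covY_covE (ξ : Cov ℂ E) : covY m (covE m ξ) = covF m ξ := by
  ext v
  simp only [covY_apply, covE_apply, covF_apply, map_IJ, map_IK, Cov.map_neg]
  linear_combination (-(1 / 4) * ξ (m qJ v)) * Complex.I_mul_I

lemma covH_covE (ξ : Cov ℂ E) : covH m (covE m ξ) = covE m ξ := by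
  ext v
  simp only [covH_apply, covE_apply, map_II, Cov.map_neg]
  linear_combination (-(1 / 2) * ξ v) * Complex.I_mul_I

lemma covX_covF (ξ : Cov ℂ E) : covX m (covF m ξ) = covE m ξ := by
  ext v
  simp only [covX_apply, covE_apply, covF_apply, map_JJ, map_JK, map_KJ, map_KK, Cov.map_neg]
  linear_combination (-(1 / 4) * ξ v) * Complex.I_mul_I

lemma covY_covF (ξ : Cov ℂ E) : covY m (covF m ξ) = 0 := by
  ext v
  simp only [covY_apply, covF_apply, map_JJ, map_JK, map_KJ, map_KK, Cov.map_neg, Cov.zero_apply]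
  linear_combination (-(1 / 4) * ξ v) * Complex.I_mul_I

lemma covH_covF (ξ : Cov ℂ E) : covH m (covF m ξ) = -covF m ξ := by
  ext v
  simp only [covH_apply, covF_apply, map_JI, map_KI, Cov.map_neg, Cov.neg_apply]
  linear_combination ((1 / 2) * ξ (m qJ v)) * Complex.I_mul_I

lemma contr_neg (v : E) (α : Form ℂ E (k + 1)) : contr (-v) α = -contr v α := by
  rw [map_neg, LinearMap.neg_apply]

/-- Contraction with the complex vector `v + √-1 I v`. -/
def conC (v : E) : Form ℂ E (k + 1) →ₗ[ℂ] Form ℂ E k := contrC v (m qI v)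

/-- Contraction with the complex vector `-J v + √-1 K v`. -/
def conD (v : E) : Form ℂ E (k + 1) →ₗ[ℂ] Form ℂ E k := contrC (-m qJ v) (m qK v)

lemma conC_apply (v : E) (α : Form ℂ E (k + 1)) :
    conC m v α = contr v α + Complex.I • contr (m qI v) α := rfl

lemma conD_apply (v : E) (α : Form ℂ E (k + 1)) :
    conD m v α = -contr (m qJ v) α + Complex.I • contr (m qK v) α := by
  rw [conD, contrC_apply, contr_neg]

lemma opX_conC (v : E) (α : Form ℂ E (k + 1)) :
    opX m (conC m v α) = conC m v (opX m α) - conD m v α := by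
  simp only [conC_apply, conD_apply, opX_apply, map_add, map_sub, map_smul, der_contr, map_JI,
    map_KI, contr_neg]
  match_scalars <;> ring_nf <;> simp <;> ring

lemma opH_conC (v : E) (α : Form ℂ E (k + 1)) :
    opH m (conC m v α) = conC m v (opH m α) - conC m v α := by
  simp only [conC_apply, opH_apply, map_add, map_smul, der_contr, map_II, contr_neg]
  match_scalars <;> ring_nf <;> simp

lemma opX_conD (v : E) (α : Form ℂ E (k + 1)) :
    opX m (conD m v α) = conD m v (opX m α) := by
  simp only [conD_apply, opX_apply, map_add, map_neg, map_sub, map_smul, der_contr, map_JJ, map_JK,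
    map_KJ, map_KK, LinearMap.neg_apply]
  match_scalars <;> ring_nf <;> simp

lemma opH_conD (v : E) (α : Form ℂ E (k + 1)) :
    opH m (conD m v α) = conD m v (opH m α) + conD m v α := by
  simp only [conD_apply, opH_apply, map_add, map_neg, map_smul, der_contr, map_IJ, map_IK,
    LinearMap.neg_apply]
  match_scalars <;> ring_nf <;> simp

/-- The three pairings computed here and below are either `0` or the single number `ξ v + √-1 ξ (I
v)`. A leg thus needs only that this number is `1`, and transversality only that the mixed number is
`0`. -/
lemma conC_covE_value (ξ : Cov ℂ E) (v : E) :
    covE m ξ v + Complex.I * covE m ξ (m qI v) = ξ v + Complex.I * ξ (m qI v) := by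
  simp only [covE_apply, map_II, Cov.map_neg]
  linear_combination (-(1 / 2) * ξ v) * Complex.I_mul_I

lemma conD_covE_value (ξ : Cov ℂ E) (v : E) :
    covE m ξ (-m qJ v) + Complex.I * covE m ξ (m qK v) = 0 := by
  simp only [covE_apply, map_IJ, map_IK, Cov.map_neg]
  linear_combination (-(1 / 2) * ξ (m qJ v)) * Complex.I_mul_I

lemma conD_covF_value (ξ : Cov ℂ E) (v : E) :
    covF m ξ (-m qJ v) + Complex.I * covF m ξ (m qK v) = ξ v + Complex.I * ξ (m qI v) := by
  simp only [covF_apply, map_JJ, map_JK, map_KJ, map_KK, Cov.map_neg]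
  linear_combination (-(1 / 2) * ξ v) * Complex.I_mul_I

/-- The leg defined by a one-form and a vector. -/
def leg (ξ : Cov ℂ E) (v : E) (h : ξ v + Complex.I * ξ (m qI v) = 1) : Leg m where
  e := covE m ξ
  f := covF m ξ
  c := conC m v
  d := conD m v
  X_e α := by rw [opX_wedge, covX_covE, map_zero, LinearMap.zero_apply, zero_add]
  Y_e α := by rw [opY_wedge, covY_covE]
  H_e α := by rw [opH_wedge, covH_covE]
  X_f α := by rw [opX_wedge, covX_covF]
  Y_f α := by rw [opY_wedge, covY_covF, map_zero, LinearMap.zero_apply, zero_add]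
  H_f α := by rw [opH_wedge, covH_covF, map_neg, LinearMap.neg_apply]
  X_c := opX_conC m v
  H_c := opH_conC m v
  X_d := opX_conD m v
  H_d := opH_conD m v
  c_e α := by rw [conC, contrC_wedge, conC_covE_value, h, one_smul]; rfl
  d_e α := by rw [conD, contrC_wedge, conD_covE_value, zero_smul, zero_sub]; rfl
  d_f α := by rw [conD, contrC_wedge, conD_covF_value, h, one_smul]; rfl
  d_f_zero α := by rw [conD, contrC_wedge_zero, conD_covF_value, h, one_smul]

lemma contrC_contrC (u v u' v' : E) (α : Form ℂ E (k + 2)) :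
    contrC u v (contrC u' v' α) = -contrC u' v' (contrC u v α) := by
  simp only [contrC_apply, map_add, map_smul]
  rw [contr_contr_comm u u', contr_contr_comm u v', contr_contr_comm v u', contr_contr_comm v v']
  module

lemma leg_transversal {ξ₁ ξ₂ : Cov ℂ E} {v₁ v₂ : E}
    (h₁ : ξ₁ v₁ + Complex.I * ξ₁ (m qI v₁) = 1) (h₂ : ξ₂ v₂ + Complex.I * ξ₂ (m qI v₂) = 1)
    (h : ξ₂ v₁ + Complex.I * ξ₂ (m qI v₁) = 0) :
    (leg m ξ₁ v₁ h₁).Transversal (leg m ξ₂ v₂ h₂) where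
  c_e α := by
    change conC m v₁ (wedge (covE m ξ₂) α) = -wedge (covE m ξ₂) (conC m v₁ α)
    rw [conC, contrC_wedge, conC_covE_value, h, zero_smul, zero_sub]; rfl
  d_e α := by
    change conD m v₁ (wedge (covE m ξ₂) α) = -wedge (covE m ξ₂) (conD m v₁ α)
    rw [conD, contrC_wedge, conD_covE_value, zero_smul, zero_sub]; rfl
  d_f α := by
    change conD m v₁ (wedge (covF m ξ₂) α) = -wedge (covF m ξ₂) (conD m v₁ α)
    rw [conD, contrC_wedge, conD_covF_value, h, zero_smul, zero_sub]; rfl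
  d_d α := contrC_contrC _ _ _ _ α
  c_e_zero α := by
    change conC m v₁ (wedge (covE m ξ₂) α) = 0
    rw [conC, contrC_wedge_zero, conC_covE_value, h, zero_smul]

end LegConstruction

/-! ### The projected symbol on families of highest weight vectors -/

section SymbolExactness

variable {E : Type*} [NormedAddCommGroup E] [NormedSpace ℝ E] {k : ℕ}
  {m : ℍ[ℝ] →ₐ[ℝ] (E →L[ℝ] E)}

namespace Leg

variable (l : Leg m)

lemma f_pow_Y (p : Form ℂ E k) (i : ℕ) :
    wedge l.f ((opY m ^ i) p) = (opY m ^ i) (wedge l.f p) := by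
  induction i with
  | zero => simp
  | succ i ih => rw [pow_succ', pow_succ', Module.End.mul_apply, Module.End.mul_apply, ← ih, l.Y_f]

lemma pow_Y_e (p : Form ℂ E k) (i : ℕ) :
    (opY m ^ (i + 1)) (wedge l.e p) =
      wedge l.e ((opY m ^ (i + 1)) p) + ((i : ℂ) + 1) • wedge l.f ((opY m ^ i) p) := by
  induction i with
  | zero => simp [l.Y_e, add_comm]
  | succ i ih =>
    rw [pow_succ', Module.End.mul_apply, ih, map_add, map_smul, l.Y_e, l.Y_f,
      ← Module.End.mul_apply, ← Module.End.mul_apply, ← pow_succ', ← pow_succ']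
    push_cast
    module

/-- The component of weight `r - 1` of the product of the leg with a highest weight vector of
weight `r`. -/
def lower (r : ℕ) (p : Form ℂ E k) : Form ℂ E (k + 1) :=
  wedge l.e (opY m p) - (r : ℂ) • wedge l.f p

lemma lower_mem {r : ℕ} {p : Form ℂ E k} (hp : p ∈ prim m k r) :
    l.lower r p ∈ prim m (k + 1) ((r : ℤ) - 1) := by
  rw [mem_prim] at hp ⊢
  have hH : opH m p = (r : ℂ) • p := by simpa using hp.1
  constructor
  · rw [lower, map_sub, map_smul, l.H_e, l.H_f, opH_opY, hH]
    simp only [map_sub, map_smul]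
    push_cast
    module
  · rw [lower, map_sub, map_smul, l.X_e, l.X_f, opX_opY, hH, hp.2]
    simp

lemma pow_Y_lower (r : ℕ) (p : Form ℂ E k) (j : ℕ) :
    (opY m ^ j) (l.lower r p) =
      wedge l.e ((opY m ^ (j + 1)) p) - ((r : ℂ) - j) • wedge l.f ((opY m ^ j) p) := by
  have h1 : wedge l.e (opY m p) = (opY m ^ 1) (wedge l.e p) - wedge l.f p := by
    rw [pow_one, l.e_Y]
  rw [lower, h1, map_sub, map_sub, map_smul, ← Module.End.mul_apply, ← pow_add, l.pow_Y_e,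
    ← l.f_pow_Y]
  module

/-- The lower component has type `r - 1`, so the projection to type `r + 1` does not see it. For `r
= 0` it is a highest weight vector of weight `-1`, hence zero. -/
lemma pow_Y_lower_mem [FiniteDimensional ℝ E] {r : ℕ} {p : Form ℂ E k} (hp : p ∈ prim m k r)
    (j : ℕ) : (opY m ^ j) (l.lower r p) ∈ cotyp m ℂ (k + 1) (r + 1) := by
  have h := l.lower_mem hp
  rcases r with _ | r
  · rw [(isSl2Rep m).hw_eq_zero (by simp) h, map_zero]
    exact zero_mem _
  · have h' : l.lower (r + 1) p ∈ prim m (k + 1) (r : ℤ) := by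
      simpa using h
    refine typ_le_cotyp m (s := r) (by omega) ?_
    rw [← iso_eq_typ]
    exact IsSl2Rep.pow_mem_iso h' j

/-- `pow_Y_e` and `pow_Y_lower` are two linear equations for `e ∧ Y^(j+1) p` and `f ∧ Yʲ p` with
determinant `±(r + 1)`. Solving them modulo lower type gives this lemma and the next. -/
lemma f_pow_Y_sub_mem [FiniteDimensional ℝ E] {r : ℕ} {p : Form ℂ E k} (hp : p ∈ prim m k r)
    (j : ℕ) : wedge l.f ((opY m ^ j) p) - ((r : ℂ) + 1)⁻¹ • (opY m ^ (j + 1)) (wedge l.e p)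
      ∈ cotyp m ℂ (k + 1) (r + 1) := by
  have hr : (r : ℂ) + 1 ≠ 0 := Nat.cast_add_one_ne_zero r
  have h := Submodule.smul_mem _ (-((r : ℂ) + 1)⁻¹) (l.pow_Y_lower_mem hp j)
  rw [l.pow_Y_lower] at h
  rw [l.pow_Y_e]
  convert h using 1
  match_scalars <;> field_simp <;> ring

lemma e_pow_Y_sub_mem [FiniteDimensional ℝ E] {r : ℕ} {p : Form ℂ E k} (hp : p ∈ prim m k r) :
    ∀ i : ℕ, wedge l.e ((opY m ^ i) p)
        - (((r : ℂ) + 1)⁻¹ * ((r : ℂ) + 1 - i)) • (opY m ^ i) (wedge l.e p)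
      ∈ cotyp m ℂ (k + 1) (r + 1)
  | 0 => by
    have hr : (r : ℂ) + 1 ≠ 0 := Nat.cast_add_one_ne_zero r
    simp [hr]
  | j + 1 => by
    have hr : (r : ℂ) + 1 ≠ 0 := Nat.cast_add_one_ne_zero r
    have h := Submodule.smul_mem _ (((j : ℂ) + 1) * ((r : ℂ) + 1)⁻¹) (l.pow_Y_lower_mem hp j)
    rw [l.pow_Y_lower] at h
    rw [l.pow_Y_e]
    convert h using 1
    push_cast
    match_scalars <;> field_simp <;> ring

end Leg

/-- The symbol in terms of families of highest weight vectors. -/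
def step (l₁ l₂ : Leg m) (a : ℕ → Form ℂ E k) : ℕ → Form ℂ E (k + 1)
  | 0 => wedge l₁.e (a 0)
  | i + 1 => wedge l₁.e (a (i + 1)) + wedge l₂.e (a i)

variable {l₁ l₂ : Leg m}

lemma step_mem {r : ℕ} {a : ℕ → Form ℂ E k} (ha : ∀ i, a i ∈ prim m k r) :
    ∀ i, step l₁ l₂ a i ∈ prim m (k + 1) ((r + 1 : ℕ) : ℤ)
  | 0 => by simpa [step] using l₁.e_mem (ha 0)
  | i + 1 => by simpa [step] using add_mem (l₁.e_mem (ha (i + 1))) (l₂.e_mem (ha i))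

lemma step_eq_zero {r : ℕ} {a : ℕ → Form ℂ E k} (ha : ∀ i, r < i → a i = 0) :
    ∀ i, r + 1 < i → step l₁ l₂ a i = 0
  | 0, hi => by omega
  | i + 1, hi => by simp [step, ha i (by omega), ha (i + 1) (by omega)]

/-- In terms of the polynomial `∑ aᵢ tⁱ`, the map `step` is multiplication by `e₁ + t e₂`, whose
square is zero. -/
lemma step_step (a : ℕ → Form ℂ E k) : ∀ i, step l₁ l₂ (step l₁ l₂ a) i = 0
  | 0 => by simp [step, wedge_self_wedge]
  | 1 => by
    simp only [step, map_add, wedge_self_wedge]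
    rw [wedge_wedge_comm l₁.e l₂.e]
    abel
  | i + 2 => by
    simp only [step, map_add, wedge_self_wedge]
    rw [wedge_wedge_comm l₁.e l₂.e]
    abel

/-- The product with `e₁ + f₂` in terms of families of highest weight vectors. -/
lemma wedge_assemble [FiniteDimensional ℝ E] {r : ℕ} {a : ℕ → Form ℂ E k}
    (ha : ∀ i, a i ∈ prim m k r) (ha0 : ∀ i, r < i → a i = 0) :
    wedge (l₁.e + l₂.f) (IsSl2Rep.assemble (opY m) r a)
      - ((r : ℂ) + 1)⁻¹ • IsSl2Rep.assemble (opY m) (r + 1) (step l₁ l₂ a)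
      ∈ cotyp m ℂ (k + 1) (r + 1) := by
  have hr : (r : ℂ) + 1 ≠ 0 := Nat.cast_add_one_ne_zero r
  have hA : IsSl2Rep.assemble (opY m) (r + 1) (step l₁ l₂ a)
      = ∑ i ∈ Finset.range (r + 1), ((r - i).factorial : ℂ) •
        (((r : ℂ) + 1 - i) • (opY m ^ i) (wedge l₁.e (a i))
          + (opY m ^ (i + 1)) (wedge l₂.e (a i))) := by
    have h1 : IsSl2Rep.assemble (opY m) (r + 1) (step l₁ l₂ a)
        = (∑ i ∈ Finset.range (r + 2), ((r + 1 - i).factorial : ℂ) •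
            (opY m ^ i) (wedge l₁.e (a i)))
          + ∑ i ∈ Finset.range (r + 1), ((r - i).factorial : ℂ) •
            (opY m ^ (i + 1)) (wedge l₂.e (a i)) := by
      rw [IsSl2Rep.assemble, Finset.sum_range_succ', Finset.sum_range_succ' _ (r + 1)]
      simp only [step, map_add, smul_add, Finset.sum_add_distrib, Nat.add_sub_add_right]
      abel
    rw [h1, Finset.sum_range_succ, ha0 (r + 1) (by omega), map_zero, map_zero, smul_zero, add_zero,
      ← Finset.sum_add_distrib]
    refine Finset.sum_congr rfl fun i hi => ?_
    have hi' : i ≤ r := by simpa [Nat.lt_succ_iff] using hi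
    -- The coefficient `r + 1 - i` of `e_pow_Y_sub_mem` is absorbed by `(r + 1 - i)! = (r + 1 - i)(r
    -- - i)!`.
    rw [show r + 1 - i = (r - i) + 1 by omega, Nat.factorial_succ, smul_add, smul_smul]
    congr 2
    push_cast [hi']
    ring
  rw [hA, IsSl2Rep.assemble, map_sum, Finset.smul_sum, ← Finset.sum_sub_distrib]
  refine sum_mem fun i _ => ?_
  have h := Submodule.smul_mem _ ((r - i).factorial : ℂ)
    (add_mem (l₁.e_pow_Y_sub_mem (ha i) i) (l₂.f_pow_Y_sub_mem (ha i) i))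
  convert h using 1
  rw [map_smul, map_add, LinearMap.add_apply]
  module

/-- For `r > 0` in positive degree, `e₁ g` has weight at least `2` and is killed by `e₁` and `e₂`,
so it is `e₁ e₂ u`, and `z = -e₁ u` works. On functions, contraction with the vector dual to `e₂`
gives `e₁ g = 0`. The case `r = 0` in positive degree is excluded: `u` would have negative weight.
-/
lemma exists_eq_e_of_e_e (h₁₂ : l₁.Transversal l₂) (h₂₁ : l₂.Transversal l₁) :
    ∀ {k r : ℕ}, (k = 0 ∨ 0 < r) → ∀ g ∈ prim m k r, wedge l₂.e (wedge l₁.e g) = 0 →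
      ∃ z ∈ prim m k r, wedge l₁.e z = 0 ∧ wedge l₁.e g = wedge l₂.e z
  | 0, r, _, g, _, h0 => by
    refine ⟨0, zero_mem _, map_zero _, ?_⟩
    have h := l₂.c_e (wedge l₁.e g)
    rw [h0, h₂₁.c_e_zero] at h
    simpa using h.symm
  | k + 1, 0, h, _, _, _ => by omega
  | k + 1, r + 1, _, g, hg, h0 => by
    obtain ⟨u, hu, hgu⟩ := h₁₂.exists_eq_e_e h₂₁ (r := r)
      (by
        have := l₁.e_mem hg
        push_cast at this
        rwa [show (r : ℤ) + 1 + 1 = r + 2 by ring] at this)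
      (wedge_self_wedge l₁.e g) h0
    refine ⟨-wedge l₁.e u, neg_mem (by simpa using l₁.e_mem hu), ?_, ?_⟩
    · rw [map_neg, wedge_self_wedge, neg_zero]
    · rw [hgu, map_neg, wedge_wedge_comm]

/-- The exactness of the sequence of families of highest weight vectors. -/
lemma exists_step_eq (h₁₂ : l₁.Transversal l₂) (h₂₁ : l₂.Transversal l₁) {r : ℕ}
    (hkr : k = 0 ∨ 0 < r) {a : ℕ → Form ℂ E (k + 1)} (ha : ∀ i, a i ∈ prim m (k + 1) (r + 1))
    (ha0 : ∀ i, r + 1 < i → a i = 0) (hstep : ∀ i, step l₁ l₂ a i = 0) :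
    ∃ b : ℕ → Form ℂ E k, (∀ i, b i ∈ prim m k r) ∧ (∀ i, r < i → b i = 0) ∧
      ∀ i, step l₁ l₂ b i = a i := by
  have key : ∀ N, ∃ b : ℕ → Form ℂ E k, (∀ i, b i ∈ prim m k r) ∧
      ∀ i ≤ N, step l₁ l₂ b i = a i := by
    intro N
    induction N with
    | zero =>
      obtain ⟨g, hg, hag⟩ := l₁.exists_eq_e (ha 0) (hstep 0)
      refine ⟨fun _ => g, fun _ => hg, fun i hi => ?_⟩
      obtain rfl : i = 0 := by omega
      exact hag.symm
    | succ N ih =>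
      obtain ⟨b, hb, hba⟩ := ih
      -- Equation `N` turns `e₂ a_N` into `e₂ e₁ b_N`, so equation `N + 1` of the cocycle condition
      -- says that `e₁` kills `a_(N+1) - e₂ b_N`.
      have he : wedge l₁.e (a (N + 1) - wedge l₂.e (b N)) = 0 := by
        have h1 : wedge l₁.e (a (N + 1)) + wedge l₂.e (a N) = 0 := hstep (N + 1)
        have h2 : wedge l₂.e (a N) = wedge l₂.e (wedge l₁.e (b N)) := by
          rw [← hba N le_rfl]
          cases N <;> simp [step, wedge_self_wedge]
        rw [h2, wedge_wedge_comm] at h1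
        rw [map_sub, sub_eq_add_neg]
        exact h1
      obtain ⟨g, hg, hag⟩ := l₁.exists_eq_e (sub_mem (ha (N + 1)) (l₂.e_mem (hb N))) he
      refine ⟨Function.update b (N + 1) g, fun i => ?_, fun i hi => ?_⟩
      · by_cases h : i = N + 1
        · subst h; simpa using hg
        · simpa [h] using hb i
      · rcases i with _ | i
        · rw [← hba 0 (by omega)]
          simp [step]
        · by_cases h : i = N
          · subst h
            simp only [step, Function.update_self]
            rw [Function.update_of_ne (by omega), ← hag]
            abel
          · rw [← hba (i + 1) (by omega)]
            simp only [step]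
            rw [Function.update_of_ne (by omega), Function.update_of_ne (by omega)]
  -- All equations up to `r + 1` are solved, but `b_(r+1)` may be nonzero, while a form of type `r`
  -- only has coefficients up to `r`. Equation `r + 2` yields `e₂ e₁ b_(r+1) = 0`.
  obtain ⟨b, hb, hba⟩ := key (r + 1)
  have hlast : wedge l₁.e (b (r + 1)) + wedge l₂.e (b r) = a (r + 1) := hba (r + 1) le_rfl
  have h0 : wedge l₂.e (wedge l₁.e (b (r + 1))) = 0 := by
    have h1 : wedge l₁.e (a (r + 2)) + wedge l₂.e (a (r + 1)) = 0 := hstep (r + 2)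
    rw [ha0 (r + 2) (by omega), map_zero, zero_add, ← hlast, map_add, wedge_self_wedge,
      add_zero] at h1
    exact h1
  obtain ⟨z, hz, hz1, hz2⟩ := exists_eq_e_of_e_e h₁₂ h₂₁ hkr _ (hb (r + 1)) h0
  -- Dropping `b_(r+1)` is compensated by adding `z` to `b_r`: this keeps equation `r` because `e₁ z
  -- = 0`, and equation `r + 1` because `e₂ z = e₁ b_(r+1)`.
  set b' : ℕ → Form ℂ E k := fun i => if i < r then b i else if i = r then b r + z else 0 with hb'
  have hlt : ∀ i, i < r → b' i = b i := fun i hi => by simp [hb', hi]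
  have heq : b' r = b r + z := by simp [hb']
  have hgt : ∀ i, r < i → b' i = 0 := fun i hi => by
    simp [hb', show ¬ i < r by omega, show i ≠ r by omega]
  have he : ∀ i ≤ r, wedge l₁.e (b' i) = wedge l₁.e (b i) := by
    intro i hi
    rcases hi.lt_or_eq with h | rfl
    · rw [hlt i h]
    · rw [heq, map_add, hz1, add_zero]
  refine ⟨b', fun i => ?_, hgt, fun i => ?_⟩
  · rcases lt_trichotomy i r with h | rfl | h
    · rw [hlt i h]; exact hb i
    · rw [heq]; exact add_mem (hb i) hz
    · rw [hgt i h]; exact zero_mem _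
  · rcases i with _ | i
    · rw [← hba 0 (by omega)]
      exact he 0 (by omega)
    · rcases lt_trichotomy i r with h | rfl | h
      · rw [← hba (i + 1) (by omega)]
        simp only [step]
        rw [he (i + 1) (by omega), hlt i h]
      · rw [← hlast]
        simp only [step]
        rw [hgt (i + 1) (by omega), heq, map_zero, zero_add, map_add, hz2]
        exact add_comm _ _
      · rw [ha0 (i + 1) (by omega)]
        simp [step, hgt i h, hgt (i + 1) (by omega)]

/-- A form of type `r` comes from a family of highest weight vectors. -/
lemma exists_assemble_of_mem_typ [FiniteDimensional ℝ E] {r : ℕ} {α : Form ℂ E k}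
    (hα : α ∈ typ m ℂ k r) : ∃ a : ℕ → Form ℂ E k, (∀ i, a i ∈ prim m k r) ∧
      (∀ i, r < i → a i = 0) ∧ α = IsSl2Rep.assemble (opY m) r a := by
  rw [← iso_eq_typ] at hα
  obtain ⟨a, ha, rfl⟩ := (isSl2Rep m).exists_assemble hα
  refine ⟨fun i => if i ≤ r then a i else 0, fun i => ?_, fun i hi => ?_, ?_⟩
  · dsimp only
    split_ifs
    · exact ha i
    · exact zero_mem _
  · simp [show ¬ i ≤ r by omega]
  · refine Finset.sum_congr rfl fun i hi => ?_
    rw [Finset.mem_range] at hi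
    dsimp only
    rw [if_pos (by omega)]

lemma assemble_mem_typ [FiniteDimensional ℝ E] {r : ℕ} {a : ℕ → Form ℂ E k}
    (ha : ∀ i, a i ∈ prim m k r) : IsSl2Rep.assemble (opY m) r a ∈ typ m ℂ k r := by
  rw [← iso_eq_typ]
  exact IsSl2Rep.assemble_mem ha

lemma eq_of_sub_mem_cotyp {r : ℕ} {𝕜 : Type*} [RCLike 𝕜] {α β : Form 𝕜 E k}
    (hα : α ∈ typ m 𝕜 k r) (hβ : β ∈ typ m 𝕜 k r) (h : α - β ∈ cotyp m 𝕜 k r) : α = β :=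
  sub_eq_zero.mp (Submodule.disjoint_def.mp (disjoint_typ_cotyp m r) _ (sub_mem hα hβ) h)

/-- By `wedge_assemble` and the uniqueness of coefficients the symbols are nonzero multiples of
`step`, so the two directions are `exists_step_eq` and `step_step`. -/
lemma Leg.wedge_mem_cotyp_iff [FiniteDimensional ℝ E] (h₁₂ : l₁.Transversal l₂)
    (h₂₁ : l₂.Transversal l₁) {r : ℕ} (hkr : k = 0 ∨ 0 < r) {β : Form ℂ E (k + 1)}
    (hβ : β ∈ typ m ℂ (k + 1) (r + 1)) :
    wedge (l₁.e + l₂.f) β ∈ cotyp m ℂ (k + 2) (r + 2) ↔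
      ∃ γ ∈ typ m ℂ k r, wedge (l₁.e + l₂.f) γ - β ∈ cotyp m ℂ (k + 1) (r + 1) := by
  have hr : (r : ℂ) + 1 ≠ 0 := Nat.cast_add_one_ne_zero r
  have hr2 : ((r + 1 : ℕ) : ℂ) + 1 ≠ 0 := Nat.cast_add_one_ne_zero (r + 1)
  constructor
  · intro h
    obtain ⟨a, ha, ha0, rfl⟩ := exists_assemble_of_mem_typ hβ
    have h1 := sub_mem h (wedge_assemble (l₁ := l₁) (l₂ := l₂) ha ha0)
    rw [sub_sub_cancel] at h1
    have hmem := assemble_mem_typ (step_mem (l₁ := l₁) (l₂ := l₂) ha)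
    have h2 : IsSl2Rep.assemble (opY m) (r + 1 + 1) (step l₁ l₂ a) = 0 := by
      have := Submodule.disjoint_def.mp (disjoint_typ_cotyp m (r + 2)) _
        (Submodule.smul_mem _ _ hmem) h1
      exact (smul_eq_zero.mp this).resolve_left (inv_ne_zero hr2)
    have h3 : ∀ i, step l₁ l₂ a i = 0 := fun i => by
      by_cases hi : i ≤ r + 1 + 1
      · exact (isSl2Rep m).eq_zero_of_assemble_eq_zero (step_mem ha) h2 i hi
      · exact step_eq_zero ha0 i (by omega)
    obtain ⟨b, hb, hb0, hba⟩ := exists_step_eq h₁₂ h₂₁ hkr (by exact_mod_cast ha) ha0 h3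
    refine ⟨((r : ℂ) + 1) • IsSl2Rep.assemble (opY m) r b,
      Submodule.smul_mem _ _ (assemble_mem_typ hb), ?_⟩
    have h4 := Submodule.smul_mem _ ((r : ℂ) + 1) (wedge_assemble (l₁ := l₁) (l₂ := l₂) hb hb0)
    rw [smul_sub, smul_smul, mul_inv_cancel₀ hr, one_smul, ← map_smul] at h4
    rwa [show step l₁ l₂ b = a from funext hba] at h4
  · rintro ⟨γ, hγ, h⟩
    obtain ⟨b, hb, hb0, rfl⟩ := exists_assemble_of_mem_typ hγ
    have h1 := sub_mem h (wedge_assemble (l₁ := l₁) (l₂ := l₂) hb hb0)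
    rw [sub_sub_sub_cancel_left] at h1
    have hmem := assemble_mem_typ (step_mem (l₁ := l₁) (l₂ := l₂) hb)
    have h2 := eq_of_sub_mem_cotyp (Submodule.smul_mem _ _ hmem) hβ h1
    have h3 := wedge_assemble (l₁ := l₁) (l₂ := l₂) (step_mem (l₁ := l₁) (l₂ := l₂) hb)
      (step_eq_zero hb0)
    have h4 : IsSl2Rep.assemble (opY m) (r + 1 + 1) (step l₁ l₂ (step l₁ l₂ b)) = 0 :=
      Finset.sum_eq_zero fun i _ => by rw [step_step, map_zero, smul_zero]
    rw [h4, smul_zero, sub_zero] at h3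
    rw [← h2, map_smul]
    exact Submodule.smul_mem _ _ h3

variable (m)

/-- A vector dual to a nonzero real one-form and annihilated by its images. -/
lemma exists_dual_vector {ξ : Cov ℝ E} (hξ : ξ ≠ 0) :
    ∃ v : E, ξ v = 1 ∧ ξ (m qI v) = 0 ∧ ξ (m qJ v) = 0 ∧ ξ (m qK v) = 0 := by
  obtain ⟨v, hv⟩ : ∃ v, ξ v ≠ 0 := by
    by_contra! h
    exact hξ (Cov.ext h)
  have hsmul : ∀ (c : ℝ) (u : E), ξ (c • u) = c * ξ u := fun c u =>
    ContinuousLinearMap.map_smul (ξ : E →L[ℝ] ℝ) c u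
  set N := ξ v ^ 2 + ξ (m qI v) ^ 2 + ξ (m qJ v) ^ 2 + ξ (m qK v) ^ 2 with hN
  have hN0 : N ≠ 0 := by positivity
  -- The vector `v` is multiplied by the quaternion `ξ(v) + ξ(Iv) i + ξ(Jv) j + ξ(Kv) k` and divided
  -- by the squared norm `N` of that quaternion.
  refine ⟨(ξ v / N) • v + (ξ (m qI v) / N) • m qI v + (ξ (m qJ v) / N) • m qJ v
    + (ξ (m qK v) / N) • m qK v, ?_, ?_, ?_, ?_⟩
  · simp only [Cov.map_add, hsmul]
    field_simp
    rw [hN]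
  · simp only [map_add, map_smul, Cov.map_add, hsmul, map_II, map_IJ, map_IK, Cov.map_neg]
    ring
  · simp only [map_add, map_smul, Cov.map_add, hsmul, map_JI, map_JJ, map_JK, Cov.map_neg]
    ring
  · simp only [map_add, map_smul, Cov.map_add, hsmul, map_KI, map_KJ, map_KK, Cov.map_neg]
    ring

/-- A nonzero real one-form is the sum of one-forms from two transversal legs. -/
lemma exists_legs {ξ : Cov ℝ E} (hξ : ξ ≠ 0) : ∃ l₁ l₂ : Leg m,
    l₁.Transversal l₂ ∧ l₂.Transversal l₁ ∧ (ξ.ofReal : Cov ℂ E) = l₁.e + l₂.f := by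
  obtain ⟨v, h1, hI, hJ, hK⟩ := exists_dual_vector m hξ
  -- The second leg starts from `Jξ` because its `f` is then the part of weight `-1` of `ξ`, which
  -- completes the part of weight `1` given by the first leg.
  refine ⟨leg m ξ.ofReal v (by simp [h1, hI]),
    leg m (derCov (m qJ) ξ.ofReal) (m qJ v)
      (by simp [map_IJ, map_JJ, map_JK, h1, hI]), ?_, ?_, ?_⟩
  · exact leg_transversal m _ _ (by simp [map_JI, hJ, hK])
  · exact leg_transversal m _ _ (by simp [map_IJ, hJ, hK])
  · change _ = covE m _ + covF m _
    ext w
    rw [Cov.add_apply, covE_apply, covF_apply]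
    simp only [derCov_apply, map_JJ, map_JK, Cov.map_neg]
    ring

/-- Exactness of the complexified symbol sequence. -/
lemma wedge_mem_cotyp_iff_complex [FiniteDimensional ℝ E] {ξ : Cov ℝ E} (hξ : ξ ≠ 0) {r : ℕ}
    (hkr : k = 0 ∨ 0 < r) {β : Form ℂ E (k + 1)} (hβ : β ∈ typ m ℂ (k + 1) (r + 1)) :
    wedge ξ.ofReal β ∈ cotyp m ℂ (k + 2) (r + 2) ↔
      ∃ γ ∈ typ m ℂ k r, wedge ξ.ofReal γ - β ∈ cotyp m ℂ (k + 1) (r + 1) := by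
  obtain ⟨l₁, l₂, h₁₂, h₂₁, h⟩ := exists_legs m hξ
  rw [h]
  exact Leg.wedge_mem_cotyp_iff h₁₂ h₂₁ hkr hβ

lemma toComplex_wedge (ξ : Cov ℝ E) (α : Form ℝ E k) :
    toComplex (wedge ξ α) = wedge ξ.ofReal (toComplex α) :=
  postcomp_wedge (𝕜 := ℝ) Complex.ofRealCLM ξ α

/-- Exactness of the symbol sequence. -/
lemma wedge_mem_cotyp_iff [FiniteDimensional ℝ E] {ξ : Cov ℝ E} (hξ : ξ ≠ 0) {r : ℕ}
    (hkr : k = 0 ∨ 0 < r) {β : Form ℝ E (k + 1)} (hβ : β ∈ typ m ℝ (k + 1) (r + 1)) :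
    wedge ξ β ∈ cotyp m ℝ (k + 2) (r + 2) ↔
      ∃ γ ∈ typ m ℝ k r, wedge ξ γ - β ∈ cotyp m ℝ (k + 1) (r + 1) := by
  rw [← toComplex_mem_cotyp_iff, toComplex_wedge,
    wedge_mem_cotyp_iff_complex m hξ hkr ((toComplex_mem_typ_iff m).mpr hβ)]
  constructor
  · rintro ⟨γ, hγ, h⟩
    -- As `ξ` is real, the real part of a complex solution is a real solution.
    refine ⟨_, postcomp_mem_typ m Complex.reCLM hγ, ?_⟩
    have h1 := postcomp_mem_cotyp m Complex.reCLM h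
    rw [map_sub, reCLM_toComplex, postcomp_wedge] at h1
    exact h1
  · rintro ⟨γ, hγ, h⟩
    refine ⟨_, (toComplex_mem_typ_iff m).mpr hγ, ?_⟩
    rw [← toComplex_wedge]
    have h1 := (toComplex_mem_cotyp_iff m).mpr h
    rwa [toComplex, map_sub] at h1

end SymbolExactness

/-! ### Multiplication of invariant forms by one-forms -/

section Invariant

variable {E : Type*} [NormedAddCommGroup E] [NormedSpace ℝ E] {k : ℕ}
  (m : ℍ[ℝ] →ₐ[ℝ] (E →L[ℝ] E))

lemma derCov_I_I (ξ : Cov ℝ E) : derCov (m qI) (derCov (m qI) ξ) = -ξ := by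
  ext v; simp [map_II]
lemma derCov_J_J (ξ : Cov ℝ E) : derCov (m qJ) (derCov (m qJ) ξ) = -ξ := by
  ext v; simp [map_JJ]
lemma derCov_K_K (ξ : Cov ℝ E) : derCov (m qK) (derCov (m qK) ξ) = -ξ := by
  ext v; simp [map_KK]
lemma derCov_I_J (ξ : Cov ℝ E) : derCov (m qI) (derCov (m qJ) ξ) = derCov (m qK) ξ := by
  ext v; simp [map_JI]
lemma derCov_J_I (ξ : Cov ℝ E) : derCov (m qJ) (derCov (m qI) ξ) = -derCov (m qK) ξ := by
  ext v; simp [map_IJ]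
lemma derCov_J_K (ξ : Cov ℝ E) : derCov (m qJ) (derCov (m qK) ξ) = derCov (m qI) ξ := by
  ext v; simp [map_KJ]
lemma derCov_K_J (ξ : Cov ℝ E) : derCov (m qK) (derCov (m qJ) ξ) = -derCov (m qI) ξ := by
  ext v; simp [map_JK]
lemma derCov_K_I (ξ : Cov ℝ E) : derCov (m qK) (derCov (m qI) ξ) = derCov (m qJ) ξ := by
  ext v; simp [map_IK]
lemma derCov_I_K (ξ : Cov ℝ E) : derCov (m qI) (derCov (m qK) ξ) = -derCov (m qJ) ξ := by
  ext v; simp [map_KI]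

/-- The product of an invariant form and a one-form is of type `1`. -/
lemma wedge_mem_typ_one [FiniteDimensional ℝ E] (ξ : Cov ℝ E) {α : Form ℝ E k}
    (hα : α ∈ typ m ℝ k 0) : wedge ξ α ∈ typ m ℝ (k + 1) 1 := by
  have h := invariant_of_mem_typ_zero_real m hα
  rw [mem_typ, cas_apply]
  -- `I`, `J`, `K` act on the factor `ξ` only, so `I² + J² + K²` acts by `-3 = -1 · (1 + 2)`.
  simp only [der_wedge', h qI rfl, h qJ rfl, h qK rfl, derCov_I_I, derCov_J_J, derCov_K_K, map_zero,
    add_zero, map_neg, LinearMap.neg_apply]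
  norm_num
  module

lemma eq_zero_of_wedge_mem_cotyp_zero [FiniteDimensional ℝ E] {ξ : Cov ℝ E} (hξ : ξ ≠ 0)
    {β : Form ℝ E 0} (hβ : β ∈ typ m ℝ 0 0) (h : wedge ξ β ∈ cotyp m ℝ 1 1) : β = 0 := by
  have h0 := Submodule.disjoint_def.mp (disjoint_typ_cotyp m 1) _ (wedge_mem_typ_one m ξ hβ) h
  obtain ⟨v, hv, -⟩ := exists_dual_vector m hξ
  have h1 := contr_wedge_zero v ξ β
  rw [h0, map_zero, hv, one_smul] at h1
  exact h1.symm

/-- Here `ξ ∧ β = 0`, and the invariance of `β` gives the same for `Iξ` and `Jξ`. A two-form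
divisible by three independent one-forms vanishes. -/
lemma eq_zero_of_wedge_mem_cotyp_two [FiniteDimensional ℝ E] {ξ : Cov ℝ E} (hξ : ξ ≠ 0)
    {β : Form ℝ E 2} (hβ : β ∈ typ m ℝ 2 0) (h : wedge ξ β ∈ cotyp m ℝ 3 1) : β = 0 := by
  have h0 := Submodule.disjoint_def.mp (disjoint_typ_cotyp m 1) _ (wedge_mem_typ_one m ξ hβ) h
  have hinv := invariant_of_mem_typ_zero_real m hβ
  obtain ⟨v, h1, hI, hJ, hK⟩ := exists_dual_vector m hξ
  have hder : ∀ q : ℍ[ℝ], q.re = 0 → wedge (derCov (m q) ξ) β = 0 := by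
    intro q hq
    have h2 := der_wedge' (m q) ξ β
    rw [h0, hinv q hq, map_zero, map_zero, add_zero] at h2
    exact h2.symm
  have key : ∀ (η : Cov ℝ E) (u : E), wedge η β = 0 → η u = 1 → β = wedge η (contr u β) := by
    intro η u hη hu
    have h2 := contr_wedge u η β
    rw [hη, map_zero, hu, one_smul] at h2
    exact sub_eq_zero.mp h2.symm
  have ha := key ξ v h0 h1
  have hb := key (derCov (m qI) ξ) (m qI v) (hder qI rfl) (by simp [map_II, h1])
  have hc := key (derCov (m qJ) ξ) (m qJ v) (hder qJ rfl) (by simp [map_JJ, h1])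
  have hb2 : contr (m qI v) β = -wedge ξ (contr (m qI v) (contr v β)) := by
    conv_lhs => rw [ha]
    rw [contr_wedge, hI, zero_smul, zero_sub]
  have hc2 : contr (m qJ v) β = 0 := by
    rw [hb, hb2, map_neg, map_neg, contr_wedge, contr_wedge_zero, derCov_apply, map_IJ, hK, hJ]
    simp
  rw [hc, hc2, map_zero]

/-- The product with the invariant two-form `ξ ∧ Iξ - Jξ ∧ Kξ`. -/
def phi (ξ : Cov ℝ E) : Form ℝ E k →ₗ[ℝ] Form ℝ E (k + 2) :=
  wedge ξ ∘ₗ wedge (derCov (m qI) ξ) - wedge (derCov (m qJ) ξ) ∘ₗ wedge (derCov (m qK) ξ)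

lemma phi_apply (ξ : Cov ℝ E) (α : Form ℝ E k) :
    phi m ξ α = wedge ξ (wedge (derCov (m qI) ξ) α)
      - wedge (derCov (m qJ) ξ) (wedge (derCov (m qK) ξ) α) := rfl

/-- The two-forms on a quaternionic line are the sum of three invariant ones and a copy of the
adjoint representation; `ξ ∧ Iξ - Jξ ∧ Kξ` is among the invariant ones. -/
lemma phi_mem_typ_zero [FiniteDimensional ℝ E] (ξ : Cov ℝ E) {α : Form ℝ E k}
    (hα : α ∈ typ m ℝ k 0) : phi m ξ α ∈ typ m ℝ (k + 2) 0 := by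
  have h := invariant_of_mem_typ_zero_real m hα
  refine mem_typ_zero_of_invariant m fun q hq => ?_
  have hI : der (m qI) (phi m ξ α) = 0 := by
    rw [phi_apply]
    simp only [map_sub, der_wedge', h qI rfl, map_zero, derCov_I_I, derCov_I_J, derCov_I_K,
      add_zero, map_neg, LinearMap.neg_apply, wedge_self_wedge, neg_zero, sub_zero]
  have hJ : der (m qJ) (phi m ξ α) = 0 := by
    rw [phi_apply]
    simp only [map_sub, der_wedge', h qJ rfl, map_zero, derCov_J_I, derCov_J_J, derCov_J_K,
      add_zero, map_neg, LinearMap.neg_apply]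
    abel
  have hK : der (m qK) (phi m ξ α) = 0 := by
    rw [phi_apply]
    simp only [map_sub, der_wedge', h qK rfl, map_zero, derCov_K_I, derCov_K_J, derCov_K_K,
      add_zero, map_neg, LinearMap.neg_apply]
    rw [wedge_wedge_comm (derCov (m qK) ξ) (derCov (m qI) ξ),
      wedge_wedge_comm ξ (derCov (m qJ) ξ)]
    abel
  rw [der_quaternion m q hq, hI, hJ, hK]
  simp

/-- The product with the four-form `ξ ∧ Iξ ∧ Jξ ∧ Kξ`. -/
def vol (ξ : Cov ℝ E) (α : Form ℝ E k) : Form ℝ E (k + 4) :=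
  wedge ξ (wedge (derCov (m qI) ξ) (wedge (derCov (m qJ) ξ) (wedge (derCov (m qK) ξ) α)))

lemma phi_phi (ξ : Cov ℝ E) (α : Form ℝ E k) : phi m ξ (phi m ξ α) = (-2 : ℝ) • vol m ξ α := by
  rw [phi_apply, phi_apply, vol]
  generalize derCov (m qI) ξ = b
  generalize derCov (m qJ) ξ = c
  generalize derCov (m qK) ξ = d
  have hba : ∀ {j : ℕ} (γ : Form ℝ E j), wedge b (wedge ξ γ) = -wedge ξ (wedge b γ) :=
    fun γ => wedge_wedge_comm _ _ _
  have hca : ∀ {j : ℕ} (γ : Form ℝ E j), wedge c (wedge ξ γ) = -wedge ξ (wedge c γ) :=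
    fun γ => wedge_wedge_comm _ _ _
  have hda : ∀ {j : ℕ} (γ : Form ℝ E j), wedge d (wedge ξ γ) = -wedge ξ (wedge d γ) :=
    fun γ => wedge_wedge_comm _ _ _
  have hcb : ∀ {j : ℕ} (γ : Form ℝ E j), wedge c (wedge b γ) = -wedge b (wedge c γ) :=
    fun γ => wedge_wedge_comm _ _ _
  have hdb : ∀ {j : ℕ} (γ : Form ℝ E j), wedge d (wedge b γ) = -wedge b (wedge d γ) :=
    fun γ => wedge_wedge_comm _ _ _
  have hdc : ∀ {j : ℕ} (γ : Form ℝ E j), wedge d (wedge c γ) = -wedge c (wedge d γ) :=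
    fun γ => wedge_wedge_comm _ _ _
  simp only [map_sub, hba, hca, hda, hcb, hdb, hdc, map_neg, wedge_self_wedge, map_zero, neg_zero,
    neg_neg]
  module

/-- The form `α` does not involve the vector `u`. -/
def Free (u : E) (α : Form ℝ E k) : Prop := ∀ η : Cov ℝ E, contr u (wedge η α) = η u • α

/-- `Free` is phrased through products with one-forms, rather than as a vanishing contraction, so
that it also covers degree `0`. -/
lemma free_zero_form (u : E) (α : Form ℝ E 0) : Free u α := fun η => contr_wedge_zero u η α

lemma Free.wedge {u : E} {α : Form ℝ E k} (h : Free u α) {η : Cov ℝ E} (hη : η u = 0) :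
    Free u (wedge η α) := fun η' => by
  rw [contr_wedge, h η, hη, zero_smul, map_zero, sub_zero]

lemma Free.sub {u : E} {α β : Form ℝ E k} (hα : Free u α) (hβ : Free u β) : Free u (α - β) :=
  fun η => by rw [map_sub, map_sub, hα η, hβ η, smul_sub]

lemma Free.eq_zero {u : E} {α : Form ℝ E k} (h : Free u α) {η : Cov ℝ E} (hη : η u = 1)
    (h0 : QuaternionicForms.wedge η α = 0) : α = 0 := by
  have h1 := h η
  rw [h0, map_zero, hη, one_smul] at h1
  exact h1.symm

lemma Free.phi {u : E} {α : Form ℝ E k} {ξ : Cov ℝ E} (h : Free u α) (h1 : ξ u = 0)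
    (hI : ξ (m qI u) = 0) (hJ : ξ (m qJ u) = 0) (hK : ξ (m qK u) = 0) :
    Free u (phi m ξ α) :=
  ((h.wedge (by simp [hI])).wedge h1).sub ((h.wedge (by simp [hK])).wedge (by simp [hJ]))

/-- Contractions with `v`, `Iv`, `Jv`, `Kv` strip off the four factors one at a time. -/
lemma eq_zero_of_vol_eq_zero {ξ : Cov ℝ E} {v : E} {α : Form ℝ E k} (h1 : ξ v = 1)
    (hI : ξ (m qI v) = 0) (hJ : ξ (m qJ v) = 0) (hK : ξ (m qK v) = 0) (hα : ∀ q, Free (m q v) α)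
    (h0 : vol m ξ α = 0) : α = 0 := by
  have hv : Free v α := by simpa using hα 1
  have hb := ((hv.wedge (η := derCov (m qK) ξ) (by simp [hK])).wedge (η := derCov (m qJ) ξ)
    (by simp [hJ])).wedge (η := derCov (m qI) ξ) (by simp [hI]) |>.eq_zero h1 h0
  have hc := (((hα qI).wedge (η := derCov (m qK) ξ) (by simp [map_KI, hJ])).wedge
    (η := derCov (m qJ) ξ) (by simp [map_JI, hK])).eq_zero (by simp [map_II, h1]) hb
  have hd := ((hα qJ).wedge (η := derCov (m qK) ξ) (by simp [map_KJ, hI])).eq_zero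
    (by simp [map_JJ, h1]) hc
  exact (hα qK).eq_zero (by simp [map_KK, h1]) hd

/-- Forms of the given degree with the given type that do not involve the given
quaternionic line exist. -/
lemma exists_invariant [FiniteDimensional ℝ E] {n : ℕ} (a : Fin n → Cov ℝ E) (e : Fin n → E)
    (hae : ∀ i j q, a i (m q (e j)) = if i = j then q.re else 0) :
    ∀ l ≤ n, ∀ N ≤ 2 * l, ∃ ρ ∈ typ m ℝ (2 * N) 0, ρ ≠ 0 ∧
      ∀ i : Fin n, l ≤ i → ∀ q, Free (m q (e i)) ρ := by
  intro l
  induction l with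
  | zero =>
    intro _ N hN
    obtain rfl : N = 0 := by omega
    refine ⟨ContinuousAlternatingMap.constOfIsEmpty ℝ E (Fin 0) (1 : ℝ), ?_, ?_, ?_⟩
    · exact mem_typ_zero_of_invariant m fun q _ => der_zero_form _ _
    · intro h
      exact one_ne_zero (congrArg (fun α : Form ℝ E 0 => α ![]) h)
    · exact fun i _ q => free_zero_form _ _
  | succ l ih =>
    intro hl N hN
    by_cases hN' : N ≤ 2 * l
    · obtain ⟨ρ, hρ, hρ0, hfree⟩ := ih (by omega) N hN'
      exact ⟨ρ, hρ, hρ0, fun i hi => hfree i (by omega)⟩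
    · obtain ⟨ρ, hρ, hρ0, hfree⟩ := ih (by omega) (2 * l) le_rfl
      set ξ := a ⟨l, hl⟩ with hξ
      set v := e ⟨l, hl⟩ with hv
      have hval : ∀ q, ξ (m q v) = q.re := fun q => by rw [hξ, hv, hae, if_pos rfl]
      have h1 : ξ v = 1 := by simpa using hval 1
      have hphi : ∀ {j : ℕ} (α : Form ℝ E j), (∀ i : Fin n, l + 1 ≤ i → ∀ q, Free (m q (e i)) α) →
          ∀ i : Fin n, l + 1 ≤ i → ∀ q, Free (m q (e i)) (phi m ξ α) := by
        intro j α hα i hi q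
        have hne : (⟨l, hl⟩ : Fin n) ≠ i := fun h => by rw [← h] at hi; simp at hi
        have h0 : ∀ q, ξ (m q (e i)) = 0 := fun q => by rw [hξ, hae, if_neg hne]
        exact (hα i hi q).phi m (h0 q) (by rw [map_mul_apply, h0]) (by rw [map_mul_apply, h0])
          (by rw [map_mul_apply, h0])
      have hfree' : ∀ i : Fin n, l + 1 ≤ i → ∀ q, Free (m q (e i)) ρ :=
        fun i hi => hfree i (by omega)
      have hvol : vol m ξ ρ ≠ 0 := fun h => hρ0
        (eq_zero_of_vol_eq_zero m h1 (hval qI) (hval qJ) (hval qK) (hfree ⟨l, hl⟩ le_rfl) h)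
      have hne : phi m ξ (phi m ξ ρ) ≠ 0 := by
        rw [phi_phi]
        exact smul_ne_zero (by norm_num) hvol
      -- `ρ` has the top degree `4 l` available on the first `l` lines; the next line contributes
      -- `φ` or `φ²`, of degree `2` or `4`.
      rcases (by omega : N = 2 * l + 1 ∨ N = 2 * l + 2) with rfl | rfl
      · exact ⟨phi m ξ ρ, phi_mem_typ_zero m ξ hρ, fun h => hne (by rw [h, map_zero]),
          hphi ρ hfree'⟩
      · exact ⟨phi m ξ (phi m ξ ρ), phi_mem_typ_zero m ξ (phi_mem_typ_zero m ξ hρ), hne,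
          hphi _ (hphi ρ hfree')⟩

/-- The symbol sequence is not exact at the first term in higher degrees. -/
lemma exists_wedge_eq_zero [FiniteDimensional ℝ E] {n : ℕ} (a : Fin n → Cov ℝ E) (e : Fin n → E)
    (hae : ∀ i j q, a i (m q (e j)) = if i = j then q.re else 0) (hn : 0 < n) {N : ℕ}
    (hN : N + 2 ≤ 2 * n) : ∃ ξ : Cov ℝ E, ξ ≠ 0 ∧
      ∃ β ∈ typ m ℝ (2 * (N + 2)) 0, β ≠ 0 ∧ wedge ξ β = 0 := by
  obtain ⟨ρ, hρ, hρ0, hfree⟩ := exists_invariant m a e hae (n - 1) (by omega) N (by omega)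
  set i : Fin n := ⟨n - 1, by omega⟩
  have hval : ∀ q, a i (m q (e i)) = q.re := fun q => by rw [hae, if_pos rfl]
  have h1 : a i (e i) = 1 := by simpa using hval 1
  have hvol : vol m (a i) ρ ≠ 0 := fun h => hρ0
    (eq_zero_of_vol_eq_zero m h1 (hval qI) (hval qJ) (hval qK) (hfree i le_rfl) h)
  -- The witness `φ² ρ` is `-2` times the product of `ρ` with the volume form of the last line,
  -- which contains the factor `ξ`.
  refine ⟨a i, fun h => ?_, phi m (a i) (phi m (a i) ρ),
    phi_mem_typ_zero m _ (phi_mem_typ_zero m _ hρ), ?_, ?_⟩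
  · rw [h] at h1; simp at h1
  · rw [phi_phi]
    exact smul_ne_zero (by norm_num) hvol
  · rw [phi_phi, map_smul, vol, wedge_self_wedge, smul_zero]

/-- The symbol sequence is not exact at the second term in positive degrees. -/
lemma exists_not_exact [FiniteDimensional ℝ E] {n : ℕ} (a : Fin n → Cov ℝ E) (e : Fin n → E)
    (hae : ∀ i j q, a i (m q (e j)) = if i = j then q.re else 0) (hn : 0 < n) {N : ℕ}
    (hN : N + 2 ≤ 2 * n) : ∃ ξ : Cov ℝ E, ξ ≠ 0 ∧
      ∃ α ∈ typ m ℝ (2 * (N + 1) + 1) 1, wedge ξ α ∈ cotyp m ℝ (2 * (N + 1) + 2) 2 ∧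
        ¬ ∃ γ ∈ typ m ℝ (2 * (N + 1)) 0, wedge ξ γ - α ∈ cotyp m ℝ (2 * (N + 1) + 1) 1 := by
  obtain ⟨ρ, hρ, hρ0, hfree⟩ := exists_invariant m a e hae (n - 1) (by omega) N (by omega)
  set i : Fin n := ⟨n - 1, by omega⟩
  have hval : ∀ q, a i (m q (e i)) = q.re := fun q => by rw [hae, if_pos rfl]
  have h1 : a i (e i) = 1 := by simpa using hval 1
  have hvol : vol m (a i) ρ ≠ 0 := fun h => hρ0
    (eq_zero_of_vol_eq_zero m h1 (hval qI) (hval qJ) (hval qK) (hfree i le_rfl) h)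
  have hα : wedge (derCov (m qI) (a i)) (phi m (a i) ρ) ∈ typ m ℝ (2 * (N + 1) + 1) 1 :=
    wedge_mem_typ_one m _ (phi_mem_typ_zero m _ hρ)
  have hwedge : wedge (a i) (wedge (derCov (m qI) (a i)) (phi m (a i) ρ)) = -vol m (a i) ρ := by
    rw [phi_apply, map_sub, map_sub, wedge_wedge_comm (derCov (m qI) (a i)) (a i),
      wedge_self_wedge, map_zero, neg_zero, map_zero, zero_sub, vol]
  refine ⟨a i, fun h => ?_, _, hα, ?_, ?_⟩
  · rw [h] at h1; simp at h1
  -- `ξ ∧ α = φ² ρ / 2` is invariant, so its component of type `2` is zero.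
  · refine typ_le_cotyp m (s := 0) (by omega) ?_
    have h2 : -vol m (a i) ρ = (1 / 2 : ℝ) • phi m (a i) (phi m (a i) ρ) := by
      rw [phi_phi]; module
    have h3 : -vol m (a i) ρ ∈ typ m ℝ (2 * N + 4) 0 := by
      rw [h2]
      exact Submodule.smul_mem _ _ (phi_mem_typ_zero m _ (phi_mem_typ_zero m _ hρ))
    rw [← hwedge] at h3
    exact h3
  -- `ξ ∧ γ` is already of type `1`, so it would equal `α`, and `ξ ∧ α` would be zero.
  · rintro ⟨γ, hγ, h⟩
    have h2 := eq_of_sub_mem_cotyp (wedge_mem_typ_one m _ hγ) hα h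
    have h3 : wedge (a i) (wedge (a i) γ) = -vol m (a i) ρ := by rw [h2]; exact hwedge
    rw [wedge_self_wedge] at h3
    exact hvol (neg_eq_zero.mp h3.symm)

end Invariant

/-! ### The model representation -/

section Model

variable {n k : ℕ}

/-- Left multiplication as a quaternionic structure on `ℍⁿ`. -/
def leftMulHom (n : ℕ) : ℍ[ℝ] →ₐ[ℝ] (HSpace n →L[ℝ] HSpace n) where
  toFun := leftMul n
  map_one' := ContinuousLinearMap.ext fun v => one_smul ℍ[ℝ] v
  map_mul' p q := ContinuousLinearMap.ext fun v => mul_smul p q v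
  map_zero' := ContinuousLinearMap.ext fun v => zero_smul ℍ[ℝ] v
  map_add' p q := ContinuousLinearMap.ext fun v => add_smul p q v
  commutes' c := ContinuousLinearMap.ext fun v => algebraMap_smul ℍ[ℝ] c v

variable {E : Type*} [NormedAddCommGroup E] [NormedSpace ℝ E]

lemma der_mem_typ_complex [FiniteDimensional ℝ E] (m : ℍ[ℝ] →ₐ[ℝ] (E →L[ℝ] E)) {r : ℕ}
    {α : Form ℂ E k} (hα : α ∈ typ m ℂ k r) (q : ℍ[ℝ]) (hq : q.re = 0) :
    der (m q) α ∈ typ m ℂ k r := by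
  rw [← iso_eq_typ] at hα ⊢
  have hX := (isSl2Rep m).X_mem_iso hα
  have hY := IsSl2Rep.Y_mem_iso hα
  have hH := (isSl2Rep m).H_mem_iso hα
  rw [der_quaternion m q hq, der_qI_eq, der_qJ_eq, der_qK_eq]
  exact add_mem (add_mem (Submodule.smul_mem _ _ (Submodule.smul_mem _ _ hH))
    (Submodule.smul_mem _ _ (sub_mem hX hY)))
    (Submodule.smul_mem _ _ (Submodule.smul_mem _ _ (add_mem hX hY)))

lemma mem_prim_of_isHighestWeight {r : ℕ} {α : Form ℂ (HSpace n) k} (h : IsHighestWeight r α) :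
    α ∈ prim (leftMulHom n) k r := by
  rw [mem_prim]
  have h1 : der (leftMulHom n qI) α = (Complex.I * (r : ℂ)) • α := h.1
  have h2 : der (leftMulHom n qJ) α - Complex.I • der (leftMulHom n qK) α = 0 := h.2
  refine ⟨?_, by rw [opX_apply, h2, smul_zero]⟩
  rw [opH_apply, h1, smul_smul, ← mul_assoc, neg_mul, Complex.I_mul_I]
  simp

lemma isHighestWeight_of_mem_prim {r : ℕ} {α : Form ℂ (HSpace n) k}
    (h : α ∈ prim (leftMulHom n) k r) : IsHighestWeight r α := by
  rw [mem_prim] at h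
  constructor
  · change der (leftMulHom n qI) α = (Complex.I * (r : ℂ)) • α
    rw [der_qI_eq, h.1, smul_smul]
    simp
  · change der (leftMulHom n qJ) α - Complex.I • der (leftMulHom n qK) α = 0
    have h2 := h.2
    rw [opX_apply] at h2
    exact (smul_eq_zero.mp h2).resolve_left (by norm_num)

/-- The isotypic part is itself invariant and contains the highest weight vectors. Conversely, an
invariant subspace is stable under `Y`, a combination of `J` and `K`, so it contains all `Yⁱ p`. -/
lemma mem_modelEC_iff {r : ℕ} {α : Form ℂ (HSpace n) k} :
    (α : HSpace n [⋀^Fin k]→L[ℝ] ℂ) ∈ modelEC n k r ↔ α ∈ typ (leftMulHom n) ℂ k r := by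
  constructor
  · intro h
    refine (Submodule.mem_sInf (M := HSpace n [⋀^Fin k]→L[ℝ] ℂ)).mp h
      (typ (leftMulHom n) ℂ k r) ⟨fun q hq β hβ => ?_, fun β hβ => ?_⟩
    · exact der_mem_typ_complex (leftMulHom n) hβ q hq
    · have h1 := IsSl2Rep.hw_le_iso (Y := opY (leftMulHom n)) (mem_prim_of_isHighestWeight hβ)
      rw [iso_eq_typ] at h1
      exact h1
  · intro h
    refine (Submodule.mem_sInf (M := HSpace n [⋀^Fin k]→L[ℝ] ℂ)).mpr fun W hW => ?_
    obtain ⟨hW1, hW2⟩ := hW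
    rw [← iso_eq_typ] at h
    induction h using Submodule.span_induction with
    | mem v hv =>
      obtain ⟨i, p, hp, rfl⟩ := hv
      induction i with
      | zero => exact hW2 _ (isHighestWeight_of_mem_prim hp)
      | succ i ih =>
        rw [pow_succ', Module.End.mul_apply]
        exact W.smul_mem _ (W.add_mem (hW1 qJ rfl _ ih) (W.smul_mem _ (hW1 qK rfl _ ih)))
    | zero => exact W.zero_mem
    | add u v _ _ hu hv => exact W.add_mem hu hv
    | smul c v _ hv => exact W.smul_mem c hv

lemma mem_modelE_iff {r : ℕ} {α : Form ℝ (HSpace n) k} :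
    (α : HSpace n [⋀^Fin k]→L[ℝ] ℝ) ∈ modelE n k r ↔ α ∈ typ (leftMulHom n) ℝ k r := by
  rw [← toComplex_mem_typ_iff, ← mem_modelEC_iff]
  rfl

/-- The Casimir operator does not depend on the choice of an orthonormal basis of `sp(1)`. -/
lemma cas_conj (m : ℍ[ℝ] →ₐ[ℝ] (E →L[ℝ] E)) (q : ℍ[ℝ]) (hq : ‖q‖ = 1) (α : Form ℝ E k) :
    der (m (q * qI * star q)) (der (m (q * qI * star q)) α)
      + der (m (q * qJ * star q)) (der (m (q * qJ * star q)) α)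
      + der (m (q * qK * star q)) (der (m (q * qK * star q)) α) = cas m α := by
  have hN : q.re ^ 2 + q.imI ^ 2 + q.imJ ^ 2 + q.imK ^ 2 = 1 := by
    have h := Quaternion.normSq_eq_norm_mul_self q
    rw [hq, Quaternion.normSq_def'] at h
    linarith
  have hre : ∀ s : ℍ[ℝ], s.re = 0 → (q * s * star q).re = 0 := fun s hs => by
    simp [hs]; ring
  rw [cas_apply]
  simp only [der_quaternion m _ (hre qI rfl), der_quaternion m _ (hre qJ rfl),
    der_quaternion m _ (hre qK rfl), map_add, map_smul]
  simp only [Quaternion.imI_mul, Quaternion.imJ_mul, Quaternion.imK_mul, Quaternion.re_mul,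
    Quaternion.re_star, Quaternion.imI_star, Quaternion.imJ_star, Quaternion.imK_star, qI_re,
    qI_imI, qI_imJ, qI_imK, qJ_re, qJ_imI, qJ_imJ, qJ_imK, qK_re, qK_imI, qK_imJ, qK_imK,
    RCLike.ofReal_real_eq_id, id]
  generalize q.re = t at *
  generalize q.imI = x at *
  generalize q.imJ = y at *
  generalize q.imK = z at *
  -- The coefficients are those of `R Rᵀ` for the map `R : s ↦ q s q̄` of `Im ℍ`: `|q|⁴ = 1` on the
  -- diagonal and `0` elsewhere.
  match_scalars
  all_goals first
    | linear_combination (t ^ 2 + x ^ 2 + y ^ 2 + z ^ 2 + 1) * hN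
    | ring

/-- `g` intertwines multiplication by `s` with multiplication by `q s q̄`, and by `cas_conj` the
Casimir operator does not notice this rotation. -/
lemma comp_mem_typ {g : HSpace n ≃L[ℝ] HSpace n} (hg : MemSp1GL g) {r : ℕ}
    {α : Form ℝ (HSpace n) k} (hα : α ∈ typ (leftMulHom n) ℝ k r) :
    Form.comp α (g : HSpace n →L[ℝ] HSpace n) ∈ typ (leftMulHom n) ℝ k r := by
  obtain ⟨q, hq, A, hA⟩ := hg
  have hqq : star q * q = 1 := by
    rw [Quaternion.star_mul_self, Quaternion.normSq_eq_norm_mul_self, hq]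
    simp
  have hcomm : ∀ (s : ℍ[ℝ]) (v : HSpace n), (g : HSpace n →L[ℝ] HSpace n) (leftMulHom n s v)
      = leftMulHom n (q * s * star q) ((g : HSpace n →L[ℝ] HSpace n) v) := by
    intro s v
    change g (s • v) = (q * s * star q) • g v
    rw [hA, hA, map_smul, smul_smul, smul_smul, mul_assoc (q * s), hqq, mul_one]
  have hder : ∀ (s : ℍ[ℝ]) (β : Form ℝ (HSpace n) k),
      der (leftMulHom n s) (Form.comp β (g : HSpace n →L[ℝ] HSpace n))
        = Form.comp (der (leftMulHom n (q * s * star q)) β) (g : HSpace n →L[ℝ] HSpace n) :=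
    fun s β => der_comp _ _ _ (hcomm s) β
  rw [mem_typ] at hα ⊢
  have hcas : cas (leftMulHom n) (Form.comp α (g : HSpace n →L[ℝ] HSpace n))
      = Form.comp (cas (leftMulHom n) α) (g : HSpace n →L[ℝ] HSpace n) := by
    rw [← cas_conj (leftMulHom n) q hq α, cas_apply]
    simp only [hder]
    rfl
  rw [hcas, hα]
  rfl

end Model

/-! ### The fibres of the bundles `E_{k,r}` -/

section Fibres

variable {n k : ℕ} {M : Type*} [TopologicalSpace M]
  [ChartedSpace (EuclideanSpace ℝ (Fin (4 * n))) M] {x : M}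

/-- The identification of the covectors at `x` with the forms on `ℍⁿ` given by a frame. -/
def frameEquiv (k : ℕ) (p : TangentSpace (𝓡 (4 * n)) x ≃L[ℝ] HSpace n) :
    Covectors n k x ≃ₗ[ℝ] Form ℝ (HSpace n) k where
  toFun α := α.compContinuousLinearMap (p.symm : HSpace n →L[ℝ] _)
  invFun α := ContinuousAlternatingMap.compContinuousLinearMap (M := HSpace n)
    (M' := TangentSpace (𝓡 (4 * n)) x) α (p : _ →L[ℝ] HSpace n)
  map_add' _ _ := rfl
  map_smul' _ _ := rfl
  left_inv α := by
    ext v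
    exact congrArg α (funext fun i => p.symm_apply_apply (v i))
  right_inv α := by
    ext v
    exact congrArg α (funext fun i => p.apply_symm_apply (v i))

lemma frameEquiv_apply (p : TangentSpace (𝓡 (4 * n)) x ≃L[ℝ] HSpace n) (α : Covectors n k x)
    (v : Fin k → HSpace n) : frameEquiv k p α v = α fun i => p.symm (v i) := rfl

/-- The one-form on `ℍⁿ` that corresponds to a covector in a frame. -/
def frameCov (p : TangentSpace (𝓡 (4 * n)) x ≃L[ℝ] HSpace n)
    (ξ : TangentSpace (𝓡 (4 * n)) x →L[ℝ] ℝ) : Cov ℝ (HSpace n) :=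
  ξ.comp (p.symm : HSpace n →L[ℝ] _)

lemma frameCov_apply (p : TangentSpace (𝓡 (4 * n)) x ≃L[ℝ] HSpace n)
    (ξ : TangentSpace (𝓡 (4 * n)) x →L[ℝ] ℝ) (v : HSpace n) :
    frameCov p ξ v = ξ (p.symm v) := rfl

lemma frameCov_ne_zero (p : TangentSpace (𝓡 (4 * n)) x ≃L[ℝ] HSpace n)
    {ξ : TangentSpace (𝓡 (4 * n)) x →L[ℝ] ℝ} (hξ : ξ ≠ 0) : frameCov p ξ ≠ 0 := by
  intro h
  refine hξ (ContinuousLinearMap.ext fun v => ?_)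
  have h1 : frameCov p ξ (p v) = 0 := by rw [h]; rfl
  rwa [frameCov_apply, p.symm_apply_apply] at h1

lemma exists_frameCov_eq (p : TangentSpace (𝓡 (4 * n)) x ≃L[ℝ] HSpace n) {ξ : Cov ℝ (HSpace n)}
    (hξ : ξ ≠ 0) : ∃ η : TangentSpace (𝓡 (4 * n)) x →L[ℝ] ℝ, η ≠ 0 ∧ frameCov p η = ξ := by
  have h : frameCov p (ContinuousLinearMap.comp (M₂ := HSpace n) ξ (p : _ →L[ℝ] HSpace n)) = ξ := by
    ext v
    exact congrArg ξ (p.apply_symm_apply v)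
  refine ⟨_, fun h0 => hξ ?_, h⟩
  rw [← h, h0]
  rfl

namespace Sp1GLStructure

variable [IsManifold (𝓡 (4 * n)) ∞ M] (Q : Sp1GLStructure n M)

lemma frames_nonempty (x : M) : ∃ p, p ∈ Q.frames x := by
  obtain ⟨U, hU, p, hp, -⟩ := Q.exists_section x
  exact ⟨p x, hp x (mem_of_mem_nhds hU)⟩

/-- Any two frames differ by the structure group, which preserves types, so one frame decides
membership in the infimum over all frames. -/
lemma mem_E_iff {p : TangentSpace (𝓡 (4 * n)) x ≃L[ℝ] HSpace n} (hp : p ∈ Q.frames x) {r : ℕ}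
    {α : Covectors n k x} :
    α ∈ Q.E k r x ↔ frameEquiv k p α ∈ typ (leftMulHom n) ℝ k r := by
  rw [E, Submodule.mem_iInf]
  constructor
  · intro h
    exact mem_modelE_iff.mp ((Submodule.mem_iInf _).mp (h p) hp)
  · intro h p'
    refine (Submodule.mem_iInf _).mpr fun hp' => mem_modelE_iff.mpr ?_
    have h1 := comp_mem_typ ((Q.mem_iff x p' hp' p).mp hp) h
    have h2 : Form.comp (frameEquiv k p α) (p'.symm.trans p : HSpace n →L[ℝ] HSpace n)
        = frameEquiv k p' α := by
      ext v
      exact congrArg α (funext fun i => p.symm_apply_apply (p'.symm (v i)))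
    rw [h2] at h1
    exact h1

/-- A model form of type `r` as a covector. -/
lemma exists_mem_E {x : M} {p : TangentSpace (𝓡 (4 * n)) x ≃L[ℝ] HSpace n} (hp : p ∈ Q.frames x)
    {r : ℕ} {β : Form ℝ (HSpace n) k} (hβ : β ∈ typ (leftMulHom n) ℝ k r) :
    ∃ α : Q.E k r x, frameEquiv k p α = β :=
  ⟨⟨(frameEquiv k p).symm β, (Q.mem_E_iff hp).mpr (by rwa [LinearEquiv.apply_symm_apply])⟩,
    LinearEquiv.apply_symm_apply _ _⟩

lemma E_eq_comap {p : TangentSpace (𝓡 (4 * n)) x ≃L[ℝ] HSpace n} (hp : p ∈ Q.frames x) (r : ℕ) :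
    Q.E k r x = (Submodule.orderIsoMapComap (frameEquiv k p)).symm (typ (leftMulHom n) ℝ k r) := by
  ext α
  exact Q.mem_E_iff hp

lemma iSup_E_eq_comap {p : TangentSpace (𝓡 (4 * n)) x ≃L[ℝ] HSpace n} (hp : p ∈ Q.frames x)
    (r : ℕ) : ⨆ s : ℕ, ⨆ _ : s ≠ r, Q.E k s x =
      (Submodule.orderIsoMapComap (frameEquiv k p)).symm (cotyp (leftMulHom n) ℝ k r) := by
  simp only [cotyp, OrderIso.map_iSup, Q.E_eq_comap hp]

lemma isCompl_E (r : ℕ) (x : M) : IsCompl (Q.E k r x) (⨆ s : ℕ, ⨆ _ : s ≠ r, Q.E k s x) := by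
  obtain ⟨p, hp⟩ := Q.frames_nonempty x
  rw [Q.E_eq_comap hp, Q.iSup_E_eq_comap hp]
  exact OrderIso.isCompl _ (isCompl_typ_real (leftMulHom n) r)

lemma proj_eq_iff {p : TangentSpace (𝓡 (4 * n)) x ≃L[ℝ] HSpace n} (hp : p ∈ Q.frames x) {r : ℕ}
    {α : Covectors n k x} {β : Q.E k r x} :
    Q.proj k r x α = β ↔
      frameEquiv k p α - frameEquiv k p β ∈ cotyp (leftMulHom n) ℝ k r := by
  have h := Q.isCompl_E (k := k) r x
  rw [proj, dif_pos h, ← map_sub]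
  have h1 : Submodule.projectionOnto _ _ h (β : Covectors n k x) = β :=
    Submodule.projectionOnto_apply_left h β
  have h2 : Submodule.projectionOnto _ _ h α = β ↔
      Submodule.projectionOnto _ _ h (α - (β : Covectors n k x)) = 0 := by
    rw [map_sub, h1, sub_eq_zero]
  rw [h2, Submodule.projectionOnto_apply_eq_zero_iff, Q.iSup_E_eq_comap hp]
  rfl

end Sp1GLStructure

end Fibres

/-! ### Smooth sections -/

section Smooth

section

variable {D E F : Type*} [NormedAddCommGroup D] [NormedSpace ℝ D] [NormedAddCommGroup E]
  [NormedSpace ℝ E] [NormedAddCommGroup F] [NormedSpace ℝ F] {k : ℕ} {s : Set D}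

lemma contDiffOn_wedgeFun {f : D → E →L[ℝ] ℝ} {g : D → E [⋀^Fin k]→L[ℝ] ℝ}
    (hf : ContDiffOn ℝ ∞ f s) (hg : ContDiffOn ℝ ∞ g s) :
    ContDiffOn ℝ ∞ (F := E [⋀^Fin (k + 1)]→L[ℝ] ℝ) (fun z => wedgeFun (f z : Cov ℝ E) (g z)) s := by
  have h1 : ContDiffOn ℝ ∞ (fun z => (f z).smulRight (g z)) s := hf.smulRight hg
  exact (ContinuousAlternatingMap.alternatizeUncurryFinCLM (n := k) ℝ E ℝ).contDiff.comp_contDiffOn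
    h1

/-- The pullback of a form along a smooth family of linear maps is smooth. -/
lemma contDiffOn_form_comp [FiniteDimensional ℝ F] {B : D → E →L[ℝ] F} (hB : ContDiffOn ℝ ∞ B s) :
    ∀ {k : ℕ} (β : Form ℝ F k),
      ContDiffOn ℝ ∞ (F := E [⋀^Fin k]→L[ℝ] ℝ) (fun z => Form.comp β (B z)) s
  | 0, β => by
    have h : (fun z => Form.comp β (B z)) = fun _ => Form.comp β (0 : E →L[ℝ] F) := by
      funext z
      exact Form.ext fun v => congrArg β (Subsingleton.elim _ _)
    rw [h]
    exact contDiffOn_const (F := E [⋀^Fin 0]→L[ℝ] ℝ)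
  | k + 1, β => by
    let x : Fin (Module.finrank ℝ F) → Cov ℝ F := fun i =>
      LinearMap.toContinuousLinearMap ((Module.finBasis ℝ F).coord i)
    -- Induction on the degree: the form is a combination of products of one-forms with its
    -- contractions, and pullback respects these products.
    have hb := sum_wedge_contr (Module.finBasis ℝ F) x (fun i v => rfl) β
    have hk : ((k : ℝ) + 1) ≠ 0 := Nat.cast_add_one_ne_zero k
    have h : ∀ z, Form.comp β (B z) = ((k : ℝ) + 1)⁻¹ • ∑ i, wedgeFun (Cov.comp (x i) (B z))
        (Form.comp (contr (Module.finBasis ℝ F i) β) (B z)) := by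
      intro z
      have h1 : β = ((k : ℝ) + 1)⁻¹ • (((k : ℝ) + 1) • β) := by
        rw [smul_smul, inv_mul_cancel₀ hk, one_smul]
      conv_lhs => rw [h1, ← hb]
      ext v
      simp only [Form.comp_apply, Form.smul_apply, Form.sum_apply, ← wedge_eq, ← wedge_comp]
    have h2 : ContDiffOn ℝ ∞ (F := E [⋀^Fin (k + 1)]→L[ℝ] ℝ)
        (fun z => ((k : ℝ) + 1)⁻¹ • ∑ i, (wedgeFun (Cov.comp (x i) (B z))
          (Form.comp (contr (Module.finBasis ℝ F i) β) (B z)) : E [⋀^Fin (k + 1)]→L[ℝ] ℝ)) s := by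
      refine ContDiffOn.const_smul _ (ContDiffOn.sum fun i _ => contDiffOn_wedgeFun
        (f := fun z => Cov.comp (x i) (B z)) ?_ (contDiffOn_form_comp hB _))
      exact ContDiffOn.clm_comp (g := fun _ => (x i : F →L[ℝ] ℝ)) contDiffOn_const hB
    exact ContDiffOn.congr (F := E [⋀^Fin (k + 1)]→L[ℝ] ℝ) h2 fun z _ => h z

end

variable {n : ℕ} {M : Type*} [TopologicalSpace M]
  [ChartedSpace (EuclideanSpace ℝ (Fin (4 * n))) M] [IsManifold (𝓡 (4 * n)) ∞ M]

/-- The inverse of a frame in the coordinates of the chart at `x`. -/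
def frameInChart (p : ∀ y : M, TangentSpace (𝓡 (4 * n)) y ≃L[ℝ] HSpace n) (x : M)
    (e : EuclideanSpace ℝ (Fin (4 * n))) : HSpace n →L[ℝ] EuclideanSpace ℝ (Fin (4 * n)) :=
  (mfderiv (𝓡 (4 * n)) 𝓘(ℝ, EuclideanSpace ℝ (Fin (4 * n))) (extChartAt (𝓡 (4 * n)) x)
    ((extChartAt (𝓡 (4 * n)) x).symm e)).comp
    ((p ((extChartAt (𝓡 (4 * n)) x).symm e)).symm : HSpace n →L[ℝ] _)

/-- A frame in the coordinates of the chart at `x`. -/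
def chartFrame (p : ∀ y : M, TangentSpace (𝓡 (4 * n)) y ≃L[ℝ] HSpace n) (x : M)
    (e : EuclideanSpace ℝ (Fin (4 * n))) : EuclideanSpace ℝ (Fin (4 * n)) →L[ℝ] HSpace n :=
  (p ((extChartAt (𝓡 (4 * n)) x).symm e) : _ →L[ℝ] HSpace n).comp
    (mfderiv 𝓘(ℝ, EuclideanSpace ℝ (Fin (4 * n))) (𝓡 (4 * n))
      (extChartAt (𝓡 (4 * n)) x).symm e)

lemma mfderiv_symm_mfderiv {x : M} {e : EuclideanSpace ℝ (Fin (4 * n))}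
    (he : e ∈ (extChartAt (𝓡 (4 * n)) x).target)
    (v : TangentSpace (𝓡 (4 * n)) ((extChartAt (𝓡 (4 * n)) x).symm e)) :
    mfderiv 𝓘(ℝ, EuclideanSpace ℝ (Fin (4 * n))) (𝓡 (4 * n)) (extChartAt (𝓡 (4 * n)) x).symm e
      (mfderiv (𝓡 (4 * n)) 𝓘(ℝ, EuclideanSpace ℝ (Fin (4 * n))) (extChartAt (𝓡 (4 * n)) x)
        ((extChartAt (𝓡 (4 * n)) x).symm e) v) = v := by
  have : IsManifold (𝓡 (4 * n)) 1 M := IsManifold.of_le (n := ∞) (by simp)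
  have h := mfderivWithin_extChartAt_symm_comp_mfderiv_extChartAt (I := 𝓡 (4 * n)) he
  simp only [modelWithCornersSelf_coe, Set.range_id, mfderivWithin_univ] at h
  exact DFunLike.congr_fun h v

lemma mfderiv_mfderiv_symm {x : M} {e : EuclideanSpace ℝ (Fin (4 * n))}
    (he : e ∈ (extChartAt (𝓡 (4 * n)) x).target) (v : EuclideanSpace ℝ (Fin (4 * n))) :
    mfderiv (𝓡 (4 * n)) 𝓘(ℝ, EuclideanSpace ℝ (Fin (4 * n))) (extChartAt (𝓡 (4 * n)) x)
      ((extChartAt (𝓡 (4 * n)) x).symm e)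
      (mfderiv 𝓘(ℝ, EuclideanSpace ℝ (Fin (4 * n))) (𝓡 (4 * n)) (extChartAt (𝓡 (4 * n)) x).symm e
        v) = v := by
  have : IsManifold (𝓡 (4 * n)) 1 M := IsManifold.of_le (n := ∞) (by simp)
  have h := mfderiv_extChartAt_comp_mfderivWithin_extChartAt_symm (I := 𝓡 (4 * n)) he
  simp only [modelWithCornersSelf_coe, Set.range_id, mfderivWithin_univ] at h
  exact DFunLike.congr_fun h v

lemma frameInChart_comp_chartFrame
    (p : ∀ y : M, TangentSpace (𝓡 (4 * n)) y ≃L[ℝ] HSpace n) {x : M}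
    {e : EuclideanSpace ℝ (Fin (4 * n))} (he : e ∈ (extChartAt (𝓡 (4 * n)) x).target) :
    (frameInChart p x e).comp (chartFrame p x e) = ContinuousLinearMap.id ℝ _ := by
  refine ContinuousLinearMap.ext fun v => ?_
  refine Eq.trans ?_ (mfderiv_mfderiv_symm he v)
  exact congrArg _ ((p _).symm_apply_apply _)

lemma chartFrame_comp_frameInChart
    (p : ∀ y : M, TangentSpace (𝓡 (4 * n)) y ≃L[ℝ] HSpace n) {x : M}
    {e : EuclideanSpace ℝ (Fin (4 * n))} (he : e ∈ (extChartAt (𝓡 (4 * n)) x).target) :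
    (chartFrame p x e).comp (frameInChart p x e) = ContinuousLinearMap.id ℝ _ := by
  refine ContinuousLinearMap.ext fun v => ?_
  refine Eq.trans ?_ ((p ((extChartAt (𝓡 (4 * n)) x).symm e)).apply_symm_apply v)
  exact congrArg (p ((extChartAt (𝓡 (4 * n)) x).symm e)) (mfderiv_symm_mfderiv he _)

/-- Applied to a fixed `v`, this is the vector field `p⁻¹ v` read in the trivialization of the
tangent bundle at `x`, whose fibre maps are the derivatives of the chart. -/
lemma contDiffOn_frameInChart {p : ∀ y : M, TangentSpace (𝓡 (4 * n)) y ≃L[ℝ] HSpace n} {V : Set M}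
    (hV : IsOpen V) (hp : SmoothFrameOn p V) (x : M) :
    ContDiffOn ℝ ∞ (frameInChart p x)
      ((extChartAt (𝓡 (4 * n)) x).target ∩ (extChartAt (𝓡 (4 * n)) x).symm ⁻¹' V) := by
  have : IsManifold (𝓡 (4 * n)) 1 M := IsManifold.of_le (n := ∞) (by simp)
  refine contDiffOn_clm_apply.mpr fun v => ?_
  have hsrc : ∀ y ∈ (chartAt (EuclideanSpace ℝ (Fin (4 * n))) x).source,
      (trivializationAt (EuclideanSpace ℝ (Fin (4 * n))) (TangentSpace (𝓡 (4 * n))) x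
        ⟨y, (p y).symm v⟩).2 = mfderiv (𝓡 (4 * n)) 𝓘(ℝ, EuclideanSpace ℝ (Fin (4 * n)))
          (extChartAt (𝓡 (4 * n)) x) y ((p y).symm v) := by
    intro y hy
    rw [← TangentBundle.continuousLinearMapAt_trivializationAt hy]
    exact (Bundle.Trivialization.continuousLinearMapAt_apply_of_mem (R := ℝ) _
      (by simpa using hy) _).symm
  have h1 : ContMDiffOn (𝓡 (4 * n)) 𝓘(ℝ, EuclideanSpace ℝ (Fin (4 * n))) ∞
      (fun y => (trivializationAt (EuclideanSpace ℝ (Fin (4 * n))) (TangentSpace (𝓡 (4 * n))) x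
        ⟨y, (p y).symm v⟩).2) (V ∩ (chartAt (EuclideanSpace ℝ (Fin (4 * n))) x).source) := by
    refine (Bundle.Trivialization.contMDiffOn_section_iff _
      (hV.inter (chartAt _ x).open_source) ?_).mp ((hp v).mono Set.inter_subset_left)
    simp
  have h2 := h1.comp
    (s := (extChartAt (𝓡 (4 * n)) x).target ∩ (extChartAt (𝓡 (4 * n)) x).symm ⁻¹' V)
    ((contMDiffOn_extChartAt_symm (n := ∞) x).mono Set.inter_subset_left) fun e he =>
      ⟨he.2, by simpa using (extChartAt (𝓡 (4 * n)) x).map_target he.1⟩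
  refine (contMDiffOn_iff_contDiffOn.mp h2).congr fun e he => ?_
  exact (hsrc _ (by simpa using (extChartAt (𝓡 (4 * n)) x).map_target he.1)).symm

/-- Pointwise inverse of the smooth family `frameInChart`, and inversion of invertible operators is
smooth. -/
lemma contDiffOn_chartFrame {p : ∀ y : M, TangentSpace (𝓡 (4 * n)) y ≃L[ℝ] HSpace n} {V : Set M}
    (hV : IsOpen V) (hp : SmoothFrameOn p V) (x : M) :
    ContDiffOn ℝ ∞ (chartFrame p x)
      ((extChartAt (𝓡 (4 * n)) x).target ∩ (extChartAt (𝓡 (4 * n)) x).symm ⁻¹' V) := by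
  intro e he
  have hinv : ∀ e' ∈ (extChartAt (𝓡 (4 * n)) x).target,
      (frameInChart p x e').inverse = chartFrame p x e' := fun e' he' =>
    ContinuousLinearMap.inverse_eq (frameInChart_comp_chartFrame p he')
      (chartFrame_comp_frameInChart p he')
  have h : (frameInChart p x e).IsInvertible :=
    ContinuousLinearMap.IsInvertible.of_inverse (frameInChart_comp_chartFrame p he.1)
      (chartFrame_comp_frameInChart p he.1)
  exact (h.contDiffAt_map_inverse.comp_contDiffWithinAt e
    (contDiffOn_frameInChart hV hp x e he)).congr (fun e' he' => (hinv e' he'.1).symm)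
      (hinv e he.1).symm

end Smooth

/-! ### The principal symbol -/

section Symbol

variable {n k : ℕ} {M : Type*} [TopologicalSpace M]
  [ChartedSpace (EuclideanSpace ℝ (Fin (4 * n))) M] [IsManifold (𝓡 (4 * n)) ∞ M]

/-- The exterior derivative of `f s` at a zero of `f`, in a frame. -/
lemma frameEquiv_extD_smul {x : M} (p : TangentSpace (𝓡 (4 * n)) x ≃L[ℝ] HSpace n) {f : M → ℝ}
    {s : ∀ y : M, Covectors n k y} (hf : ContMDiff (𝓡 (4 * n)) 𝓘(ℝ, ℝ) ∞ f) (hfx : f x = 0)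
    (hs : SmoothForm s) :
    frameEquiv (k + 1) p (extD (fun y => f y • s y) x) =
      wedge (frameCov p (mfderiv (𝓡 (4 * n)) 𝓘(ℝ, ℝ) f x)) (frameEquiv k p (s x)) := by
  have : IsManifold (𝓡 (4 * n)) 1 M := IsManifold.of_le (n := ∞) (by simp)
  set φ := extChartAt (𝓡 (4 * n)) x with hφ
  have hx : φ.symm (φ x) = x := extChartAt_to_inv x
  have htgt : φ x ∈ φ.target := mem_extChartAt_target x
  have hopen : IsOpen φ.target := isOpen_extChartAt_target x
  have hL : DifferentiableAt ℝ (localRep s x) (φ x) :=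
    ((hs x).contDiffAt (hopen.mem_nhds htgt)).differentiableAt (by simp)
  have hsymm : MDifferentiableAt 𝓘(ℝ, EuclideanSpace ℝ (Fin (4 * n))) (𝓡 (4 * n)) φ.symm (φ x) :=
    ((contMDiffOn_extChartAt_symm (n := ∞) x).contMDiffAt (hopen.mem_nhds htgt)).mdifferentiableAt
      (by simp)
  have hfd : MDifferentiableAt (𝓡 (4 * n)) 𝓘(ℝ, ℝ) f (φ.symm (φ x)) :=
    hf.contMDiffAt.mdifferentiableAt (by simp)
  have hg : DifferentiableAt ℝ (f ∘ φ.symm) (φ x) :=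
    mdifferentiableAt_iff_differentiableAt.mp (hfd.comp _ hsymm)
  have hid : mfderiv (𝓡 (4 * n)) 𝓘(ℝ, EuclideanSpace ℝ (Fin (4 * n))) φ x
      = ContinuousLinearMap.id ℝ (EuclideanSpace ℝ (Fin (4 * n))) := mfderiv_extChartAt_self
  have hid' : ∀ v : EuclideanSpace ℝ (Fin (4 * n)),
      mfderiv 𝓘(ℝ, EuclideanSpace ℝ (Fin (4 * n))) (𝓡 (4 * n)) φ.symm (φ x) v = v := by
    intro v
    have h := mfderivWithin_range_extChartAt_symm (I := 𝓡 (4 * n)) (x := x)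
    simp only [modelWithCornersSelf_coe, Set.range_id, mfderivWithin_univ] at h
    exact DFunLike.congr_fun h v
  have hval : ∀ v : EuclideanSpace ℝ (Fin (4 * n)), fderiv ℝ (f ∘ φ.symm) (φ x)
      (mfderiv (𝓡 (4 * n)) 𝓘(ℝ, EuclideanSpace ℝ (Fin (4 * n))) φ x v)
      = mfderiv (𝓡 (4 * n)) 𝓘(ℝ, ℝ) f x v := by
    intro v
    have h1 := mfderiv_comp_of_eq (hf.contMDiffAt.mdifferentiableAt (by simp)) hsymm hx
    rw [mfderiv_eq_fderiv] at h1
    rw [h1, hid]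
    have hf' : ∀ y, y = x → ∀ w : EuclideanSpace ℝ (Fin (4 * n)),
        mfderiv (𝓡 (4 * n)) 𝓘(ℝ, ℝ) f y w = mfderiv (𝓡 (4 * n)) 𝓘(ℝ, ℝ) f x w := by
      rintro y rfl w; rfl
    refine Eq.trans ?_ (hf' _ hx v)
    exact congrArg (mfderiv (𝓡 (4 * n)) 𝓘(ℝ, ℝ) f (φ.symm (φ x))) (hid' v)
  have hrep : localRep (fun y => f y • s y) x = fun e => (f ∘ φ.symm) e • localRep s x e := rfl
  -- As `f` vanishes at `x`, the term with the derivative of `s` drops out of the product rule.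
  have hder : fderiv ℝ (localRep (fun y => f y • s y) x) (φ x)
      = (fderiv ℝ (f ∘ φ.symm) (φ x)).smulRight (localRep s x (φ x)) := by
    rw [hrep, fderiv_fun_smul hg hL]
    simp [hx, hfx]
  have hsx : ∀ v : Fin k → EuclideanSpace ℝ (Fin (4 * n)),
      localRep s x (φ x) (fun i =>
        mfderiv (𝓡 (4 * n)) 𝓘(ℝ, EuclideanSpace ℝ (Fin (4 * n))) φ x (v i)) = s x v := by
    intro v
    have hs' : ∀ y, y = x → ∀ w : Fin k → EuclideanSpace ℝ (Fin (4 * n)), s y w = s x w := by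
      rintro y rfl w; rfl
    rw [hid]
    refine Eq.trans ?_ (hs' _ hx v)
    exact congrArg (s (φ.symm (φ x))) (funext fun i => hid' (v i))
  ext v
  rw [wedge_apply]
  have h1 : extD (fun y => f y • s y) x (fun i => p.symm (v i)) =
      ∑ i : Fin (k + 1), (-1) ^ (i : ℕ) • (fderiv ℝ (localRep (fun y => f y • s y) x) (φ x)
        (mfderiv (𝓡 (4 * n)) 𝓘(ℝ, EuclideanSpace ℝ (Fin (4 * n))) φ x (p.symm (v i))))
        (i.removeNth fun i => mfderiv (𝓡 (4 * n)) 𝓘(ℝ, EuclideanSpace ℝ (Fin (4 * n))) φ x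
          (p.symm (v i))) :=
    ContinuousAlternatingMap.alternatizeUncurryFin_apply _ _
  rw [frameEquiv_apply, h1]
  refine Finset.sum_congr rfl fun i _ => ?_
  rw [hder, zsmul_eq_mul]
  push_cast
  refine congrArg _ (congrArg₂ (· * ·) (hval _) (hsx _))

variable [T2Space M]

/-- There is a smooth function with a given differential at a given zero. -/
lemma exists_smooth_function (x : M) (ξ : TangentSpace (𝓡 (4 * n)) x →L[ℝ] ℝ) :
    ∃ f : M → ℝ, ContMDiff (𝓡 (4 * n)) 𝓘(ℝ, ℝ) ∞ f ∧ f x = 0 ∧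
      mfderiv (𝓡 (4 * n)) 𝓘(ℝ, ℝ) f x = ξ := by
  have : IsManifold (𝓡 (4 * n)) 1 M := IsManifold.of_le (n := ∞) (by simp)
  obtain ⟨χ, -, -⟩ := (SmoothBumpFunction.nhds_basis_tsupport (I := 𝓡 (4 * n)) x).mem_iff.mp
    Filter.univ_mem
  let ξ' : EuclideanSpace ℝ (Fin (4 * n)) →L[ℝ] ℝ := ξ
  let g : M → ℝ := fun y => ξ' (extChartAt (𝓡 (4 * n)) x y - extChartAt (𝓡 (4 * n)) x x)
  have hdiff : ContDiff ℝ ∞ fun e => ξ' (e - extChartAt (𝓡 (4 * n)) x x) :=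
    ξ'.contDiff.comp (contDiff_id.sub contDiff_const)
  have hg : ContMDiffOn (𝓡 (4 * n)) 𝓘(ℝ, ℝ) ∞ g
      (chartAt (EuclideanSpace ℝ (Fin (4 * n))) x).source :=
    hdiff.contMDiff.comp_contMDiffOn contMDiffOn_extChartAt
  refine ⟨fun y => χ y • g y, χ.contMDiff_smul hg, by simp [g], ?_⟩
  have heq : (fun y => χ y • g y) =ᶠ[𝓝 x] g := by
    filter_upwards [χ.eventuallyEq_one] with y hy
    rw [hy]
    exact one_smul ℝ _
  rw [heq.mfderiv_eq]
  have h1 : mfderiv (𝓡 (4 * n)) 𝓘(ℝ, ℝ) g x = _ :=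
    mfderiv_comp (I' := 𝓘(ℝ, EuclideanSpace ℝ (Fin (4 * n)))) x
      (g := fun e => ξ' (e - extChartAt (𝓡 (4 * n)) x x))
      (hdiff.contMDiff.mdifferentiable (by simp) _)
      (mdifferentiableAt_extChartAt (mem_chart_source _ x))
  rw [h1, mfderiv_extChartAt_self, mfderiv_eq_fderiv]
  have h2 : HasFDerivAt (fun e => ξ' (e - extChartAt (𝓡 (4 * n)) x x)) ξ'
      (extChartAt (𝓡 (4 * n)) x x) :=
    ξ'.hasFDerivAt.comp _ ((hasFDerivAt_id _).sub_const _)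
  rw [h2.fderiv]
  rfl

/-! ### The symbol as projected multiplication by the covector -/

namespace Sp1GLStructure

variable (Q : Sp1GLStructure n M)

/-- There is a smooth section with a given value at a given point. -/
lemma exists_smooth_section {r : ℕ} {x : M} (α : Q.E k r x) :
    ∃ s : ∀ y : M, Q.E k r y, SmoothForm (fun y => (s y : Covectors n k y)) ∧ s x = α := by
  classical
  obtain ⟨U, hU, p, hp, hsmooth⟩ := Q.exists_section x
  obtain ⟨χ, -, hχ⟩ := (SmoothBumpFunction.nhds_basis_tsupport (I := 𝓡 (4 * n)) x).mem_iff.mp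
    (interior_mem_nhds.mpr hU)
  set β := frameEquiv k (p x) (α : Covectors n k x) with hβ
  have hβmem : β ∈ typ (leftMulHom n) ℝ k r :=
    (Q.mem_E_iff (hp x (mem_of_mem_nhds hU))).mp α.2
  -- The section is constant in the local frame and cut off by `χ`; off the support of `χ`, where
  -- `p` need not belong to `Q`, it is zero.
  have hmem : ∀ y, χ y • (frameEquiv k (p y)).symm β ∈ Q.E k r y := by
    intro y
    by_cases hy : y ∈ tsupport χ
    · refine Submodule.smul_mem _ _ ((Q.mem_E_iff (hp y (interior_subset (hχ hy)))).mpr ?_)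
      rwa [LinearEquiv.apply_symm_apply]
    · rw [image_eq_zero_of_notMem_tsupport hy, zero_smul]
      exact zero_mem _
  refine ⟨fun y => ⟨_, hmem y⟩, ?_, ?_⟩
  · intro x' e he
    have hsymm := contMDiffOn_extChartAt_symm (I := 𝓡 (4 * n)) (n := ∞) x'
    have hW : ∀ V : Set M, IsOpen V → IsOpen ((extChartAt (𝓡 (4 * n)) x').target ∩
        (extChartAt (𝓡 (4 * n)) x').symm ⁻¹' V) := fun V hV =>
      (continuousOn_extChartAt_symm x').isOpen_inter_preimage (isOpen_extChartAt_target x') hV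
    have hrep : localRep (fun y => χ y • (frameEquiv k (p y)).symm β) x'
        = fun e => (χ ((extChartAt (𝓡 (4 * n)) x').symm e)) •
          (Form.comp β (chartFrame p x' e) : EuclideanSpace ℝ (Fin (4 * n)) [⋀^Fin k]→L[ℝ] ℝ) :=
      rfl
    change ContDiffWithinAt ℝ ∞ (localRep (fun y => χ y • (frameEquiv k (p y)).symm β) x') _ e
    by_cases hy : (extChartAt (𝓡 (4 * n)) x').symm e ∈ tsupport χ
    · have hopen := hW _ (isOpen_interior (s := U))
      have he' : e ∈ (extChartAt (𝓡 (4 * n)) x').target ∩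
        (extChartAt (𝓡 (4 * n)) x').symm ⁻¹' interior U := ⟨he, hχ hy⟩
      have h1 : ContDiffOn ℝ ∞ (fun e => χ ((extChartAt (𝓡 (4 * n)) x').symm e))
          ((extChartAt (𝓡 (4 * n)) x').target ∩
            (extChartAt (𝓡 (4 * n)) x').symm ⁻¹' interior U) :=
        (contMDiffOn_iff_contDiffOn.mp (χ.contMDiff.comp_contMDiffOn hsymm)).mono
          Set.inter_subset_left
      have h2 := contDiffOn_form_comp (contDiffOn_chartFrame isOpen_interior
        (fun v => (hsmooth v).mono interior_subset) x') β
      rw [hrep]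
      exact ((h1.smul h2).contDiffAt (hopen.mem_nhds he')).contDiffWithinAt
    · have hopen := hW _ (isClosed_tsupport χ).isOpen_compl
      have h0 : localRep (fun y => χ y • (frameEquiv k (p y)).symm β) x' =ᶠ[𝓝 e] fun _ => 0 := by
        filter_upwards [hopen.mem_nhds ⟨he, hy⟩] with e' he'
        rw [hrep]
        dsimp only
        rw [image_eq_zero_of_notMem_tsupport he'.2, zero_smul]
        rfl
      exact (contDiffAt_const.congr_of_eventuallyEq h0).contDiffWithinAt
  · refine Subtype.ext ?_
    dsimp only
    rw [χ.eq_one, one_smul, hβ, LinearEquiv.symm_apply_apply]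

/-- The principal symbol is the projection of the product with the covector. -/
lemma symbol_apply {x : M} (p : TangentSpace (𝓡 (4 * n)) x ≃L[ℝ] HSpace n) {r : ℕ}
    (ξ : TangentSpace (𝓡 (4 * n)) x →L[ℝ] ℝ) (α : Q.E k r x) :
    Q.symbol k r x ξ α = Q.proj (k + 1) (r + 1) x
      ((frameEquiv (k + 1) p).symm (wedge (frameCov p ξ) (frameEquiv k p α))) := by
  have hD : ∀ (f : M → ℝ) (s : ∀ y : M, Q.E k r y), ContMDiff (𝓡 (4 * n)) 𝓘(ℝ, ℝ) ∞ f → f x = 0 →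
      mfderiv (𝓡 (4 * n)) 𝓘(ℝ, ℝ) f x = ξ → SmoothForm (fun y => (s y : Covectors n k y)) →
      Q.opD k r (fun y => f y • (s y : Covectors n k y)) x = Q.proj (k + 1) (r + 1) x
        ((frameEquiv (k + 1) p).symm (wedge (frameCov p ξ) (frameEquiv k p (s x)))) := by
    intro f s hf hfx hξ hs
    rw [opD, ← hξ, ← frameEquiv_extD_smul p hf hfx hs, LinearEquiv.symm_apply_apply]
  have hex : ∃ σ, Q.IsPrincipalSymbol k r x ξ σ := by
    refine ⟨Q.proj (k + 1) (r + 1) x ∘ₗ (frameEquiv (k + 1) p).symm.toLinearMap ∘ₗ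
      wedge (frameCov p ξ) ∘ₗ (frameEquiv k p).toLinearMap ∘ₗ (Q.E k r x).subtype, ?_⟩
    intro f s hf hfx hξ hs
    exact (hD f s hf hfx hξ hs).symm
  -- Every covector is a differential and every fibre element a value of a smooth section, so the
  -- defining property determines the chosen symbol.
  obtain ⟨f, hf, hfx, hξ⟩ := exists_smooth_function x ξ
  obtain ⟨s, hs, rfl⟩ := Q.exists_smooth_section α
  rw [symbol, dif_pos hex, hex.choose_spec f s hf hfx hξ hs, hD f s hf hfx hξ hs]

lemma symbol_eq_iff {x : M} {p : TangentSpace (𝓡 (4 * n)) x ≃L[ℝ] HSpace n}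
    (hp : p ∈ Q.frames x) {r : ℕ} (ξ : TangentSpace (𝓡 (4 * n)) x →L[ℝ] ℝ) (α : Q.E k r x)
    (β : Q.E (k + 1) (r + 1) x) :
    Q.symbol k r x ξ α = β ↔
      wedge (frameCov p ξ) (frameEquiv k p α) - frameEquiv (k + 1) p β
        ∈ cotyp (leftMulHom n) ℝ (k + 1) (r + 1) := by
  rw [Q.symbol_apply p, Q.proj_eq_iff hp, LinearEquiv.apply_symm_apply]

lemma symbol_eq_zero_iff {x : M} {p : TangentSpace (𝓡 (4 * n)) x ≃L[ℝ] HSpace n}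
    (hp : p ∈ Q.frames x) {r : ℕ} (ξ : TangentSpace (𝓡 (4 * n)) x →L[ℝ] ℝ) (α : Q.E k r x) :
    Q.symbol k r x ξ α = 0 ↔
      wedge (frameCov p ξ) (frameEquiv k p α) ∈ cotyp (leftMulHom n) ℝ (k + 1) (r + 1) := by
  rw [Q.symbol_eq_iff hp, Submodule.coe_zero, map_zero, sub_zero]

lemma exact_symbol_iff {x : M} {p : TangentSpace (𝓡 (4 * n)) x ≃L[ℝ] HSpace n}
    (hp : p ∈ Q.frames x) {r : ℕ} (ξ : TangentSpace (𝓡 (4 * n)) x →L[ℝ] ℝ) :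
    Function.Exact (Q.symbol k r x ξ) (Q.symbol (k + 1) (r + 1) x ξ) ↔
      ∀ β ∈ typ (leftMulHom n) ℝ (k + 1) (r + 1),
        wedge (frameCov p ξ) β ∈ cotyp (leftMulHom n) ℝ (k + 2) (r + 2) ↔
          ∃ γ ∈ typ (leftMulHom n) ℝ k r,
            wedge (frameCov p ξ) γ - β ∈ cotyp (leftMulHom n) ℝ (k + 1) (r + 1) := by
  constructor
  · intro h β hβ
    obtain ⟨β, rfl⟩ := Q.exists_mem_E hp hβ
    refine (Q.symbol_eq_zero_iff hp ξ β).symm.trans ((h β).trans ⟨?_, ?_⟩)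
    · rintro ⟨γ, hγ⟩
      exact ⟨_, (Q.mem_E_iff hp).mp γ.2, (Q.symbol_eq_iff hp ξ γ β).mp hγ⟩
    · rintro ⟨γ, hγ, hγβ⟩
      obtain ⟨γ, rfl⟩ := Q.exists_mem_E hp hγ
      exact ⟨γ, (Q.symbol_eq_iff hp ξ γ β).mpr hγβ⟩
  · intro h β
    refine (Q.symbol_eq_zero_iff hp ξ β).trans
      ((h _ ((Q.mem_E_iff hp).mp β.2)).trans ⟨?_, ?_⟩)
    · rintro ⟨γ, hγ, hγβ⟩
      obtain ⟨γ, rfl⟩ := Q.exists_mem_E hp hγ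
      exact ⟨γ, (Q.symbol_eq_iff hp ξ γ β).mpr hγβ⟩
    · rintro ⟨γ, hγ⟩
      exact ⟨_, (Q.mem_E_iff hp).mp γ.2, (Q.symbol_eq_iff hp ξ γ β).mp hγ⟩

lemma injective_symbol_iff {x : M} {p : TangentSpace (𝓡 (4 * n)) x ≃L[ℝ] HSpace n}
    (hp : p ∈ Q.frames x) {r : ℕ} (ξ : TangentSpace (𝓡 (4 * n)) x →L[ℝ] ℝ) :
    Function.Injective (Q.symbol k r x ξ) ↔
      ∀ β ∈ typ (leftMulHom n) ℝ k r,
        wedge (frameCov p ξ) β ∈ cotyp (leftMulHom n) ℝ (k + 1) (r + 1) → β = 0 := by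
  rw [injective_iff_map_eq_zero]
  constructor
  · intro h β hβ h0
    obtain ⟨β, rfl⟩ := Q.exists_mem_E hp hβ
    rw [h β ((Q.symbol_eq_zero_iff hp ξ β).mpr h0), Submodule.coe_zero, map_zero]
  · intro h β hβ
    have h0 := h _ ((Q.mem_E_iff hp).mp β.2) ((Q.symbol_eq_zero_iff hp ξ β).mp hβ)
    exact Subtype.ext ((LinearEquiv.map_eq_zero_iff _).mp h0)

/-- Ellipticity where the type is at least `2`, and for the complex of functions also where it
is `1`. -/
lemma ellipticAt_succ {k j : ℕ} (h : k = 0 ∨ 0 < j) : Q.EllipticAt k (j + 1) := by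
  intro x ξ hξ
  obtain ⟨p, hp⟩ := Q.frames_nonempty x
  exact (Q.exact_symbol_iff hp ξ).mpr fun β hβ =>
    wedge_mem_cotyp_iff (leftMulHom n) (frameCov_ne_zero p hξ) (by omega) hβ

lemma ellipticAt_zero_zero : Q.EllipticAt 0 0 := by
  intro x ξ hξ
  obtain ⟨p, hp⟩ := Q.frames_nonempty x
  exact (Q.injective_symbol_iff hp ξ).mpr fun β hβ h =>
    eq_zero_of_wedge_mem_cotyp_zero (leftMulHom n) (frameCov_ne_zero p hξ) hβ h

lemma ellipticAt_one_zero : Q.EllipticAt 1 0 := by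
  intro x ξ hξ
  obtain ⟨p, hp⟩ := Q.frames_nonempty x
  exact (Q.injective_symbol_iff hp ξ).mpr fun β hβ h =>
    eq_zero_of_wedge_mem_cotyp_two (leftMulHom n) (frameCov_ne_zero p hξ) hβ h

end Sp1GLStructure

/-- The real part of a coordinate of `ℍⁿ`. -/
def reCoord (n : ℕ) (i : Fin n) : Cov ℝ (HSpace n) :=
  LinearMap.toContinuousLinearMap
    ((QuaternionAlgebra.reₗ (-1 : ℝ) 0 (-1)).comp (LinearMap.proj i : HSpace n →ₗ[ℝ] ℍ[ℝ]))

lemma reCoord_leftMulHom_single (i j : Fin n) (q : ℍ[ℝ]) :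
    reCoord n i (leftMulHom n q (Pi.single j 1)) = if i = j then q.re else 0 := by
  change (q • (Pi.single j (1 : ℍ[ℝ]) : HSpace n) i).re = _
  by_cases h : i = j
  · subst h; simp
  · simp [h]

/-! ### Failure of ellipticity at the first two terms -/

namespace Sp1GLStructure

variable (Q : Sp1GLStructure n M) [Nonempty M]

lemma not_ellipticAt_zero {k : ℕ} (hk : 2 ≤ k) (hkn : k ≤ 2 * n) : ¬ Q.EllipticAt k 0 := by
  intro h
  obtain ⟨x⟩ := ‹Nonempty M›
  obtain ⟨p, hp⟩ := Q.frames_nonempty x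
  obtain ⟨N, rfl⟩ := Nat.exists_eq_add_of_le' hk
  obtain ⟨ξ, hξ, β, hβ, hβ0, h0⟩ := exists_wedge_eq_zero (leftMulHom n) (reCoord n)
    (fun i => Pi.single i 1) reCoord_leftMulHom_single (by omega) hkn
  obtain ⟨η, hη, rfl⟩ := exists_frameCov_eq p hξ
  refine hβ0 ((Q.injective_symbol_iff hp η).mp (h x η hη) β hβ ?_)
  rw [h0]
  exact zero_mem _

lemma not_ellipticAt_one {k : ℕ} (hk : 1 ≤ k) (hkn : k < 2 * n) : ¬ Q.EllipticAt k 1 := by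
  intro h
  obtain ⟨x⟩ := ‹Nonempty M›
  obtain ⟨p, hp⟩ := Q.frames_nonempty x
  obtain ⟨N, rfl⟩ := Nat.exists_eq_add_of_le' hk
  obtain ⟨ξ, hξ, β, hβ, h0, hne⟩ := exists_not_exact (leftMulHom n) (reCoord n)
    (fun i => Pi.single i 1) reCoord_leftMulHom_single (by omega) (N := N) (by omega)
  obtain ⟨η, hη, rfl⟩ := exists_frameCov_eq p hξ
  exact hne (((Q.exact_symbol_iff hp η).mp (h x η hη) β hβ).mp h0)

end Sp1GLStructure

end Symbol

end QuaternionicForms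

end

theorem theorem5p1 {n : ℕ} {M : Type*} [TopologicalSpace M] [T2Space M]
    [SecondCountableTopology M] [Nonempty M]
    [ChartedSpace (EuclideanSpace ℝ (Fin (4 * n))) M] [IsManifold (𝓡 (4 * n)) ∞ M]
    (Q : QuaternionicForms.Sp1GLStructure n M) (hQ : Q.IsQuaternionic)
    (k : ℕ) (hk : k ≤ 2 * n) :
    (2 * k ≥ 4 →
      ¬ Q.EllipticAt k 0 ∧ (k < 2 * n → ¬ Q.EllipticAt k 1) ∧
        ∀ j : ℕ, 2 ≤ j → k + j ≤ 2 * n → Q.EllipticAt k j) ∧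
    (k = 1 →
      Q.EllipticAt k 0 ∧ ¬ Q.EllipticAt k 1 ∧
        ∀ j : ℕ, 2 ≤ j → k + j ≤ 2 * n → Q.EllipticAt k j) ∧
    (k = 0 → ∀ j : ℕ, k + j ≤ 2 * n → Q.EllipticAt k j) := by
  -- For `j ≥ 2` the term before `E_{2k+j,j}` has positive type `j - 1`, which is what exactness
  -- requires.
  have hj : ∀ j : ℕ, 2 ≤ j → k + j ≤ 2 * n → Q.EllipticAt k j := by
    intro j hj _
    obtain ⟨j, rfl⟩ := Nat.exists_eq_add_of_le' (show 1 ≤ j by omega)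
    exact Q.ellipticAt_succ (Or.inr (by omega))
  refine ⟨fun h => ⟨Q.not_ellipticAt_zero (by omega) hk, fun hlt => ?_, hj⟩, ?_, ?_⟩
  · exact Q.not_ellipticAt_one (by omega) hlt
  · rintro rfl
    exact ⟨Q.ellipticAt_one_zero, Q.not_ellipticAt_one le_rfl (by omega), hj⟩
  · rintro rfl j _
    rcases j with _ | j
    · exact Q.ellipticAt_zero_zero
    · exact Q.ellipticAt_succ (Or.inl rfl)
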